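/- Let $n\ge 4$, let $U\subseteq\mathbb R^n$ be open, let $\eta_{ab}=\mathrm{diag}(-1,1,\dots,1)$, let $\mathcal H$ be a smooth function on $U$ that does not vanish identically on any nonempty open subset of $U$, and let $k_a$ be a smooth nowhere zero 1-form on $U$ with $\eta^{ab}k_ak_b=0$. Consider the Kerr--Schild metric $g_{ab}=\eta_{ab}-2\mathcal H k_ak_b$ and put $k^a=g^{ab}k_b$. A null frame at a point consists of $k$, a null vector $l^a$ with $k_al^a=1$, and $n-2$ vectors $m^{(i)a}$, orthonormal with respect to $g$ and orthogonal to $k$ and $l$. With respect to such a frame the optical matrix is $L_{ij}=k_{a;b}m^{(i)a}m^{(j)b}$ (covariant derivative of $g$) and the expansion is $\theta=L_{ii}/(n-2)$. Suppose that $g$ is a vacuum metric, $R_{ab}=0$ on $U$, and that $k$ is expanding: at every point of $U$, $\theta\ne0$ in some null frame. Then: 1. At every point of $U$ and in every null frame, $L$ is a normal matrix: $LL^T=L^TL$. 2. If $V\subseteq U$ is open and $g$ is not flat on $V$ (its Riemann tensor does not vanish identically on $V$), then there is a point of $V$ at which $\operatorname{rank}L\ge 2$ in every null frame. 3. $k$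 is geodetic: there is a smooth nowhere zero function $c$ on $U$ such that $ck$ is geodetic and affinely parametrized, i.e. $\hat k=ck$ satisfies $\hat k^b\hat k_{a;b}=0$. 4. Let $c$ be any such function, $\hat k=ck$ and $\hat{\mathcal H}=\mathcal H/c^2$ (so $g_{ab}=\eta_{ab}-2\hat{\mathcal H}\hat k_a\hat k_b$). There is a smooth nowhere zero function $r$ on $U$ with $\hat k^a\partial_ar=1$ (an affine parameter along $\hat k^a$) such that along every integral curve $\gamma:I\to U$ of $\hat k^a$ ($I$ an open interval) there are integers $0\le 2p\le m\le n-2$, real constants $a^0_{(2)},\dots,a^0_{(2p)}$ and $\mathcal H_0$ (independent of $r$), and a null frame $\hat k,l,m^{(i)}$ along $\gamma$, smooth in the parameter of $\gamma$, in which for all points of $\gamma$ the optical matrix $L$ of $\hat k$ has rank $m$ and is block-diagonal, with $p$ blocks of size $2\times2$ $$\begin{pmatrix} s_{(2\mu)} & A_{(2\mu)}\\ -A_{(2\mu)} & s_{(2\mu)}\end{pmatrix},\qquad s_{(2\mu)}=\frac{r}{r^2+(a^0_{(2\mu)})^2},\quad A_{(2\mu)}=\frac{a^0_{(2\mu)}}{r^2+(a^0_{(2\mu)})^2}\qquad(\mu=1,\dots,p),$$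 followed by the diagonal block $$\frac1r\,\mathrm{diag}(\underbrace{1,\dots,1}_{m-2p},\underbrace{0,\dots,0}_{n-2-m}),$$ and $$\hat{\mathcal H}=\frac{\mathcal H_0}{r^{\,m-2p-1}}\prod_{\mu=1}^p\frac1{r^2+(a^0_{(2\mu)})^2}.$$ -/

import Mathlib

open scoped ContDiff Matrix

noncomputable section

namespace KerrSchild

/-- Points of `ℝⁿ` in Cartesian coordinates `x⁰, …, xⁿ⁻¹`; also the components of a vector or of a
covector in these coordinates. -/
abbrev Vec (n : ℕ) : Type := Fin n → ℝ

/-- A field of bilinear forms, given by its Cartesian components. -/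
abbrev MetricField (n : ℕ) : Type := Vec n → Matrix (Fin n) (Fin n) ℝ

/-- The Minkowski metric `η_{ab} = diag(-1, 1, …, 1)`. -/
def minkowski (n : ℕ) : Matrix (Fin n) (Fin n) ℝ :=
  Matrix.diagonal fun a => if a.val = 0 then -1 else 1

/-- The partial derivative `∂_a f`. -/
def partialDeriv {n : ℕ} (a : Fin n) (f : Vec n → ℝ) (x : Vec n) : ℝ :=
  fderiv ℝ f x (Pi.single a 1)

/-- The Christoffel symbols `Γ^a_{bc} = ½ g^{ad} (∂_b g_{dc} + ∂_c g_{db} - ∂_d g_{bc})`. -/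
def christoffel {n : ℕ} (g : MetricField n) (a b c : Fin n) (x : Vec n) : ℝ :=
  (1 / 2) * ∑ d, (g x)⁻¹ a d *
    (partialDeriv b (fun y => g y d c) x + partialDeriv c (fun y => g y d b) x
      - partialDeriv d (fun y => g y b c) x)

/-- The Riemann tensor
`R^a_{bcd} = ∂_c Γ^a_{db} - ∂_d Γ^a_{cb} + Γ^a_{ce} Γ^e_{db} - Γ^a_{de} Γ^e_{cb}`. -/
def riemann {n : ℕ} (g : MetricField n) (a b c d : Fin n) (x : Vec n) : ℝ :=
  partialDeriv c (christoffel g a d b) x - partialDeriv d (christoffel g a c b) x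
    + ∑ e, (christoffel g a c e x * christoffel g e d b x
      - christoffel g a d e x * christoffel g e c b x)

/-- The Ricci tensor `R_{bd} = R^a_{bad}`. -/
def ricci {n : ℕ} (g : MetricField n) (b d : Fin n) (x : Vec n) : ℝ :=
  ∑ a, riemann g a b a d x

/-- The covariant derivative `k_{a;b} = ∂_b k_a - Γ^c_{ab} k_c` of the 1-form `k` with respect to
the Levi-Civita connection of `g`. -/
def covDeriv {n : ℕ} (g : MetricField n) (k : Vec n → Vec n) (a b : Fin n) (x : Vec n) : ℝ :=
  partialDeriv b (fun y => k y a) x - ∑ c, christoffel g c a b x * k x c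

/-- The vector field `k^a = g^{ab} k_b`. -/
def raise {n : ℕ} (g : MetricField n) (k : Vec n → Vec n) (x : Vec n) : Vec n :=
  (g x)⁻¹ *ᵥ k x

/-- The Kerr-Schild metric `g_{ab} = η_{ab} - 2 H k_a k_b`. -/
def ksMetric {n : ℕ} (H : Vec n → ℝ) (k : Vec n → Vec n) : MetricField n :=
  fun x => minkowski n - (2 * H x) • Matrix.vecMulVec (k x) (k x)

/-- Smooth Kerr-Schild data on an open set `U` of `ℝⁿ`, `n ≥ 4`: a scalar function `H` that does not
vanish identically on any nonempty open subset of `U`, and a nowhere zero 1-form `k` that is null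
with respect to the Minkowski metric. -/
structure IsKerrSchild {n : ℕ} (U : Set (Vec n)) (H : Vec n → ℝ) (k : Vec n → Vec n) : Prop where
  four_le : 4 ≤ n
  isOpen : IsOpen U
  smooth_H : ContDiffOn ℝ ∞ H U
  smooth_k : ContDiffOn ℝ ∞ k U
  null : ∀ x ∈ U, k x ⬝ᵥ ((minkowski n)⁻¹ *ᵥ k x) = 0
  ne_zero : ∀ x ∈ U, k x ≠ 0
  dense : U ⊆ closure {x ∈ U | H x ≠ 0}

/-- The vacuum Einstein equations on `U`. -/
def IsVacuum {n : ℕ} (U : Set (Vec n)) (g : MetricField n) : Prop :=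
  ∀ x ∈ U, ∀ a b, ricci g a b x = 0

/-- `k, l, e_1, …, e_{n-2}` is a null frame at a point, where `g` is the metric there, `k` is a null
covector, and `l` and the `e_i` are vectors: `l` is null with `k_a l^a = 1`, the `e_i` are
orthonormal, and they are orthogonal to `k` and `l`. -/
structure IsNullFrame {n : ℕ} (g : Matrix (Fin n) (Fin n) ℝ) (k l : Vec n)
    (e : Fin (n - 2) → Vec n) : Prop where
  k_k : k ⬝ᵥ (g⁻¹ *ᵥ k) = 0
  k_l : k ⬝ᵥ l = 1
  l_l : l ⬝ᵥ (g *ᵥ l) = 0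
  k_e : ∀ i, k ⬝ᵥ e i = 0
  l_e : ∀ i, l ⬝ᵥ (g *ᵥ e i) = 0
  e_e : ∀ i j, e i ⬝ᵥ (g *ᵥ e j) = if i = j then 1 else 0

/-- The optical matrix `L_{ij} = k_{a;b} e_i^a e_j^b` at the point `x`. -/
def opticalMatrix {n : ℕ} (g : MetricField n) (k : Vec n → Vec n) (x : Vec n)
    (e : Fin (n - 2) → Vec n) : Matrix (Fin (n - 2)) (Fin (n - 2)) ℝ :=
  fun i j => ∑ a, ∑ b, covDeriv g k a b x * e i a * e j b

/-- The expansion scalar `θ = L_{ii} / (n - 2)`. -/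
def expansion {n : ℕ} (g : MetricField n) (k : Vec n → Vec n) (x : Vec n)
    (e : Fin (n - 2) → Vec n) : ℝ :=
  (opticalMatrix g k x e).trace / ((n : ℝ) - 2)

/-- `k` is expanding on `U`: at every point `θ ≠ 0` in some null frame. -/
def IsExpanding {n : ℕ} (U : Set (Vec n)) (g : MetricField n) (k : Vec n → Vec n) : Prop :=
  ∀ x ∈ U, ∃ l e, IsNullFrame (g x) (k x) l e ∧ expansion g k x e ≠ 0

/-- `k` is geodetic and affinely parametrized on `U`: `k^b k_{a;b} = 0`. -/
def IsAffineGeodetic {n : ℕ} (U : Set (Vec n)) (g : MetricField n) (k : Vec n → Vec n) : Prop :=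
  ∀ x ∈ U, ∀ a, ∑ b, raise g k x b * covDeriv g k a b x = 0

/-- The smooth nowhere zero function `c` rescales `k` to an affinely parametrized geodetic
1-form `c k`. -/
structure IsAffineRescaling {n : ℕ} (U : Set (Vec n)) (g : MetricField n) (k : Vec n → Vec n)
    (c : Vec n → ℝ) : Prop where
  smooth : ContDiffOn ℝ ∞ c U
  ne_zero : ∀ x ∈ U, c x ≠ 0
  affine : IsAffineGeodetic U g (fun x => c x • k x)

/-- The restriction of `γ` to the open interval `I` is an integral curve of `k^a` in `U`. -/
structure IsIntegralCurveIn {n : ℕ} (U : Set (Vec n)) (g : MetricField n) (k : Vec n → Vec n)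
    (I : Set ℝ) (γ : ℝ → Vec n) : Prop where
  isOpen : IsOpen I
  ordConnected : I.OrdConnected
  mem : ∀ s ∈ I, γ s ∈ U
  hasDerivAt : ∀ s ∈ I, HasDerivAt γ (raise g k (γ s)) s

/-- The canonical block-diagonal `d × d` matrix: first `p` blocks of size `2 × 2`
`(s, A; -A, s)` with `s = r / (r² + a_μ²)` and `A = a_μ / (r² + a_μ²)` (block `μ` occupies the rows
and columns `2μ, 2μ + 1`, counted from `0`), then `m - 2p` diagonal entries `1 / r`, then zeros. -/
def canonicalMatrix (d p m : ℕ) (a : Fin p → ℝ) (r : ℝ) : Matrix (Fin d) (Fin d) ℝ :=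
  fun i j =>
    if h : i.val / 2 < p then
      if j = i then r / (r ^ 2 + a ⟨i.val / 2, h⟩ ^ 2)
      else if j.val / 2 = i.val / 2 then
        if i.val % 2 = 0 then a ⟨i.val / 2, h⟩ / (r ^ 2 + a ⟨i.val / 2, h⟩ ^ 2)
        else -(a ⟨i.val / 2, h⟩ / (r ^ 2 + a ⟨i.val / 2, h⟩ ^ 2))
      else 0
    else if j = i ∧ i.val < m then 1 / r else 0

end KerrSchild

end

/-! A null covector that is nowhere zero has nonvanishing time component, so `k` can be replaced by
κ = k / k_0, with κ_0 = 1, and `H` by H k_0². All curvature computations then take place in the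
commutative algebra of smooth functions on `U` with its commuting derivations, where they are
polynomial identities. Ric(κ, κ) is 2H times the Minkowski norm of the acceleration of κ
(`ric_contract`). The acceleration has no time component, so this norm is a sum of squares, and
vacuum makes κ geodesic.

For geodesic κ the terms of Ric quadratic in the Christoffel symbols are multiples of κ_b κ_d, so up
to such multiples the vacuum equations are linear in H (`ric_eq_linRic`). Let N be `shape`, that is,
∂_b κ_a with a multiple of κ_b removed; in a null frame it becomes the optical matrix up to a
factor. The transversal vacuum equations read φ(N + Nᵀ) = 2H N Nᵀ (`optical_constraint`).
Eliminating φ by a trace and cancelling H by density gives N + Nᵀ = 2r N Nᵀ with r = tr N / tr(N Nᵀ)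
(`shapeAt_constraint`). This says that 1 - 2rN is orthogonal, which yields normality, and it splits
the frame components of N into rotation blocks, entries 1/r and zeros (`exists_canonicalMatrix`).
With the Sachs equation κ(N) = -N² it also yields κ(r) = 1 and r κ(H) = H(1 - r tr N).

Along an integral curve κ is constant, so the curve is a straight line, and the spacelike part of a
null frame can be kept fixed. The optical matrix and the canonical matrix both solve F' = -F² and
agree at one point, hence everywhere (`canonical_along`). The transport equation for H then
integrates to the stated product (`profile_along`).

If the rank is below 2 throughout an open set, expansion makes it one, N is symmetric, and H is
constant along κ. The mixed vacuum equations then determine the gradient of H, and the curvature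
reduces to one symmetric traceless matrix Ω. The Bianchi identity forces Ω = 0 (`linRiem_eq_zero`),
so the metric is flat there. -/

open scoped ContDiff Matrix

noncomputable section

namespace KerrSchild

set_option linter.unusedSectionVars false

/-! ### The differential algebra of smooth functions on an open set -/

section SmoothAlgebra

variable {n : ℕ} {U : Set (Vec n)}

/-- Extension by zero of a function on `U`. -/
def extendZero (f : U → ℝ) : Vec n → ℝ := Function.extend Subtype.val f 0

@[simp] lemma extendZero_coe (f : U → ℝ) (x : U) : extendZero f x = f x :=
  Subtype.val_injective.extend_apply f 0 x

lemma extendZero_apply (f : U → ℝ) {x : Vec n} (hx : x ∈ U) : extendZero f x = f ⟨x, hx⟩ :=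
  extendZero_coe f ⟨x, hx⟩

/-- The algebra of smooth functions on `U`. -/
def smoothAlgebra (U : Set (Vec n)) : Subalgebra ℝ (U → ℝ) where
  carrier := {f | ContDiffOn ℝ ∞ (extendZero f) U}
  mul_mem' {f g} hf hg := (ContDiffOn.mul hf hg).congr fun x hx => by
    simp [extendZero_apply _ hx]
  add_mem' {f g} hf hg := (ContDiffOn.add hf hg).congr fun x hx => by
    simp [extendZero_apply _ hx]
  algebraMap_mem' c := (contDiffOn_const (c := c)).congr fun x hx => by
    simp [extendZero_apply _ hx]

instance : CoeFun (smoothAlgebra U) fun _ => U → ℝ := ⟨Subtype.val⟩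

/-- The restriction of a smooth function to `U`. -/
def restrictSmooth (F : Vec n → ℝ) (hF : ContDiffOn ℝ ∞ F U) : smoothAlgebra U :=
  ⟨fun x => F x, hF.congr fun x hx => by simp [extendZero_apply _ hx]⟩

@[simp] lemma restrictSmooth_apply (F : Vec n → ℝ) (hF : ContDiffOn ℝ ∞ F U) (x : U) :
    restrictSmooth F hF x = F x := rfl

lemma smoothAlgebra_ext {f g : smoothAlgebra U} (h : ∀ x : U, f x = g x) : f = g :=
  Subtype.ext (funext h)

/-- Evaluation at a point of `U`. -/
def evalAt (x : U) : smoothAlgebra U →ₐ[ℝ] ℝ :=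
  (Pi.evalAlgHom ℝ (fun _ : U => ℝ) x).comp (smoothAlgebra U).val

lemma extend_differentiableAt (hU : IsOpen U) (f : smoothAlgebra U) (x : U) :
    DifferentiableAt ℝ (extendZero f) x :=
  (f.2.contDiffAt (hU.mem_nhds x.2)).differentiableAt (by simp)

lemma partialDeriv_congr_on (hU : IsOpen U) {F G : Vec n → ℝ} (h : ∀ y ∈ U, F y = G y)
    (a : Fin n) {x : Vec n} (hx : x ∈ U) : partialDeriv a F x = partialDeriv a G x := by
  unfold partialDeriv
  rw [Filter.EventuallyEq.fderiv_eq]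
  filter_upwards [hU.mem_nhds hx] with y hy using h y hy

lemma contDiffOn_partialDeriv (hU : IsOpen U) {F : Vec n → ℝ} (hF : ContDiffOn ℝ ∞ F U)
    (a : Fin n) : ContDiffOn ℝ ∞ (partialDeriv a F) U := by
  have h := hF.fderiv_of_isOpen hU (m := ∞) (by simp)
  exact h.clm_apply contDiffOn_const

/-- The partial derivatives as derivations of the algebra of smooth functions. -/
def pd (hU : IsOpen U) (a : Fin n) : Derivation ℝ (smoothAlgebra U) (smoothAlgebra U) :=
  Derivation.mk'
    { toFun := fun f => restrictSmooth (partialDeriv a (extendZero f))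
        (contDiffOn_partialDeriv hU f.2 a)
      map_add' := fun f g => smoothAlgebra_ext fun x => by
        have h : partialDeriv a (extendZero (f + g : smoothAlgebra U)) x =
            partialDeriv a (fun y => extendZero f y + extendZero g y) x :=
          partialDeriv_congr_on hU (fun y hy => by simp [extendZero_apply _ hy]) a x.2
        refine h.trans ?_
        simp only [partialDeriv]
        rw [fderiv_fun_add (extend_differentiableAt hU f x) (extend_differentiableAt hU g x)]
        rfl
      map_smul' := fun c f => smoothAlgebra_ext fun x => by
        have h : partialDeriv a (extendZero (c • f : smoothAlgebra U)) x =
            partialDeriv a (fun y => c • extendZero f y) x :=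
          partialDeriv_congr_on hU (fun y hy => by simp [extendZero_apply _ hy]) a x.2
        refine h.trans ?_
        simp only [partialDeriv]
        rw [fderiv_fun_const_smul (extend_differentiableAt hU f x)]
        rfl }
    fun f g => smoothAlgebra_ext fun x => by
        have h : partialDeriv a (extendZero (f * g : smoothAlgebra U)) x =
            partialDeriv a (fun y => extendZero f y * extendZero g y) x :=
          partialDeriv_congr_on hU (fun y hy => by simp [extendZero_apply _ hy]) a x.2
        refine h.trans ?_
        simp only [partialDeriv]
        rw [fderiv_fun_mul (extend_differentiableAt hU f x) (extend_differentiableAt hU g x)]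
        simp [partialDeriv]

lemma pd_apply (hU : IsOpen U) (a : Fin n) (f : smoothAlgebra U) (x : U) :
    pd hU a f x = partialDeriv a (extendZero f) x := rfl

lemma pd_eq_partialDeriv (hU : IsOpen U) (a : Fin n) (f : smoothAlgebra U) {F : Vec n → ℝ}
    (h : ∀ y : U, f y = F y) (x : U) : pd hU a f x = partialDeriv a F x := by
  rw [pd_apply]
  exact partialDeriv_congr_on hU (fun y hy => by rw [extendZero_apply _ hy, h]) a x.2

lemma pd_comm (hU : IsOpen U) (a b : Fin n) (f : smoothAlgebra U) :
    pd hU a (pd hU b f) = pd hU b (pd hU a f) := by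
  refine smoothAlgebra_ext fun x => ?_
  rw [pd_eq_partialDeriv hU a (pd hU b f) (fun y => pd_apply hU b f y),
    pd_eq_partialDeriv hU b (pd hU a f) (fun y => pd_apply hU a f y)]
  have hf : ContDiffAt ℝ ∞ (extendZero f) x := f.2.contDiffAt (hU.mem_nhds x.2)
  have hd : DifferentiableAt ℝ (fderiv ℝ (extendZero f)) x :=
    (hf.fderiv_right (m := 1) (by norm_cast)).differentiableAt (by simp)
  have hs : IsSymmSndFDerivAt ℝ (extendZero f) x :=
    hf.isSymmSndFDerivAt (by
    rw [minSmoothness_of_isRCLikeNormedField]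
    exact WithTop.coe_le_coe.mpr (le_top : (2 : ℕ∞) ≤ ⊤))
  unfold partialDeriv
  rw [fderiv_clm_apply hd (differentiableAt_const _), fderiv_clm_apply hd (differentiableAt_const _)]
  simpa using hs _ _

lemma fderiv_extendZero_apply (hU : IsOpen U) (f : smoothAlgebra U) (x : U) (v : Vec n) :
    fderiv ℝ (extendZero f) x v = ∑ a, v a * pd hU a f x := by
  have hv : v = ∑ a, v a • (Pi.single a 1 : Vec n) := by
    ext b; simp [Finset.sum_apply, Pi.single_apply]
  conv_lhs => rw [hv]
  rw [map_sum]
  refine Finset.sum_congr rfl fun a _ => ?_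
  rw [map_smul, smul_eq_mul]
  rfl

lemma hasDerivAt_comp_curve (hU : IsOpen U) (f : smoothAlgebra U) {γ : ℝ → Vec n} {v : Vec n}
    {s : ℝ} (hs : γ s ∈ U) (hγ : HasDerivAt γ v s) :
    HasDerivAt (fun t => extendZero f (γ t)) (∑ a, v a * pd hU a f ⟨γ s, hs⟩) s := by
  have h := (extend_differentiableAt hU f ⟨γ s, hs⟩).hasFDerivAt.comp_hasDerivAt s hγ
  rwa [fderiv_extendZero_apply hU f ⟨γ s, hs⟩] at h

/-- The inverse of a nowhere zero smooth function. -/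
def invSmooth (f : smoothAlgebra U) (hf : ∀ x : U, f x ≠ 0) : smoothAlgebra U :=
  ⟨fun x => (f x)⁻¹, (f.2.inv fun x hx => by rw [extendZero_apply _ hx]; exact hf _).congr
    fun x hx => by simp [extendZero_apply _ hx]⟩

@[simp] lemma invSmooth_apply (f : smoothAlgebra U) (hf : ∀ x : U, f x ≠ 0) (x : U) :
    invSmooth f hf x = (f x)⁻¹ := rfl

lemma mul_invSmooth (f : smoothAlgebra U) (hf : ∀ x : U, f x ≠ 0) : f * invSmooth f hf = 1 :=
  smoothAlgebra_ext fun x => by simp [hf x]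

/-- `H` may have zeros, so it cannot be divided out pointwise; continuity carries the vanishing of
`f` from the dense set where `H` is nonzero to all of `U`. -/
lemma eq_zero_of_mul_eq_zero_of_dense {H : Vec n → ℝ}
    (hH : ContDiffOn ℝ ∞ H U) (hdense : U ⊆ closure {x ∈ U | H x ≠ 0}) {f : smoothAlgebra U}
    (h : restrictSmooth H hH * f = 0) : f = 0 := by
  refine smoothAlgebra_ext fun x => ?_
  have hc : ContinuousWithinAt (extendZero f) {x ∈ U | H x ≠ 0} x :=
    (f.2.continuousOn x x.2).mono fun y hy => hy.1
  have hz : ∀ y ∈ {x ∈ U | H x ≠ 0}, extendZero f y ∈ ({0} : Set ℝ) := by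
    rintro y ⟨hy, hy0⟩
    have := congrArg (fun F : smoothAlgebra U => F ⟨y, hy⟩) h
    simp only [Subalgebra.coe_mul, Pi.mul_apply, restrictSmooth_apply, Subalgebra.coe_zero,
      Pi.zero_apply] at this
    rw [extendZero_apply _ hy]
    exact (mul_eq_zero.mp this).resolve_left hy0
  have := hc.mem_closure (hdense x.2) (t := {0}) hz
  rw [closure_singleton, extendZero_coe] at this
  simpa using this

end SmoothAlgebra

/-! ### Curvature in a commutative algebra with commuting derivations -/

section Tensor

variable {n : ℕ} {A : Type*} [CommRing A] [Algebra ℝ A]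

/-- Christoffel symbols of the metric `g` with inverse `gi`. -/
def gamma (D : Fin n → Derivation ℝ A A) (g gi : Fin n → Fin n → A) (a b c : Fin n) : A :=
  (1 / 2 : ℝ) • ∑ d, gi a d * (D b (g d c) + D c (g d b) - D d (g b c))

/-- The Riemann tensor of the connection `Γ`. -/
def riem (D : Fin n → Derivation ℝ A A) (Γ : Fin n → Fin n → Fin n → A) (a b c d : Fin n) : A :=
  D c (Γ a d b) - D d (Γ a c b) + ∑ e, (Γ a c e * Γ e d b - Γ a d e * Γ e c b)

/-- The Ricci tensor of the connection `Γ`. -/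
def ric (D : Fin n → Derivation ℝ A A) (Γ : Fin n → Fin n → Fin n → A) (b d : Fin n) : A :=
  ∑ a, riem D Γ a b a d

/-- The diagonal entries of the Minkowski metric with time direction `o`. -/
def sgn (o a : Fin n) : A := if a = o then -1 else 1

/-- The Kerr-Schild metric. -/
def ksG (o : Fin n) (H : A) (κ : Fin n → A) (a b : Fin n) : A :=
  (if a = b then sgn o a else 0) - 2 * (H * (κ a * κ b))

/-- The inverse of the Kerr-Schild metric. -/
def ksGi (o : Fin n) (H : A) (κ : Fin n → A) (a b : Fin n) : A :=
  (if a = b then sgn o a else 0) + 2 * (H * ((sgn o a * κ a) * (sgn o b * κ b)))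

lemma sgn_mul_self (o a : Fin n) : (sgn o a : A) * sgn o a = 1 := by
  unfold sgn; split_ifs <;> ring

@[simp] lemma sgn_self (o : Fin n) : (sgn o o : A) = -1 := by simp [sgn]

@[simp] lemma map_sgn (δ : Derivation ℝ A A) (o a : Fin n) : δ (sgn o a) = 0 := by
  unfold sgn; split_ifs <;> simp

/-- Minkowski contractions become Euclidean on objects without time component. This is what turns
indefinite norms into sums of squares. -/
lemma sgn_mul_of_zero {o : Fin n} {X : Fin n → A} (h : X o = 0) (a : Fin n) :
    sgn o a * X a = X a := by
  unfold sgn; split_ifs with h' <;> simp [h', h]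

/-- The combination of first derivatives of `H κ κ` in the Christoffel symbols. -/
def lowGamma (D : Fin n → Derivation ℝ A A) (H : A) (κ : Fin n → A) (a b c : Fin n) : A :=
  D b (H * (κ a * κ c)) + D c (H * (κ a * κ b)) - D a (H * (κ b * κ c))

/-- The derivative along the null direction `κ`. -/
def dirD (D : Fin n → Derivation ℝ A A) (o : Fin n) (κ : Fin n → A) (f : A) : A :=
  ∑ a, sgn o a * κ a * D a f

/-- The Christoffel symbols of the Kerr-Schild metric. -/
def ksGamma (D : Fin n → Derivation ℝ A A) (o : Fin n) (H : A) (κ : Fin n → A) :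
    Fin n → Fin n → Fin n → A :=
  gamma D (ksG o H κ) (ksGi o H κ)

/-- A null covector field `κ` with `κ_o = 1`. -/
structure IsNormalizedNull (D : Fin n → Derivation ℝ A A) (o : Fin n) (κ : Fin n → A) : Prop where
  comm : ∀ a b f, D a (D b f) = D b (D a f)
  time : κ o = 1
  null : ∑ a, sgn o a * κ a * κ a = 0

variable {D : Fin n → Derivation ℝ A A} {o : Fin n} {κ : Fin n → A} (H : A)

lemma two_mul_cancel {x : A} (h : 2 * x = 0) : x = 0 := by
  have : (1 / 2 : ℝ) • ((2 : ℝ) • x) = 0 := by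
    rw [two_smul, ← two_mul, h, smul_zero]
  rwa [smul_smul, one_div_mul_cancel two_ne_zero, one_smul] at this

lemma map_two_mul (δ : Derivation ℝ A A) (x : A) : δ (2 * x) = 2 * δ x := by
  rw [two_mul, map_add, two_mul]

lemma dirD_mul (f g : A) : dirD D o κ (f * g) = dirD D o κ f * g + f * dirD D o κ g := by
  simp only [dirD, Finset.mul_sum, Finset.sum_mul, ← Finset.sum_add_distrib, Derivation.leibniz,
    smul_eq_mul]
  exact Finset.sum_congr rfl fun a _ => by ring

lemma lowGamma_symm (a b c : Fin n) : lowGamma D H κ a b c = lowGamma D H κ a c b := by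
  simp only [lowGamma, mul_comm (κ b) (κ c)]; ring

lemma lowGamma_expand (a b c : Fin n) : lowGamma D H κ a b c =
    D b H * (κ a * κ c) + D c H * (κ a * κ b) - D a H * (κ b * κ c)
    + H * (D b (κ a) * κ c + κ a * D b (κ c) + D c (κ a) * κ b + κ a * D c (κ b)
      - D a (κ b) * κ c - κ b * D a (κ c)) := by
  simp only [lowGamma, Derivation.leibniz, smul_eq_mul]; ring

namespace IsNormalizedNull

variable (h : IsNormalizedNull D o κ)
include h

lemma null_deriv (b : Fin n) : ∑ a, sgn o a * κ a * D b (κ a) = 0 := by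
  apply two_mul_cancel
  have := congrArg (D b) h.null
  simp only [map_sum, map_zero, Derivation.leibniz, smul_eq_mul, map_sgn] at this
  rw [← this, Finset.mul_sum]
  exact Finset.sum_congr rfl fun a _ => by ring

lemma deriv_time (b : Fin n) : D b (κ o) = 0 := by simp [h.time]

/-- In the first two terms the contracted index sits on κ, and both κ^a κ_a and κ^a ∂κ_a vanish;
only the term with the derivative along κ survives. -/
lemma contract_lowGamma (b c : Fin n) :
    ∑ a, sgn o a * κ a * lowGamma D H κ a b c = - dirD D o κ (H * (κ b * κ c)) := by
  have : ∑ a, sgn o a * κ a * lowGamma D H κ a b c =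
      (D b H * κ c + H * D b (κ c) + D c H * κ b + H * D c (κ b)) * ∑ a, sgn o a * κ a * κ a
      + H * κ c * ∑ a, sgn o a * κ a * D b (κ a) + H * κ b * ∑ a, sgn o a * κ a * D c (κ a)
      - ∑ a, sgn o a * κ a * D a (H * (κ b * κ c)) := by
    simp only [Finset.mul_sum, ← Finset.sum_add_distrib, ← Finset.sum_sub_distrib]
    refine Finset.sum_congr rfl fun a _ => ?_
    simp only [lowGamma, Derivation.leibniz, smul_eq_mul]
    ring
  rw [this, h.null, h.null_deriv, h.null_deriv, dirD]
  ring

/-- The perturbation is -2Hκκ, so the lowered symbols are minus `lowGamma`; raising the index with η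
+ 2Hκκ adds the second term by `contract_lowGamma`. -/
lemma ksGamma_eq (a b c : Fin n) : ksGamma D o H κ a b c =
    - (sgn o a * lowGamma D H κ a b c)
      + 2 * (H * (sgn o a * κ a)) * dirD D o κ (H * (κ b * κ c)) := by
  have e1 : ∀ d, D b (ksG o H κ d c) + D c (ksG o H κ d b) - D d (ksG o H κ b c) =
      -2 * lowGamma D H κ d b c := by
    intro d
    have e0 : ∀ δ : Derivation ℝ A A, ∀ x y : Fin n,
        δ (ksG o H κ x y) = -2 * δ (H * (κ x * κ y)) := by
      intro δ x y
      rw [ksG, map_sub, map_two_mul]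
      split_ifs <;> simp
    simp only [e0, lowGamma]; ring
  have e2 : ∑ d, ksGi o H κ a d * (-2 * lowGamma D H κ d b c) =
      2 * (-(sgn o a * lowGamma D H κ a b c) - 2 * (H * (sgn o a * κ a)) *
        ∑ d, sgn o d * κ d * lowGamma D H κ d b c) := by
    have e3 : ∑ d, (if a = d then (sgn o a : A) else 0) * (-2 * lowGamma D H κ d b c) =
      sgn o a * (-2 * lowGamma D H κ a b c) := by simp
    have e4 : ∑ d, 2 * (H * ((sgn o a * κ a) * (sgn o d * κ d))) * (-2 * lowGamma D H κ d b c) =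
        -4 * (H * (sgn o a * κ a)) * ∑ d, sgn o d * κ d * lowGamma D H κ d b c := by
      rw [Finset.mul_sum]
      exact Finset.sum_congr rfl fun d _ => by ring
    simp only [ksGi, add_mul, Finset.sum_add_distrib, e3, e4]
    ring
  simp only [ksGamma, gamma, e1]
  rw [e2, h.contract_lowGamma, two_mul, ← two_smul ℝ, smul_smul, one_div_mul_cancel two_ne_zero,
    one_smul]
  ring

/-- The acceleration of `κ`. -/
lemma accel_time : dirD D o κ (κ o) = 0 := by simp [dirD, h.deriv_time]

lemma null_accel : ∑ a, sgn o a * κ a * dirD D o κ (κ a) = 0 := by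
  have : ∑ a, sgn o a * κ a * dirD D o κ (κ a) =
      ∑ b, sgn o b * κ b * ∑ a, sgn o a * κ a * D b (κ a) := by
    simp only [dirD, Finset.mul_sum]
    rw [Finset.sum_comm]
    exact Finset.sum_congr rfl fun b _ => Finset.sum_congr rfl fun a _ => by ring
  rw [this]
  simp [h.null_deriv]

/-- This expresses that the determinant is constant: a perturbation by the square of a null covector
does not change it. Two of the four terms of the Ricci tensor thereby drop out. -/
lemma trace_ksGamma (b : Fin n) : ∑ a, ksGamma D o H κ a a b = 0 := by
  have e1 : ∑ a, sgn o a * lowGamma D H κ a a b = D b (H * ∑ a, sgn o a * κ a * κ a) := by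
    rw [Finset.mul_sum, map_sum]
    refine Finset.sum_congr rfl fun a _ => ?_
    simp only [lowGamma, Derivation.leibniz, smul_eq_mul, map_sgn]
    ring
  have e2 : ∑ a, 2 * (H * (sgn o a * κ a)) * dirD D o κ (H * (κ a * κ b)) =
      2 * H * (dirD D o κ (H * κ b) * ∑ a, sgn o a * κ a * κ a +
        H * κ b * ∑ a, sgn o a * κ a * dirD D o κ (κ a)) := by
    simp only [Finset.mul_sum, ← Finset.sum_add_distrib]
    refine Finset.sum_congr rfl fun a _ => ?_
    simp only [dirD_mul]
    ring
  simp only [h.ksGamma_eq, Finset.sum_add_distrib, Finset.sum_neg_distrib, e1, e2, h.null,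
    h.null_accel]
  simp

lemma ric_eq (b d : Fin n) : ric D (ksGamma D o H κ) b d =
    ∑ a, D a (ksGamma D o H κ a d b)
      - ∑ a, ∑ e, ksGamma D o H κ a d e * ksGamma D o H κ e a b := by
  simp only [ric, riem, Finset.sum_add_distrib, Finset.sum_sub_distrib]
  have e1 : ∑ a, D d (ksGamma D o H κ a a b) = 0 := by
    rw [← map_sum, h.trace_ksGamma, map_zero]
  have e2 : ∑ a, ∑ e, ksGamma D o H κ a a e * ksGamma D o H κ e d b = 0 := by
    rw [Finset.sum_comm]
    simp [← Finset.sum_mul, h.trace_ksGamma]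
  rw [e1, e2]; ring

lemma dirD_contract (a : Fin n) : ∑ d, sgn o d * κ d * dirD D o κ (H * (κ a * κ d)) = 0 := by
  have : ∑ d, sgn o d * κ d * dirD D o κ (H * (κ a * κ d)) =
      dirD D o κ (H * κ a) * ∑ a, sgn o a * κ a * κ a +
        H * κ a * ∑ a, sgn o a * κ a * dirD D o κ (κ a) := by
    simp only [Finset.mul_sum, ← Finset.sum_add_distrib]
    refine Finset.sum_congr rfl fun a _ => ?_
    simp only [dirD_mul]
    ring
  rw [this, h.null, h.null_accel]; simp

lemma contract_ksGamma (a b : Fin n) : ∑ d, sgn o d * κ d * ksGamma D o H κ a d b =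
    - (sgn o a * dirD D o κ (H * (κ a * κ b))) := by
  have e : ∑ d, sgn o d * κ d * ksGamma D o H κ a d b =
      -(sgn o a * (∑ d, sgn o d * κ d * D d (H * (κ a * κ b))
        + (D b H * κ a + H * D b (κ a) - D a H * κ b - H * D a (κ b)) * ∑ d, sgn o d * κ d * κ d
        + H * κ a * ∑ d, sgn o d * κ d * D b (κ d) - H * κ b * ∑ d, sgn o d * κ d * D a (κ d)))
      + 2 * H * sgn o a * κ a * ∑ d, sgn o d * κ d * dirD D o κ (H * (κ b * κ d)) := by
    simp only [Finset.mul_sum, ← Finset.sum_add_distrib, ← Finset.sum_sub_distrib,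
      ← Finset.sum_neg_distrib]
    refine Finset.sum_congr rfl fun d _ => ?_
    rw [h.ksGamma_eq, mul_comm (κ b) (κ d)]
    simp only [lowGamma, Derivation.leibniz, smul_eq_mul]
    ring
  rw [e, h.null, h.null_deriv, h.null_deriv, h.dirD_contract, dirD]
  ring

lemma ksGamma_symm (a b c : Fin n) : ksGamma D o H κ a b c = ksGamma D o H κ a c b := by
  rw [h.ksGamma_eq, h.ksGamma_eq, lowGamma_symm, mul_comm (κ b)]

/-- The component of the Ricci tensor along `κ` is `2 H` times the norm of the acceleration. -/
lemma ric_contract : ∑ b, ∑ d, sgn o b * κ b * (sgn o d * κ d) * ric D (ksGamma D o H κ) b d =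
    2 * H * ∑ a, sgn o a * (dirD D o κ (κ a) * dirD D o κ (κ a)) := by
  set Γ := ksGamma D o H κ with hΓ
  set E : Fin n → Fin n → A := fun a b => dirD D o κ (H * (κ a * κ b)) with hE
  have hEs : ∀ a b, E a b = E b a := fun a b => by simp only [hE, mul_comm (κ a)]
  have c1 : ∀ a b, ∑ d, sgn o d * κ d * Γ a d b = - (sgn o a * E a b) := h.contract_ksGamma H
  have c2 : ∀ a, ∑ b, ∑ d, sgn o b * κ b * (sgn o d * κ d) * Γ a d b = 0 := by
    intro a
    have : ∑ b, ∑ d, sgn o b * κ b * (sgn o d * κ d) * Γ a d b =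
        - sgn o a * ∑ b, sgn o b * κ b * E a b := by
      rw [Finset.mul_sum]
      refine Finset.sum_congr rfl fun b _ => ?_
      calc _ = sgn o b * κ b * ∑ d, sgn o d * κ d * Γ a d b := by
            rw [Finset.mul_sum]; exact Finset.sum_congr rfl fun d _ => by ring
        _ = _ := by rw [c1]; ring
    rw [this, h.dirD_contract, mul_zero]
  -- Differentiating the identity `c2` moves the derivative from Γ to κ.
  have c3 : ∀ a, ∑ b, ∑ d, sgn o b * κ b * (sgn o d * κ d) * D a (Γ a d b) =
      2 * ∑ b, sgn o b * D a (κ b) * (sgn o a * E a b) := by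
    intro a
    have h0 := congrArg (D a) (c2 a)
    simp only [map_sum, map_zero, Derivation.leibniz, smul_eq_mul, map_sgn, mul_zero, add_zero,
      mul_add, Finset.sum_add_distrib] at h0
    have s1 : ∑ b, ∑ d, Γ a d b * (sgn o b * κ b * (sgn o d * D a (κ d))) =
        - ∑ b, sgn o b * D a (κ b) * (sgn o a * E a b) := by
      rw [Finset.sum_comm, ← Finset.sum_neg_distrib]
      refine Finset.sum_congr rfl fun b _ => ?_
      calc _ = sgn o b * D a (κ b) * ∑ d, sgn o d * κ d * Γ a d b := by
            rw [Finset.mul_sum]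
            exact Finset.sum_congr rfl fun d _ => by rw [hΓ, h.ksGamma_symm H a b d]; ring
        _ = _ := by rw [c1]; ring
    have s2 : ∑ b, ∑ d, Γ a d b * (sgn o d * κ d * (sgn o b * D a (κ b))) =
        - ∑ b, sgn o b * D a (κ b) * (sgn o a * E a b) := by
      rw [← Finset.sum_neg_distrib]
      refine Finset.sum_congr rfl fun b _ => ?_
      calc _ = sgn o b * D a (κ b) * ∑ d, sgn o d * κ d * Γ a d b := by
            rw [Finset.mul_sum]
            exact Finset.sum_congr rfl fun d _ => by ring
        _ = _ := by rw [c1]; ring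
    linear_combination h0 - s1 - s2
  have c4 : ∑ b, ∑ d, sgn o b * κ b * (sgn o d * κ d) * ∑ a, ∑ e, Γ a d e * Γ e a b =
      ∑ a, ∑ e, (sgn o a * E a e) * (sgn o e * E e a) := by
    have : ∀ a e, (sgn o a * E a e) * (sgn o e * E e a) =
        ∑ b, ∑ d, sgn o b * κ b * (sgn o d * κ d) * (Γ a d e * Γ e a b) := by
      intro a e
      have := congrArg₂ (· * ·) (c1 a e) (c1 e a)
      simp only [neg_mul_neg] at this
      rw [← this, Finset.sum_mul_sum, Finset.sum_comm]
      refine Finset.sum_congr rfl fun b _ => Finset.sum_congr rfl fun d _ => ?_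
      rw [hΓ, h.ksGamma_symm H e b a]; ring
    simp only [this]
    simp only [Finset.mul_sum]
    rw [Finset.sum_congr rfl fun b _ => Finset.sum_comm]
    rw [Finset.sum_comm]
    refine Finset.sum_congr rfl fun a _ => ?_
    rw [Finset.sum_congr rfl fun b _ => Finset.sum_comm]
    rw [Finset.sum_comm]
  have c5 : ∀ a b, E a b = dirD D o κ H * (κ a * κ b)
      + H * (dirD D o κ (κ a) * κ b + κ a * dirD D o κ (κ b)) := by
    intro a b; simp only [hE, dirD_mul]
  set α := fun a => dirD D o κ (κ a) with hα
  have n1 : ∑ a, sgn o a * κ a * κ a = 0 := h.null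
  have n2 : ∑ a, sgn o a * κ a * α a = 0 := h.null_accel
  have s1 : ∑ a, ∑ b, sgn o b * D a (κ b) * (sgn o a * E a b) =
      H * ∑ a, sgn o a * (α a * α a) := by
    have i1 : ∀ a, ∑ b, sgn o b * D a (κ b) * (sgn o a * E a b) =
        (dirD D o κ H * κ a + H * α a) * sgn o a * ∑ b, sgn o b * κ b * D a (κ b)
        + H * κ a * sgn o a * ∑ b, sgn o b * D a (κ b) * α b := by
      intro a
      simp only [Finset.mul_sum, ← Finset.sum_add_distrib, c5]
      exact Finset.sum_congr rfl fun b _ => by simp only [hα]; ring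
    simp only [i1, h.null_deriv, mul_zero, zero_add, Finset.mul_sum]
    rw [Finset.sum_comm]
    refine Finset.sum_congr rfl fun b _ => ?_
    calc _ = H * (sgn o b * (α b * ∑ a, sgn o a * κ a * D a (κ b))) := by
          simp only [Finset.mul_sum]
          exact Finset.sum_congr rfl fun a _ => by ring
      _ = _ := rfl
  -- `E` is built from κκ and the products of κ with the acceleration α, so each full contraction
  -- contains κ·κ or κ·α, and the quadratic terms contribute nothing.
  have s2 : ∑ a, ∑ e, (sgn o a * E a e) * (sgn o e * E e a) = 0 := by
    have i1 : ∀ a, ∑ e, (sgn o a * E a e) * (sgn o e * E e a) =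
        sgn o a * ((dirD D o κ H * κ a + H * α a) * (dirD D o κ H * κ a + H * α a) *
            ∑ e, sgn o e * κ e * κ e
          + 2 * (dirD D o κ H * κ a + H * α a) * (H * κ a) * ∑ e, sgn o e * κ e * α e)
          + H * H * (∑ e, sgn o e * α e * α e) * (sgn o a * κ a * κ a) := by
      intro a
      simp only [Finset.mul_sum, Finset.sum_mul, ← Finset.sum_add_distrib, c5]
      exact Finset.sum_congr rfl fun e _ => by simp only [hα]; ring
    simp only [i1, n1, n2, mul_zero, zero_add, add_zero, ← Finset.mul_sum]
  have hr : ∀ b d, ric D Γ b d = _ := h.ric_eq H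
  simp only [hr, mul_sub, Finset.sum_sub_distrib]
  rw [c4, s2]
  have : ∑ b, ∑ d, sgn o b * κ b * (sgn o d * κ d) * ∑ a, D a (Γ a d b) =
      ∑ a, ∑ b, ∑ d, sgn o b * κ b * (sgn o d * κ d) * D a (Γ a d b) := by
    simp only [Finset.mul_sum]
    rw [Finset.sum_congr rfl fun b _ => Finset.sum_comm]
    rw [Finset.sum_comm]
  rw [this, Finset.sum_congr rfl fun a _ => c3 a, ← Finset.mul_sum, s1]
  ring

end IsNormalizedNull

end Tensor

/-! ### The vacuum equations for a geodesic null covector field. -/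

section Geodesic

variable {n : ℕ} {A : Type*} [CommRing A] [Algebra ℝ A]

/-- A geodesic null covector field `κ` with `κ_o = 1`. -/
structure IsGeodesicNull (D : Fin n → Derivation ℝ A A) (o : Fin n) (κ : Fin n → A) : Prop
    extends IsNormalizedNull D o κ where
  geodesic : ∀ a, dirD D o κ (κ a) = 0

/-- The flat wave operator. -/
def box (D : Fin n → Derivation ℝ A A) (o : Fin n) (f : A) : A := ∑ c, sgn o c * D c (D c f)

/-- The flat inner product of two gradients. -/
def gradInner (D : Fin n → Derivation ℝ A A) (o : Fin n) (f g : A) : A :=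
  ∑ c, sgn o c * D c f * D c g

/-- The divergence of `κ`. -/
def divergence (D : Fin n → Derivation ℝ A A) (o : Fin n) (κ : Fin n → A) : A :=
  ∑ a, sgn o a * D a (κ a)

/-- The part of `∂_b κ_a` transversal to the time direction. -/
def shape (D : Fin n → Derivation ℝ A A) (o : Fin n) (κ : Fin n → A) (a b : Fin n) : A :=
  D b (κ a) - D o (κ a) * κ b

/-- The coefficient in the divergence `∂_a (H κ^a κ_b) = φ κ_b`. -/
def fluxCoeff (D : Fin n → Derivation ℝ A A) (o : Fin n) (H : A) (κ : Fin n → A) : A :=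
  dirD D o κ H + H * divergence D o κ

/-- The linearized Ricci tensor. -/
def linRic (D : Fin n → Derivation ℝ A A) (o : Fin n) (H : A) (κ : Fin n → A) (b d : Fin n) : A :=
  D b (fluxCoeff D o H κ * κ d) + D d (fluxCoeff D o H κ * κ b) - box D o (H * (κ b * κ d))

variable {D : Fin n → Derivation ℝ A A} {o : Fin n} {κ : Fin n → A} (H : A)

lemma gradInner_mul (f g k : A) :
    gradInner D o (f * g) k = f * gradInner D o g k + g * gradInner D o f k := by
  simp only [gradInner, Finset.mul_sum, ← Finset.sum_add_distrib, Derivation.leibniz, smul_eq_mul]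
  exact Finset.sum_congr rfl fun a _ => by ring

lemma gradInner_comm (f g : A) : gradInner D o f g = gradInner D o g f :=
  Finset.sum_congr rfl fun a _ => by ring

lemma box_mul (f g : A) :
    box D o (f * g) = box D o f * g + 2 * gradInner D o f g + f * box D o g := by
  simp only [box, gradInner, Finset.mul_sum, Finset.sum_mul, ← Finset.sum_add_distrib,
    Derivation.leibniz, smul_eq_mul, map_add]
  exact Finset.sum_congr rfl fun a _ => by ring

namespace IsGeodesicNull

variable (h : IsGeodesicNull D o κ)
include h

lemma contract_right (a : Fin n) : ∑ b, sgn o b * κ b * D b (κ a) = 0 := h.geodesic a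

lemma dirD_prod (b c : Fin n) : dirD D o κ (H * (κ b * κ c)) = dirD D o κ H * (κ b * κ c) := by
  simp [dirD_mul, h.geodesic]

lemma ksGamma_geodesic (a b c : Fin n) : ksGamma D o H κ a b c =
    - (sgn o a * (lowGamma D H κ a b c - 2 * H * dirD D o κ H * (κ a * (κ b * κ c)))) := by
  rw [h.ksGamma_eq, h.dirD_prod]; ring

/-- Every term of Γ carries a κ in one of its slots. Contracted with κ, the curl `B` and the
symmetrized derivative `S` vanish, while `F` returns a multiple of κ; hence all products cancel
except the one in which both free indices sit on κ. -/
lemma gamma_quadratic : ∃ Z, ∀ b d, ∑ a, ∑ e, ksGamma D o H κ a d e * ksGamma D o H κ e a b =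
    Z * (κ b * κ d) := by
  set B : Fin n → Fin n → A := fun a b => D b (κ a) - D a (κ b) with hB
  set S : Fin n → Fin n → A := fun a b => D b (κ a) + D a (κ b) with hS
  set δ := dirD D o κ H with hδ
  set F : Fin n → Fin n → A := fun a e =>
    κ a * D e H - κ e * D a H + H * B a e - 2 * H * δ * (κ a * κ e) with hF
  set X : Fin n → Fin n → Fin n → A := fun a d e =>
    κ a * κ e * D d H + H * κ e * B a d + H * κ a * S e d + κ d * F a e with hX
  have n1 : ∑ a, sgn o a * κ a * κ a = 0 := h.null
  have n2 : ∀ b, ∑ a, sgn o a * κ a * D b (κ a) = 0 := h.null_deriv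
  have n3 : ∀ b, ∑ a, sgn o a * κ a * D a (κ b) = 0 := h.contract_right
  have n4 : ∑ a, sgn o a * κ a * D a H = δ := rfl
  have B1 : ∀ d, ∑ a, sgn o a * κ a * B a d = 0 := by
    intro d
    have := congrArg₂ (· - ·) (n2 d) (n3 d)
    simpa only [← Finset.sum_sub_distrib, ← mul_sub, sub_zero] using this
  have S1 : ∀ d, ∑ a, sgn o a * κ a * S a d = 0 := by
    intro d
    have := congrArg₂ (· + ·) (n2 d) (n3 d)
    simpa only [← Finset.sum_add_distrib, ← mul_add, add_zero] using this
  have F1 : ∀ a, ∑ e, sgn o e * κ e * F e a = - (δ * κ a) := by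
    intro a
    have : ∑ e, sgn o e * κ e * F e a = (D a H - 2 * H * δ * κ a) * ∑ e, sgn o e * κ e * κ e
        - κ a * ∑ e, sgn o e * κ e * D e H + H * ∑ e, sgn o e * κ e * B e a := by
      simp only [Finset.mul_sum, ← Finset.sum_add_distrib, ← Finset.sum_sub_distrib]
      exact Finset.sum_congr rfl fun e _ => by simp only [hF]; ring
    rw [this, n1, n4, B1]; ring
  have F2 : ∀ a, ∑ e, sgn o e * κ e * F a e = δ * κ a := by
    intro a
    have : ∑ e, sgn o e * κ e * F a e = (- D a H - 2 * H * δ * κ a) * ∑ e, sgn o e * κ e * κ e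
        + κ a * ∑ e, sgn o e * κ e * D e H - H * ∑ e, sgn o e * κ e * B e a := by
      simp only [Finset.mul_sum, ← Finset.sum_add_distrib, ← Finset.sum_sub_distrib]
      exact Finset.sum_congr rfl fun e _ => by simp only [hF, hB]; ring
    rw [this, n1, n4, B1]; ring
  have X1 : ∀ b a, ∑ e, sgn o e * κ e * X e b a = - (δ * (κ a * κ b)) := by
    intro b a
    have : ∑ e, sgn o e * κ e * X e b a =
        (κ a * D b H + H * S a b) * ∑ e, sgn o e * κ e * κ e
        + H * κ a * ∑ e, sgn o e * κ e * B e b + κ b * ∑ e, sgn o e * κ e * F e a := by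
      simp only [Finset.mul_sum, ← Finset.sum_add_distrib]
      exact Finset.sum_congr rfl fun e _ => by simp only [hX]; ring
    rw [this, n1, B1, F1]; ring
  have G1 : ∀ a d e, ksGamma D o H κ a d e = - (sgn o a * X a d e) := by
    intro a d e
    rw [h.ksGamma_geodesic, lowGamma_expand]
    simp only [hX, hF, hB, hS]; ring
  refine ⟨∑ a, ∑ e, sgn o a * F a e * (sgn o e * F e a), fun b d => ?_⟩
  have expand : ∑ a, ∑ e, ksGamma D o H κ a d e * ksGamma D o H κ e a b =
      ∑ a, ∑ e, sgn o a * (κ a * D d H + H * B a d) * (sgn o e * κ e * X e b a)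
      + ∑ a, ∑ e, sgn o a * (κ a * D b H + H * S a b) * (H * κ a * (sgn o e * κ e * S e d)
          + κ d * (sgn o e * κ e * F a e))
      + ∑ a, ∑ e, H * H * (sgn o a * κ a * κ a) * (sgn o e * (S e d * B e b))
      + ∑ a, ∑ e, H * κ b * (sgn o e * S e d) * (sgn o a * κ a * F e a)
      + ∑ a, ∑ e, H * κ d * (sgn o e * B e b) * (sgn o a * κ a * F a e)
      + ∑ a, ∑ e, sgn o a * F a e * (sgn o e * F e a) * (κ b * κ d) := by
    simp only [← Finset.sum_add_distrib]
    refine Finset.sum_congr rfl fun a _ => Finset.sum_congr rfl fun e _ => ?_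
    rw [h.ksGamma_symm H e a b, G1, G1]
    simp only [hX]; ring
  have t1 : ∑ a, ∑ e, sgn o a * (κ a * D d H + H * B a d) * (sgn o e * κ e * X e b a) = 0 := by
    have : ∑ a, ∑ e, sgn o a * (κ a * D d H + H * B a d) * (sgn o e * κ e * X e b a) =
      -(δ * κ b) * (D d H * (∑ a, sgn o a * κ a * κ a) + H * ∑ a, sgn o a * κ a * B a d) := by
      simp only [← Finset.mul_sum, X1]
      simp only [Finset.mul_sum, ← Finset.sum_add_distrib]
      exact Finset.sum_congr rfl fun e _ => by ring
    rw [this, n1, B1]; ring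
  have t2 : ∑ a, ∑ e, sgn o a * (κ a * D b H + H * S a b) * (H * κ a * (sgn o e * κ e * S e d)
          + κ d * (sgn o e * κ e * F a e)) = 0 := by
    have : ∑ a, ∑ e, sgn o a * (κ a * D b H + H * S a b) * (H * κ a * (sgn o e * κ e * S e d)
          + κ d * (sgn o e * κ e * F a e)) =
      δ * κ d * (D b H * (∑ a, sgn o a * κ a * κ a) + H * ∑ a, sgn o a * κ a * S a b) := by
      have i : ∀ a, ∑ e, sgn o a * (κ a * D b H + H * S a b) * (H * κ a * (sgn o e * κ e * S e d)
          + κ d * (sgn o e * κ e * F a e)) = δ * κ d * κ a * (sgn o a *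
            (κ a * D b H + H * S a b)) := by
        intro a
        simp only [← Finset.mul_sum, Finset.sum_add_distrib, S1, F2]
        ring
      simp only [i, Finset.mul_sum, ← Finset.sum_add_distrib]
      exact Finset.sum_congr rfl fun e _ => by ring
    rw [this, n1, S1]; ring
  have t3 : ∑ a, ∑ e, H * H * (sgn o a * κ a * κ a) * (sgn o e * (S e d * B e b)) = 0 := by
    simp only [← Finset.mul_sum, ← Finset.sum_mul, n1]; ring
  have t4 : ∑ a, ∑ e, H * κ b * (sgn o e * S e d) * (sgn o a * κ a * F e a) = 0 := by
    rw [Finset.sum_comm]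
    have : ∑ e, ∑ a, H * κ b * (sgn o e * S e d) * (sgn o a * κ a * F e a) =
        H * κ b * δ * ∑ e, sgn o e * κ e * S e d := by
      simp only [← Finset.mul_sum, F2]
      simp only [Finset.mul_sum]
      exact Finset.sum_congr rfl fun e _ => by ring
    rw [this, S1]; ring
  have t5 : ∑ a, ∑ e, H * κ d * (sgn o e * B e b) * (sgn o a * κ a * F a e) = 0 := by
    rw [Finset.sum_comm]
    have : ∑ e, ∑ a, H * κ d * (sgn o e * B e b) * (sgn o a * κ a * F a e) =
        - (H * κ d * δ) * ∑ e, sgn o e * κ e * B e b := by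
      simp only [← Finset.mul_sum, F1]
      simp only [Finset.mul_sum]
      exact Finset.sum_congr rfl fun e _ => by ring
    rw [this, B1]; ring
  rw [expand, t1, t2, t3, t4, t5]
  simp only [Finset.sum_mul, zero_add]

lemma flux (b : Fin n) : ∑ a, sgn o a * D a (H * (κ a * κ b)) = fluxCoeff D o H κ * κ b := by
  have : ∑ a, sgn o a * D a (H * (κ a * κ b)) =
      (∑ a, sgn o a * κ a * D a H + H * ∑ a, sgn o a * D a (κ a)) * κ b
      + H * ∑ a, sgn o a * κ a * D a (κ b) := by
    simp only [Finset.mul_sum, Finset.sum_mul, ← Finset.sum_add_distrib, Derivation.leibniz,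
      smul_eq_mul]
    exact Finset.sum_congr rfl fun e _ => by ring
  rw [this, h.contract_right, fluxCoeff, dirD, divergence]; ring

/-- The quadratic terms, and the part of Γ proportional to κκκ, only produce multiples of κ_b κ_d.
Every component not of this form is therefore linear in `H`. -/
lemma ric_eq_linRic : ∃ Y, ∀ b d, ric D (ksGamma D o H κ) b d =
    - linRic D o H κ b d + Y * (κ b * κ d) := by
  obtain ⟨Z, hZ⟩ := h.gamma_quadratic H
  set δ := dirD D o κ H with hδ
  refine ⟨∑ a, D a (2 * H * δ * (sgn o a * κ a)) - Z, fun b d => ?_⟩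
  rw [h.ric_eq, hZ]
  have e1 : ∑ a, D a (ksGamma D o H κ a d b) =
      - ∑ a, sgn o a * D a (lowGamma D H κ a d b)
      + (∑ a, D a (2 * H * δ * (sgn o a * κ a))) * (κ b * κ d)
      + 2 * H * δ * ∑ a, sgn o a * κ a * D a (κ b * κ d) := by
    simp only [Finset.mul_sum, Finset.sum_mul, ← Finset.sum_add_distrib, ← Finset.sum_neg_distrib]
    refine Finset.sum_congr rfl fun a _ => ?_
    have : ksGamma D o H κ a d b = - (sgn o a * lowGamma D H κ a d b) +
        (2 * H * δ * (sgn o a * κ a)) * (κ b * κ d) := by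
      rw [h.ksGamma_geodesic]; ring
    rw [this, map_add, map_neg, Derivation.leibniz, Derivation.leibniz _ (2 * H * δ * _)]
    simp only [smul_eq_mul, map_sgn]
    ring
  have e2 : ∑ a, sgn o a * κ a * D a (κ b * κ d) = 0 := by
    have := dirD_mul (D := D) (o := o) (κ := κ) (κ b) (κ d)
    rw [h.geodesic, h.geodesic] at this
    simpa [dirD] using this
  have e3 : ∑ a, sgn o a * D a (lowGamma D H κ a d b) = linRic D o H κ b d := by
    have : ∑ a, sgn o a * D a (lowGamma D H κ a d b) =
        D d (∑ a, sgn o a * D a (H * (κ a * κ b))) + D b (∑ a, sgn o a * D a (H * (κ a * κ d)))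
        - ∑ a, sgn o a * D a (D a (H * (κ b * κ d))) := by
      simp only [map_sum, ← Finset.sum_add_distrib, ← Finset.sum_sub_distrib]
      refine Finset.sum_congr rfl fun a _ => ?_
      rw [Derivation.leibniz (D d), Derivation.leibniz (D b), lowGamma]
      simp only [smul_eq_mul, map_sgn, map_add, map_sub]
      rw [h.comm d a, h.comm b a, mul_comm (κ d)]
      ring
    rw [this, h.flux, h.flux, linRic, box]; ring
  rw [e1, e2, e3]; ring

lemma shape_time_left (b : Fin n) : shape D o κ o b = 0 := by simp [shape, h.deriv_time]

lemma shape_time_right (a : Fin n) : shape D o κ a o = 0 := by simp [shape, h.time]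

lemma sgn_shape_left (a b : Fin n) : sgn o a * shape D o κ a b = shape D o κ a b :=
  sgn_mul_of_zero (X := fun a => shape D o κ a b) (h.shape_time_left b) a

lemma sgn_shape_right (a b : Fin n) : sgn o b * shape D o κ a b = shape D o κ a b :=
  sgn_mul_of_zero (X := fun b => shape D o κ a b) (h.shape_time_right a) b

lemma shape_mul_null (a : Fin n) : ∑ b, shape D o κ a b * κ b = 0 := by
  have : ∑ b, shape D o κ a b * κ b =
      ∑ b, sgn o b * κ b * D b (κ a) - D o (κ a) * ∑ b, sgn o b * κ b * κ b := by
    simp only [Finset.mul_sum, ← Finset.sum_sub_distrib]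
    refine Finset.sum_congr rfl fun b _ => ?_
    rw [← h.sgn_shape_right, shape]; ring
  rw [this, h.contract_right, h.null]; ring

lemma null_mul_shape (b : Fin n) : ∑ a, κ a * shape D o κ a b = 0 := by
  have : ∑ a, κ a * shape D o κ a b =
      ∑ a, sgn o a * κ a * D b (κ a) - (∑ a, sgn o a * κ a * D o (κ a)) * κ b := by
    simp only [Finset.sum_mul, ← Finset.sum_sub_distrib]
    refine Finset.sum_congr rfl fun a _ => ?_
    rw [← h.sgn_shape_left, shape]; ring
  rw [this, h.null_deriv, h.null_deriv]; ring

lemma trace_shape : ∑ a, shape D o κ a a = divergence D o κ := by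
  have : ∑ a, shape D o κ a a =
      ∑ a, sgn o a * D a (κ a) - ∑ a, sgn o a * κ a * D o (κ a) := by
    simp only [← Finset.sum_sub_distrib]
    refine Finset.sum_congr rfl fun a _ => ?_
    rw [← h.sgn_shape_left, shape]; ring
  rw [this, h.null_deriv, divergence]; ring

/-- The gradient of κ_b is the row of the shape tensor plus a multiple of κ; the extra terms vanish
because the shape tensor annihilates κ and κ is null. -/
lemma gradInner_eq_shape (b d : Fin n) :
    gradInner D o (κ b) (κ d) = ∑ c, shape D o κ b c * shape D o κ d c := by
  have : gradInner D o (κ b) (κ d) = ∑ c, shape D o κ b c * shape D o κ d c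
      + D o (κ b) * ∑ c, shape D o κ d c * κ c + D o (κ d) * ∑ c, shape D o κ b c * κ c
      + D o (κ b) * D o (κ d) * ∑ c, sgn o c * κ c * κ c := by
    simp only [gradInner, Finset.mul_sum, ← Finset.sum_add_distrib]
    refine Finset.sum_congr rfl fun c _ => ?_
    have h1 := h.sgn_shape_right b c
    have h2 := h.sgn_shape_right d c
    have e1 : D c (κ b) = shape D o κ b c + D o (κ b) * κ c := by rw [shape]; ring
    have e2 : D c (κ d) = shape D o κ d c + D o (κ d) * κ c := by rw [shape]; ring
    rw [e1, e2]
    linear_combination (shape D o κ d c + D o (κ d) * κ c) * h1 + D o (κ b) * κ c * h2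
  rw [this, h.shape_mul_null, h.shape_mul_null, h.null]; ring

lemma linRic_expand (b d : Fin n) : linRic D o H κ b d =
    D b (fluxCoeff D o H κ) * κ d + D d (fluxCoeff D o H κ) * κ b
    + fluxCoeff D o H κ * (D b (κ d) + D d (κ b)) - box D o H * (κ b * κ d)
    - 2 * (κ d * gradInner D o H (κ b) + κ b * gradInner D o H (κ d))
    - H * (box D o (κ b) * κ d + κ b * box D o (κ d))
    - 2 * H * ∑ c, shape D o κ b c * shape D o κ d c := by
  rw [linRic, box_mul, box_mul, gradInner_comm H, gradInner_mul, h.gradInner_eq_shape,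
    Derivation.leibniz, Derivation.leibniz, gradInner_comm (κ b) H, gradInner_comm (κ d) H]
  simp only [smul_eq_mul]; ring

lemma linRic_of_vacuum (hv : ∀ b d, ric D (ksGamma D o H κ) b d = 0) :
    ∃ Y, ∀ b d, linRic D o H κ b d = Y * (κ b * κ d) := by
  obtain ⟨Y, hY⟩ := h.ric_eq_linRic H
  exact ⟨Y, fun b d => by linear_combination hY b d - hv b d⟩

/-- The transversal part of the vacuum equations. -/
lemma optical_constraint (hv : ∀ b d, ric D (ksGamma D o H κ) b d = 0) (b d : Fin n) :
    fluxCoeff D o H κ * (shape D o κ b d + shape D o κ d b) =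
      2 * H * ∑ c, shape D o κ b c * shape D o κ d c := by
  obtain ⟨Y, hY⟩ := h.linRic_of_vacuum H hv
  -- As κ_o = 1, this combination annihilates every term with a factor κ_b or κ_d. Only the
  -- symmetrized derivative of κ and the term quadratic in the shape tensor remain.
  have e : linRic D o H κ b d - κ b * linRic D o H κ o d - κ d * linRic D o H κ b o
      + κ b * κ d * linRic D o H κ o o = 0 := by
    rw [hY, hY, hY, hY, h.time]; ring
  simp only [h.linRic_expand, h.time, h.shape_time_left, zero_mul,
    mul_zero, Finset.sum_const_zero] at e
  have bo' : box D o (1 : A) = 0 := by simp [box]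
  have go' : gradInner D o H (1 : A) = 0 := by simp [gradInner]
  simp only [bo', go', Derivation.map_one_eq_zero] at e
  simp only [shape] at e ⊢
  linear_combination e

/-- The mixed part of the vacuum equations. -/
lemma mixed_constraint (hv : ∀ b d, ric D (ksGamma D o H κ) b d = 0) (b : Fin n) :
    D b (fluxCoeff D o H κ) - κ b * D o (fluxCoeff D o H κ) + fluxCoeff D o H κ * D o (κ b)
      = 2 * gradInner D o H (κ b) + H * box D o (κ b) := by
  obtain ⟨Y, hY⟩ := h.linRic_of_vacuum H hv
  have e : linRic D o H κ b o - κ b * linRic D o H κ o o = 0 := by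
    rw [hY, hY, h.time]; ring
  have bo' : box D o (1 : A) = 0 := by simp [box]
  have go' : gradInner D o H (1 : A) = 0 := by simp [gradInner]
  simp only [h.linRic_expand, h.time, h.shape_time_left, zero_mul, bo', go',
    mul_zero, Finset.sum_const_zero, Derivation.map_one_eq_zero] at e
  linear_combination e

lemma dirD_comm (b : Fin n) (f : A) :
    dirD D o κ (D b f) = D b (dirD D o κ f) - ∑ c, sgn o c * D b (κ c) * D c f := by
  simp only [dirD, map_sum, ← Finset.sum_sub_distrib]
  refine Finset.sum_congr rfl fun c _ => ?_
  simp only [Derivation.leibniz, smul_eq_mul, map_sgn]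
  rw [h.comm c b]; ring

lemma dirD_deriv (a b : Fin n) :
    dirD D o κ (D b (κ a)) = - ∑ c, shape D o κ a c * D b (κ c) := by
  rw [h.dirD_comm, h.geodesic, map_zero, zero_sub]
  have : ∑ c, sgn o c * D b (κ c) * D c (κ a) = ∑ c, shape D o κ a c * D b (κ c)
      + D o (κ a) * ∑ c, sgn o c * κ c * D b (κ c) := by
    simp only [Finset.mul_sum, ← Finset.sum_add_distrib]
    refine Finset.sum_congr rfl fun c _ => ?_
    rw [← h.sgn_shape_right, shape]; ring
  rw [this, h.null_deriv]; ring

/-- The Sachs equation. -/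
lemma dirD_shape (a b : Fin n) :
    dirD D o κ (shape D o κ a b) = - ∑ c, shape D o κ a c * shape D o κ c b := by
  have sub : ∀ f g, dirD D o κ (f - g) = dirD D o κ f - dirD D o κ g := fun f g => by
    simp [dirD, mul_sub]
  have e : ∑ c, shape D o κ a c * shape D o κ c b =
      ∑ c, shape D o κ a c * D b (κ c) - (∑ c, shape D o κ a c * D o (κ c)) * κ b := by
    simp only [Finset.sum_mul, ← Finset.sum_sub_distrib]
    refine Finset.sum_congr rfl fun c _ => ?_
    conv_lhs => rw [shape.eq_def D o κ c b]
    ring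
  rw [e, shape, sub, dirD_mul, h.dirD_deriv, h.dirD_deriv, h.geodesic]
  ring

/-- The covariant and the flat derivative of κ thus differ by a multiple of κκ, which vectors
orthogonal to κ do not see. -/
lemma contract_gamma_null (a b : Fin n) :
    ∑ c, ksGamma D o H κ c a b * κ c = dirD D o κ H * (κ a * κ b) := by
  have : ∑ c, ksGamma D o H κ c a b * κ c = - ∑ c, sgn o c * κ c * lowGamma D H κ c a b
      + 2 * H * dirD D o κ H * (κ a * κ b) * ∑ c, sgn o c * κ c * κ c := by
    simp only [Finset.mul_sum, ← Finset.sum_add_distrib, ← Finset.sum_neg_distrib]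
    refine Finset.sum_congr rfl fun c _ => ?_
    rw [h.ksGamma_geodesic]; ring
  rw [this, h.contract_lowGamma, h.null, h.dirD_prod]; ring

end IsGeodesicNull

end Geodesic

/-! ### Flatness when the optical matrix has rank one. -/

section RankOne

variable {n : ℕ} {A : Type*} [CommRing A] [Algebra ℝ A]

/-- A geodesic null covector field whose shape tensor is symmetric of rank one, with
nonvanishing divergence, and a function `H` that is constant along it. -/
structure IsRankOne (D : Fin n → Derivation ℝ A A) (o : Fin n) (H : A) (κ : Fin n → A) : Prop
    extends IsGeodesicNull D o κ where
  symm : ∀ a b, shape D o κ a b = shape D o κ b a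
  minors : ∀ a b c d, shape D o κ a b * shape D o κ c d = shape D o κ a d * shape D o κ c b
  isUnit : IsUnit (divergence D o κ)
  dirD_zero : dirD D o κ H = 0

/-- The splitting `∂_o κ = u + z` into parts along and transversal to the image of the shape
tensor, and the resulting form of the gradient of `H`. -/
structure IsSplitting (D : Fin n → Derivation ℝ A A) (o : Fin n) (H : A) (κ u z : Fin n → A) :
    Prop where
  add : ∀ a, D o (κ a) = u a + z a
  grad : ∀ a, D a H = D o H * κ a + 2 * (H * u a)
  shape_mul : ∀ a b c, shape D o κ a b * u c = shape D o κ a c * u b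
  shape_z : ∀ a, ∑ b, shape D o κ a b * z b = 0
  u_z : ∑ a, u a * z a = 0
  u_o : u o = 0
  z_o : z o = 0
  null_u : ∑ a, sgn o a * κ a * u a = 0
  null_z : ∑ a, sgn o a * κ a * z a = 0

/-- The linearized Riemann tensor, with all indices down. -/
def linRiem (D : Fin n → Derivation ℝ A A) (H : A) (κ : Fin n → A) (a b c d : Fin n) : A :=
  D d (lowGamma D H κ a c b) - D c (lowGamma D H κ a d b)

variable {D : Fin n → Derivation ℝ A A} {o : Fin n} {κ : Fin n → A} {H : A}

namespace IsRankOne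

variable (h : IsRankOne D o H κ)
include h

lemma shape_sq (a b : Fin n) : ∑ c, shape D o κ a c * shape D o κ c b =
    divergence D o κ * shape D o κ a b := by
  rw [← h.trace_shape, Finset.sum_mul]
  exact Finset.sum_congr rfl fun c _ => by rw [h.minors a c c b]; ring

lemma cancel {x y : A} (hxy : divergence D o κ * x = divergence D o κ * y) : x = y :=
  h.isUnit.mul_left_cancel hxy

lemma shape_eq (a b : Fin n) : D b (κ a) = shape D o κ a b + D o (κ a) * κ b := by
  rw [shape]; ring

/-- Symmetry of the shape tensor determines the curl ∂_c κ_b - ∂_b κ_c. Inserting it into ∂^c ∂_c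
κ_b and commuting derivatives produces the gradient of the divergence. -/
lemma box_null (b : Fin n) : box D o (κ b) = D b (divergence D o κ)
    + divergence D o κ * D o (κ b) - D o (divergence D o κ) * κ b
    - 2 * ∑ c, shape D o κ b c * D o (κ c) := by
  have hM : ∀ c, D c (κ b) = D b (κ c) + D o (κ b) * κ c - D o (κ c) * κ b := by
    intro c
    have := h.symm b c
    simp only [shape] at this
    linear_combination this
  have e : box D o (κ b) = D b (divergence D o κ) + dirD D o κ (D o (κ b))
      + D o (κ b) * divergence D o κ - D o (divergence D o κ) * κ b
      - ∑ c, sgn o c * D o (κ c) * D c (κ b) := by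
    simp only [box, divergence, dirD, map_sum, Finset.mul_sum, Finset.sum_mul,
      ← Finset.sum_add_distrib, ← Finset.sum_sub_distrib]
    refine Finset.sum_congr rfl fun c _ => ?_
    conv_lhs => rw [hM c]
    simp only [map_add, map_sub, Derivation.leibniz, smul_eq_mul, map_sgn]
    rw [h.comm c b, h.comm c o (κ c)]
    ring
  have e2 : ∑ c, sgn o c * D o (κ c) * D c (κ b) = ∑ c, shape D o κ b c * D o (κ c)
      + D o (κ b) * ∑ c, sgn o c * κ c * D o (κ c) := by
    simp only [Finset.mul_sum, ← Finset.sum_add_distrib]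
    refine Finset.sum_congr rfl fun c _ => ?_
    rw [← h.sgn_shape_right, shape]; ring
  rw [e, e2, h.dirD_deriv, h.null_deriv]; ring

/-- With N the shape tensor and θ its trace, u = N ∂_o κ / θ is the projection of ∂_o κ to the image
of N. `mixed_constraint` becomes θ(∂H - κ ∂_o H) = 2N ∂H - 2H N ∂_o κ; applying N, with N² = θN and
Nκ = 0, gives N ∂H = 2H N ∂_o κ, and hence the gradient of `H`. -/
lemma exists_splitting (hv : ∀ b d, ric D (ksGamma D o H κ) b d = 0) :
    ∃ u z, IsSplitting D o H κ u z := by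
  obtain ⟨ρ, hρ⟩ := h.isUnit.exists_right_inv
  set θ := divergence D o κ with hθ
  set N := shape D o κ with hN
  set w : Fin n → A := fun b => ∑ c, N b c * D o (κ c) with hw
  set t : Fin n → A := fun b => ∑ c, N b c * D c H with ht
  have hg : ∀ b, gradInner D o H (κ b) = t b := by
    intro b
    have : gradInner D o H (κ b) = t b + D o (κ b) * dirD D o κ H := by
      simp only [gradInner, ht, dirD, Finset.mul_sum, ← Finset.sum_add_distrib]
      refine Finset.sum_congr rfl fun c _ => ?_
      rw [hN, ← h.sgn_shape_right, shape]; ring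
    rw [this, h.dirD_zero]; ring
  have h1 : ∀ b, θ * (D b H - κ b * D o H) = 2 * t b - 2 * (H * w b) := by
    intro b
    have := h.mixed_constraint H hv b
    rw [hg, h.box_null, fluxCoeff, h.dirD_zero, zero_add, Derivation.leibniz,
      Derivation.leibniz] at this
    simp only [smul_eq_mul, ← hθ, ← hN] at this
    linear_combination this
  have hNN : ∀ a b, ∑ c, N a c * N c b = θ * N a b := h.shape_sq
  have hNv : ∀ (v : Fin n → A) a, ∑ b, N a b * ∑ c, N b c * v c = θ * ∑ c, N a c * v c := by
    intro v a
    simp only [Finset.mul_sum]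
    rw [Finset.sum_comm]
    refine Finset.sum_congr rfl fun c _ => ?_
    rw [← mul_assoc, ← hNN, Finset.sum_mul]
    exact Finset.sum_congr rfl fun b _ => by ring
  have hNκ : ∀ a, ∑ b, N a b * κ b = 0 := h.shape_mul_null
  have h2 : ∀ a, t a = 2 * (H * w a) := by
    intro a
    have e1 : ∑ b, N a b * (θ * (D b H - κ b * D o H)) = θ * t a := by
      have : ∑ b, N a b * (θ * (D b H - κ b * D o H)) = θ * t a
          - θ * D o H * ∑ b, N a b * κ b := by
        simp only [ht, Finset.mul_sum, ← Finset.sum_sub_distrib]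
        exact Finset.sum_congr rfl fun b _ => by ring
      rw [this, hNκ]; ring
    have e2 : ∑ b, N a b * (2 * t b - 2 * (H * w b)) = 2 * (θ * t a) - 2 * (H * (θ * w a)) := by
      have : ∑ b, N a b * (2 * t b - 2 * (H * w b)) =
          2 * ∑ b, N a b * t b - 2 * H * ∑ b, N a b * w b := by
        simp only [Finset.mul_sum (s := Finset.univ) (a := (2 : A)),
          Finset.mul_sum (s := Finset.univ) (a := 2 * H), ← Finset.sum_sub_distrib]
        exact Finset.sum_congr rfl fun b _ => by ring
      rw [this, hNv, hNv]; ring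
    have e3 : θ * t a = 2 * (θ * t a) - 2 * (H * (θ * w a)) := by
      refine e1.symm.trans (Eq.trans ?_ e2)
      exact Finset.sum_congr rfl fun b _ => by rw [h1]
    apply h.cancel
    linear_combination -e3
  have hNw : ∀ a, ∑ b, N a b * w b = θ * w a := hNv _
  have hκw : ∑ a, κ a * w a = 0 := by
    simp only [hw, Finset.mul_sum]
    rw [Finset.sum_comm]
    refine Finset.sum_eq_zero fun c _ => ?_
    have := h.null_mul_shape c
    calc _ = (∑ a, κ a * N a c) * D o (κ c) := by
          rw [Finset.sum_mul]; exact Finset.sum_congr rfl fun a _ => by ring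
      _ = 0 := by rw [this, zero_mul]
  have hwo : w o = 0 := by
    simp only [hw]; exact Finset.sum_eq_zero fun c _ => by rw [hN, h.shape_time_left, zero_mul]
  have hκu : ∑ a, sgn o a * κ a * (ρ * w a) = 0 := by
    have : ∑ a, sgn o a * κ a * (ρ * w a) = ρ * ∑ a, κ a * w a := by
      rw [Finset.mul_sum]
      refine Finset.sum_congr rfl fun a _ => ?_
      have := sgn_mul_of_zero (o := o) hwo a
      linear_combination κ a * ρ * this
    rw [this, hκw, mul_zero]
  have hNz : ∀ a, ∑ b, N a b * (D o (κ b) - ρ * w b) = 0 := by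
    intro a
    have : ∑ b, N a b * (D o (κ b) - ρ * w b) = w a - ρ * ∑ b, N a b * w b := by
      simp only [mul_sub, Finset.sum_sub_distrib, Finset.mul_sum (a := ρ) (f := fun b => N a b * w b)]
      congr 1
      exact Finset.sum_congr rfl fun b _ => by ring
    rw [this, hNw]; linear_combination - w a * hρ
  refine ⟨fun a => ρ * w a, fun a => D o (κ a) - ρ * w a, ⟨fun a => by ring, fun a => ?_,
    fun a b c => ?_, hNz, ?_, ?_, ?_, hκu, ?_⟩⟩
  · apply h.cancel
    have := h1 a
    rw [h2] at this
    linear_combination this - 2 * H * w a * hρ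
  · simp only [hw, ← hN, Finset.mul_sum]
    refine Finset.sum_congr rfl fun e _ => ?_
    have m := h.minors a b e c
    have s1 := h.symm c e
    have s2 := h.symm b e
    simp only [← hN] at m s1 s2
    rw [s1, s2]
    linear_combination ρ * D o (κ e) * m
  · have : ∑ a, ρ * w a * (D o (κ a) - ρ * w a) =
        ρ * ∑ c, D o (κ c) * ∑ a, N c a * (D o (κ a) - ρ * w a) := by
      simp only [Finset.mul_sum]
      rw [Finset.sum_comm]
      refine Finset.sum_congr rfl fun a _ => ?_
      simp only [hw, Finset.mul_sum, Finset.sum_mul]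
      refine Finset.sum_congr rfl fun c _ => ?_
      rw [hN, h.symm a c]; ring
    rw [this]
    simp [hNz]
  · simp [hwo]
  · simp [hwo, h.deriv_time]
  · simp only [mul_sub, Finset.sum_sub_distrib, hκu, h.null_deriv, sub_zero]

lemma linRiem_antisymm (a b c d : Fin n) :
    linRiem D H κ a b c d = - linRiem D H κ b a c d := by
  simp only [linRiem, lowGamma, map_add, map_sub]
  rw [h.comm d c (H * (κ a * κ b)), mul_comm (κ a) (κ b), h.comm d c (H * (κ b * κ a)),
    mul_comm (κ c) (κ b), mul_comm (κ c) (κ a), mul_comm (κ d) (κ b), mul_comm (κ d) (κ a)]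
  ring

lemma linRiem_pair (a b c d : Fin n) :
    linRiem D H κ a b c d = linRiem D H κ c d a b := by
  simp only [linRiem, lowGamma, map_add, map_sub]
  rw [h.comm d c (H * (κ a * κ b)), h.comm b a (H * (κ c * κ d)), h.comm d b, h.comm d a,
    h.comm c b, h.comm c a, mul_comm (κ c) (κ a), mul_comm (κ b) (κ d)]
  ring

lemma linRiem_bianchi (a b c d e : Fin n) :
    D e (linRiem D H κ a b c d) + D c (linRiem D H κ a b d e) + D d (linRiem D H κ a b e c) = 0 := by
  simp only [linRiem, map_sub]
  rw [h.comm e d, h.comm e c, h.comm d c]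
  ring

end IsRankOne

namespace IsSplitting

variable {u z : Fin n → A} (s : IsSplitting D o H κ u z) (h : IsRankOne D o H κ)
include s h

/-- The leading part of the Christoffel symbols. -/
lemma lowGamma_eq (a b c : Fin n) : lowGamma D H κ a b c =
    κ a * (D o H * (κ b * κ c) + 2 * (H * (shape D o κ b c + u b * κ c + κ b * u c)))
      + 2 * (H * z a) * (κ b * κ c) := by
  rw [lowGamma_expand]
  rw [s.grad a, s.grad b, s.grad c, h.shape_eq a b, h.shape_eq c b, h.shape_eq a c, h.shape_eq b c,
    h.shape_eq b a, h.shape_eq c a, s.add, s.add, s.add]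
  rw [h.symm c b, h.symm b a, h.symm c a]
  ring

/-- The products of Christoffel symbols only involve κ·κ, κ·u, κ·z, u·z and the shape tensor applied
to κ or z, all of which vanish. The linearized curvature is therefore exact. -/
lemma riem_eq (a b c d : Fin n) :
    riem D (ksGamma D o H κ) a b c d = sgn o a * linRiem D H κ a b c d := by
  have hΓ : ∀ a b c, ksGamma D o H κ a b c = - (sgn o a * lowGamma D H κ a b c) := by
    intro a b c
    rw [h.ksGamma_geodesic, h.dirD_zero]; ring
  have quad : ∀ a b c d, ∑ e, ksGamma D o H κ a c e * ksGamma D o H κ e d b = 0 := by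
    intro a b c d
    set G := D o H * (κ d * κ b) + 2 * (H * (shape D o κ d b + u d * κ b + κ d * u b)) with hG
    have : ∑ e, ksGamma D o H κ a c e * ksGamma D o H κ e d b = sgn o a *
        ((κ a * G * (D o H * κ c + 2 * H * u c) + 2 * (H * z a) * κ c * G)
            * ∑ e, sgn o e * κ e * κ e
          + 2 * H * κ a * G * ∑ e, shape D o κ c e * κ e
          + 2 * H * κ a * κ c * G * ∑ e, sgn o e * κ e * u e
          + 2 * H * κ d * κ b * (κ a * (D o H * κ c + 2 * H * u c) + 2 * (H * z a) * κ c)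
            * ∑ e, sgn o e * κ e * z e
          + 2 * H * κ d * κ b * (2 * H * κ a) * ∑ e, shape D o κ c e * z e
          + 2 * H * κ d * κ b * (2 * H * κ a * κ c) * ∑ e, u e * z e) := by
      simp only [Finset.mul_sum, ← Finset.sum_add_distrib]
      refine Finset.sum_congr rfl fun e _ => ?_
      rw [hΓ, hΓ, s.lowGamma_eq h, s.lowGamma_eq h]
      have e1 := h.sgn_shape_right c e
      have e2 := sgn_mul_of_zero (o := o) s.u_o e
      rw [← hG]
      linear_combination sgn o a * (2 * H * κ a * (κ e * G + 2 * (H * z e) * (κ d * κ b))) * e1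
        + sgn o a * (2 * H * κ a * κ c * (2 * (H * z e) * (κ d * κ b))) * e2
    rw [this, h.null, h.shape_mul_null, s.null_u, s.null_z, s.shape_z, s.u_z]
    ring
  rw [riem, Finset.sum_sub_distrib, quad, quad, hΓ, hΓ, linRiem]
  simp only [map_neg, Derivation.leibniz, smul_eq_mul, map_sgn]
  ring

lemma lowGamma_time (a c : Fin n) : lowGamma D H κ a c o =
    κ a * D c H + 2 * (H * z a) * κ c := by
  rw [s.lowGamma_eq h, h.time, s.u_o, h.shape_time_right, s.grad c]; ring

lemma linRiem_time_aux (a c d : Fin n) : linRiem D H κ a o c d =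
    κ c * (D o H * shape D o κ a d - D o (κ a) * D d H + 2 * D d (H * z a)
        - 2 * (H * z a) * D o (κ d))
    - κ d * (D o H * shape D o κ a c - D o (κ a) * D c H + 2 * D c (H * z a)
        - 2 * (H * z a) * D o (κ c)) := by
  rw [linRiem, s.lowGamma_time h, s.lowGamma_time h]
  have e : ∀ c d, D d (κ a * D c H + 2 * (H * z a) * κ c) = D d (κ a) * D c H
      + κ a * D d (D c H) + 2 * D d (H * z a) * κ c + 2 * (H * z a) * D d (κ c) := by
    intro c d
    rw [map_add, Derivation.leibniz, Derivation.leibniz (D d) (2 * (H * z a)), map_two_mul]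
    simp only [smul_eq_mul]; ring
  rw [e, e, h.comm d c]
  rw [h.shape_eq a d, h.shape_eq a c, h.shape_eq c d, h.shape_eq d c]
  linear_combination shape D o κ a d * s.grad c - shape D o κ a c * s.grad d
    + 2 * H * s.shape_mul a d c + 2 * (H * z a) * h.symm c d

/-- By `linRiem_time_aux` the left side has the form κ_c X_d - κ_d X_c, and setting c = o recovers X
modulo κ. -/
lemma linRiem_time (b c d : Fin n) : linRiem D H κ o b c d =
    κ c * linRiem D H κ o b o d - κ d * linRiem D H κ o b o c := by
  rw [h.linRiem_antisymm o b, h.linRiem_antisymm o b, h.linRiem_antisymm o b,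
    s.linRiem_time_aux h, s.linRiem_time_aux h, s.linRiem_time_aux h, h.time]
  ring

/-- The curvature contains the expression N_ad N_cb - N_ac N_db, with N the shape tensor; it is a
2×2 minor and vanishes at rank one. -/
lemma linRiem_split (a b c d : Fin n) : linRiem D H κ a b c d =
    κ a * linRiem D H κ o b c d - κ b * linRiem D H κ o a c d := by
  rw [h.linRiem_antisymm o a]
  simp only [linRiem, s.lowGamma_time h]
  simp only [s.lowGamma_eq h, h.time, s.z_o]
  set G : Fin n → A := fun c =>
    D o H * (κ c * κ b) + 2 * (H * (shape D o κ c b + u c * κ b + κ c * u b)) with hG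
  have e : ∀ c d, D d (κ a * G c + 2 * (H * z a) * (κ c * κ b)) = D d (κ a) * G c
      + κ a * D d (G c) + D d (2 * (H * z a)) * (κ c * κ b)
      + 2 * (H * z a) * (D d (κ c) * κ b + κ c * D d (κ b)) := by
    intro c d
    simp only [map_add, Derivation.leibniz, smul_eq_mul]; ring
  have e1 : ∀ c d, D d (κ a * D c H + 2 * (H * z a) * κ c) = D d (κ a) * D c H
      + κ a * D d (D c H) + D d (2 * (H * z a)) * κ c + 2 * (H * z a) * D d (κ c) := by
    intro c d
    simp only [map_add, Derivation.leibniz, smul_eq_mul]; ring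
  have e2 : ∀ c d, D d (1 * G c + 2 * (H * 0) * (κ c * κ b)) = D d (G c) := by
    intro c d; congr 1; ring
  simp only [hG] at e e2 ⊢
  rw [e c d, e d c, e1, e1, e2, e2, h.comm d c, h.shape_eq a d, h.shape_eq a c, h.shape_eq b d,
    h.shape_eq b c, s.add a, s.add b]
  linear_combination -κ b * (shape D o κ a d + (u a + z a) * κ d) * s.grad c
    + κ b * (shape D o κ a c + (u a + z a) * κ c) * s.grad d
    + 2 * H * (h.minors a d c b - h.minors a c d b) + 2 * H * shape D o κ a b * h.symm c d
    + 2 * H * κ c * (u b * h.symm a d + s.shape_mul d a b)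
    - 2 * H * κ d * (u b * h.symm a c + s.shape_mul c a b)
    + 2 * H * z a * κ c * h.symm b d - 2 * H * z a * κ d * h.symm b c

/-- Differentiating κ^a z_a = 0 shows that the bracket in `linRiem_time_aux`, contracted with κ, is
a multiple of κ_c; such a multiple cancels in the antisymmetrization. -/
lemma linRiem_null (d : Fin n) : ∑ a, sgn o a * κ a * linRiem D H κ o a o d = 0 := by
  have key : ∀ c, ∑ a, sgn o a * κ a * (D o H * shape D o κ a c - D o (κ a) * D c H
      + 2 * D c (H * z a) - 2 * (H * z a) * D o (κ c)) =
      - (2 * H * (∑ a, D o (κ a) * z a) * κ c) := by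
    intro c
    have e0 : ∑ a, sgn o a * κ a * D c (H * z a) =
        - (H * (∑ a, D o (κ a) * z a) * κ c) := by
      have := congrArg (D c) s.null_z
      simp only [map_sum, map_zero, Derivation.leibniz, smul_eq_mul, map_sgn, mul_zero,
        add_zero] at this
      have e3 : ∑ a, sgn o a * κ a * D c (H * z a) = D c H * ∑ a, sgn o a * κ a * z a
          + H * ∑ a, (sgn o a * κ a * D c (z a) + z a * (sgn o a * D c (κ a)))
          - H * ∑ a, shape D o κ c a * z a - H * (∑ a, D o (κ a) * z a) * κ c := by
        simp only [Finset.mul_sum, Finset.sum_mul, ← Finset.sum_add_distrib,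
          ← Finset.sum_sub_distrib, Derivation.leibniz, smul_eq_mul]
        refine Finset.sum_congr rfl fun a _ => ?_
        have e4 := sgn_mul_of_zero (o := o) s.z_o a
        rw [h.shape_eq a c, h.symm c a]
        linear_combination - H * (shape D o κ a c + D o (κ a) * κ c) * e4
      rw [e3, s.null_z, s.shape_z, this]; ring
    have e1 : ∑ a, sgn o a * κ a * (D o H * shape D o κ a c - D o (κ a) * D c H
      + 2 * D c (H * z a) - 2 * (H * z a) * D o (κ c)) =
        D o H * ∑ a, κ a * shape D o κ a c - D c H * ∑ a, sgn o a * κ a * D o (κ a)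
        + 2 * ∑ a, sgn o a * κ a * D c (H * z a)
        - 2 * H * D o (κ c) * ∑ a, sgn o a * κ a * z a := by
      simp only [Finset.mul_sum, ← Finset.sum_add_distrib, ← Finset.sum_sub_distrib]
      refine Finset.sum_congr rfl fun a _ => ?_
      linear_combination κ a * D o H * h.sgn_shape_left a c
    rw [e1, e0, h.null_mul_shape, h.null_deriv, s.null_z]; ring
  have e2 : ∑ a, sgn o a * κ a * linRiem D H κ o a o d =
      κ d * ∑ a, sgn o a * κ a * (D o H * shape D o κ a o - D o (κ a) * D o H
        + 2 * D o (H * z a) - 2 * (H * z a) * D o (κ o))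
      - ∑ a, sgn o a * κ a * (D o H * shape D o κ a d - D o (κ a) * D d H
        + 2 * D d (H * z a) - 2 * (H * z a) * D o (κ d)) := by
    simp only [Finset.mul_sum, ← Finset.sum_sub_distrib]
    refine Finset.sum_congr rfl fun a _ => ?_
    rw [h.linRiem_antisymm o a, s.linRiem_time_aux h, h.time]; ring
  rw [e2, key, key, h.time]; ring

/-- A vacuum Kerr-Schild metric with an expanding optical matrix of rank one is flat. -/
lemma linRiem_eq_zero (hv : ∀ b d, ric D (ksGamma D o H κ) b d = 0) (a b c d : Fin n) :
    linRiem D H κ a b c d = 0 := by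
  -- The whole curvature is encoded in this symmetric matrix, which is traceless and annihilates the
  -- time direction and κ.
  set Ω : Fin n → Fin n → A := fun a d => linRiem D H κ o a o d with hΩ
  set N := shape D o κ with hN
  have hT : ∀ b c d, linRiem D H κ o b c d = κ c * Ω b d - κ d * Ω b c := s.linRiem_time h
  have hT4 : ∀ a b c d, linRiem D H κ a b c d =
      κ a * (κ c * Ω b d - κ d * Ω b c) - κ b * (κ c * Ω a d - κ d * Ω a c) := by
    intro a b c d; rw [s.linRiem_split h, hT, hT]
  have hs : ∀ a b, Ω a b = Ω b a := fun a b => h.linRiem_pair o a o b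
  have h0 : ∀ a, Ω a o = 0 := by
    intro a
    have := hT a o o
    apply two_mul_cancel
    have h2 : linRiem D H κ o a o o = Ω a o := rfl
    have h3 : linRiem D H κ o a o o = 0 := by simp [linRiem]
    rw [← h2, h3, mul_zero]
  have hκ : ∀ b, ∑ e, sgn o e * κ e * Ω b e = 0 := by
    intro b
    simp only [hs b]
    exact s.linRiem_null h b
  have htr : ∑ a, Ω a a = 0 := by
    have := hv o o
    simp only [ric, s.riem_eq h] at this
    rw [← this]
    refine Finset.sum_congr rfl fun a _ => ?_
    rw [h.linRiem_antisymm a o, h.linRiem_pair o a a o, h.linRiem_antisymm a o,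
      h.linRiem_pair o a o a]
    have := sgn_mul_of_zero (o := o) (X := fun a => Ω a a) (h0 o) a
    simpa using this.symm
  -- Contraction of the Bianchi identity with κ gives the transport equation of Ω.
  have hD : ∀ b c, dirD D o κ (Ω b c) = - ∑ e, Ω b e * N e c := by
    intro b c
    have bi : ∀ e, - D e (Ω b c) + D c (Ω b e)
        + D o (κ e * Ω b c - κ c * Ω b e) = 0 := by
      intro e
      have := h.linRiem_bianchi o b c o e
      simp only [hT, h0, h.time, mul_zero, one_mul, zero_sub, sub_zero, map_neg] at this
      exact this
    have k1 : ∀ x, ∑ e, sgn o e * κ e * D x (Ω b e) =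
        - ∑ e, Ω b e * N e x - (∑ e, D o (κ e) * Ω b e) * κ x := by
      intro x
      have := congrArg (D x) (hκ b)
      simp only [map_sum, map_zero, Derivation.leibniz, smul_eq_mul, map_sgn, mul_zero,
        add_zero] at this
      have e3 : ∑ e, sgn o e * κ e * D x (Ω b e) =
          ∑ e, (sgn o e * κ e * D x (Ω b e) + Ω b e * (sgn o e * D x (κ e)))
          - ∑ e, Ω b e * N e x - (∑ e, D o (κ e) * Ω b e) * κ x := by
        simp only [Finset.sum_mul, ← Finset.sum_sub_distrib]
        refine Finset.sum_congr rfl fun e _ => ?_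
        have e4 := sgn_mul_of_zero (o := o) (X := Ω b) (h0 b) e
        rw [h.shape_eq e x]
        linear_combination - (shape D o κ e x + D o (κ e) * κ x) * e4
      rw [e3, this]; ring
    have k2 : ∑ e, sgn o e * κ e * (- D e (Ω b c) + D c (Ω b e)
        + D o (κ e * Ω b c - κ c * Ω b e)) = - dirD D o κ (Ω b c)
        + ∑ e, sgn o e * κ e * D c (Ω b e) + D o (Ω b c) * ∑ e, sgn o e * κ e * κ e
        + Ω b c * ∑ e, sgn o e * κ e * D o (κ e)
        - D o (κ c) * ∑ e, sgn o e * κ e * Ω b e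
        - κ c * ∑ e, sgn o e * κ e * D o (Ω b e) := by
      simp only [dirD, Finset.mul_sum, ← Finset.sum_add_distrib, ← Finset.sum_sub_distrib,
        ← Finset.sum_neg_distrib, map_sub, Derivation.leibniz, smul_eq_mul]
      exact Finset.sum_congr rfl fun e _ => by ring
    simp only [bi, mul_zero, Finset.sum_const_zero, k1, h.null, h.null_deriv, hκ, h.time] at k2
    have k3 : ∑ e, Ω b e * N e o = 0 :=
      Finset.sum_eq_zero fun e _ => by rw [hN, h.shape_time_right, mul_zero]
    rw [k3] at k2
    linear_combination k2
  -- Ω is symmetric, hence so is its derivative along κ, and with it the product ΩN.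
  have hcomm : ∀ b c, ∑ e, N b e * Ω e c = ∑ e, Ω b e * N e c := by
    intro b c
    have h1 := hD b c
    rw [hs b c, hD c b, neg_inj] at h1
    rw [← h1]
    exact Finset.sum_congr rfl fun e _ => by rw [hs c e, hN, h.symm e b]; ring
  -- Subtracting κ times the Bianchi identities with a time index removes all derivatives of Ω and
  -- leaves an algebraic relation with N.
  have alg : ∀ a b c e, N a e * Ω b c - N a c * Ω b e - N b e * Ω a c + N b c * Ω a e = 0 := by
    intro a b c e
    have bi := h.linRiem_bianchi a b c o e
    have x1 : ∀ c d, linRiem D H κ a b c d =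
      κ a * linRiem D H κ o b c d - κ b * linRiem D H κ o a c d := s.linRiem_split h a b
    have x2 := h.linRiem_bianchi o b c o e
    have x3 := h.linRiem_bianchi o a c o e
    simp only [x1, map_sub, Derivation.leibniz, smul_eq_mul] at bi
    simp only [hT, h0, h.time] at bi x2 x3
    rw [h.shape_eq a e, h.shape_eq b e, h.shape_eq a c, h.shape_eq b c] at bi
    linear_combination -bi + κ a * x2 - κ b * x3
  -- Trace of the algebraic relation over its first and last index, using tr Ω = 0 and NΩ = ΩN.
  have hθ : ∀ b c, divergence D o κ * Ω b c = 2 * ∑ e, N b e * Ω e c := by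
    intro b c
    have : ∑ a, (N a a * Ω b c - N a c * Ω b a - N b a * Ω a c + N b c * Ω a a) =
        (∑ a, N a a) * Ω b c - ∑ a, Ω b a * N a c - ∑ a, N b a * Ω a c
          + N b c * ∑ a, Ω a a := by
      simp only [Finset.mul_sum, Finset.sum_mul, ← Finset.sum_add_distrib,
        ← Finset.sum_sub_distrib]
      exact Finset.sum_congr rfl fun e _ => by ring
    simp only [alg, Finset.sum_const_zero] at this
    rw [h.trace_shape, htr, ← hcomm] at this
    linear_combination -this
  -- Multiplication by N and N² = θN turn θΩ = 2NΩ into θNΩ = 2θNΩ.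
  have hNΩ : ∀ b c, ∑ e, N b e * Ω e c = 0 := by
    intro b c
    have e1 : ∑ e, N b e * (divergence D o κ * Ω e c) =
        divergence D o κ * ∑ e, N b e * Ω e c := by
      rw [Finset.mul_sum]; exact Finset.sum_congr rfl fun e _ => by ring
    have e2 : ∑ e, N b e * (2 * ∑ f, N e f * Ω f c) =
        2 * (divergence D o κ * ∑ e, N b e * Ω e c) := by
      simp only [Finset.mul_sum]
      rw [Finset.sum_comm]
      refine Finset.sum_congr rfl fun f _ => ?_
      rw [← mul_assoc (divergence D o κ), ← h.shape_sq, Finset.sum_mul, Finset.mul_sum]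
      exact Finset.sum_congr rfl fun b _ => by ring
    simp only [hθ] at e1
    apply h.cancel
    rw [mul_zero]
    linear_combination e1 - e2
  have hΩ0 : ∀ b c, Ω b c = 0 := by
    intro b c
    apply h.cancel
    rw [hθ, hNΩ]; ring
  rw [hT4]; simp only [hΩ0]; ring

end IsSplitting

end RankOne

/-! ### Normal form of an operator with T + T' = 2r T T'. -/

section CanonicalForm

open Module

/-- The index set of the canonical form: blocks, nonzero and zero diagonal entries. -/
abbrev BlockIndex (P Q Z : Type) : Type := (Fin 2 × P) ⊕ (Q ⊕ Z)

variable {V : Type*} [NormedAddCommGroup V] [InnerProductSpace ℝ V] [FiniteDimensional ℝ V]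

/-- An orthonormal family in which the operator `T` is in canonical form. -/
structure IsCanonicalFamily {P Q Z : Type} (T : V →ₗ[ℝ] V) (r : ℝ) (a : P → ℝ)
    (b : BlockIndex P Q Z → V) : Prop where
  orthonormal : Orthonormal ℝ b
  fst : ∀ μ, T (b (.inl (0, μ))) = (r / (r ^ 2 + a μ ^ 2)) • b (.inl (0, μ))
    - (a μ / (r ^ 2 + a μ ^ 2)) • b (.inl (1, μ))
  snd : ∀ μ, T (b (.inl (1, μ))) = (a μ / (r ^ 2 + a μ ^ 2)) • b (.inl (0, μ))
    + (r / (r ^ 2 + a μ ^ 2)) • b (.inl (1, μ))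
  diag : ∀ x, T (b (.inr (.inl x))) = (1 / r) • b (.inr (.inl x))
  zero : ∀ x, T (b (.inr (.inr x))) = 0

variable {T T' : V →ₗ[ℝ] V} {r : ℝ}

/-- On `W` the relation becomes 2T = 2r T², so the eigenvalues are 0 and 1/r. There are no rotation
blocks, whence the empty index type. -/
lemma exists_canonicalFamily_of_symm (hr : r ≠ 0) (hadj : ∀ x y, (inner ℝ (T x) y) = (inner ℝ x (T' y)))
    (h1 : ∀ x, T x + T' x = (2 * r) • T (T' x)) (W : Submodule ℝ V) (hT : ∀ w ∈ W, T w ∈ W)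
    (hsym : ∀ w ∈ W, T w = T' w) :
    ∃ (P Q Z : Type) (_ : Fintype P) (_ : Fintype Q) (_ : Fintype Z) (a : P → ℝ)
      (b : BlockIndex P Q Z → V), IsCanonicalFamily T r a b ∧ (∀ i, b i ∈ W) ∧
      Fintype.card (BlockIndex P Q Z) = finrank ℝ W := by
  set S : W →ₗ[ℝ] W := T.restrict hT with hS
  have hSs : S.IsSymmetric := by
    intro x y
    simp only [Submodule.coe_inner, hS, LinearMap.coe_restrict_apply]
    rw [hadj, hsym y y.2]
  set β := hSs.eigenvectorBasis rfl with hβ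
  set ev := hSs.eigenvalues rfl with hev
  have hT' : ∀ i, T (β i) = ev i • (β i : V) := by
    intro i
    have := congrArg Subtype.val (hSs.apply_eigenvectorBasis rfl i)
    simpa only [hS, LinearMap.coe_restrict_apply, LinearMap.comp_apply, Submodule.coe_smul,
      RCLike.ofReal_real_eq_id, id] using this
  have hev2 : ∀ i, ev i = 0 ∨ ev i = 1 / r := by
    intro i
    have e := h1 (β i)
    have hne : (β i : V) ≠ 0 := by
      have := β.orthonormal.ne_zero i
      simpa using this
    rw [← hsym _ (β i).2, hT', map_smul, hT', ← two_smul ℝ, smul_smul, smul_smul, smul_smul] at e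
    have e2 := smul_left_injective ℝ hne e
    have e3 : ev i * (1 - r * ev i) = 0 := by linear_combination e2 / 2
    rcases mul_eq_zero.mp e3 with h | h
    · exact Or.inl h
    · right; field_simp; linarith
  let f : BlockIndex Empty {i // ev i ≠ 0} {i // ¬ ev i ≠ 0} → Fin (finrank ℝ W) :=
    Sum.elim (fun x => x.2.elim) (Sum.elim Subtype.val Subtype.val)
  have hf : Function.Injective f := by
    rintro (⟨_, ⟨⟩⟩ | x | x) (⟨_, ⟨⟩⟩ | y | y) hxy
    · simp only [f, Sum.elim_inr, Sum.elim_inl] at hxy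
      rw [Subtype.ext hxy]
    · have h : x.1 = y.1 := hxy
      exact absurd (h ▸ x.2) y.2
    · have h : x.1 = y.1 := hxy
      exact absurd (h ▸ y.2) x.2
    · simp only [f, Sum.elim_inr] at hxy
      rw [Subtype.ext hxy]
  refine ⟨Empty, {i // ev i ≠ 0}, {i // ¬ ev i ≠ 0}, inferInstance, inferInstance, inferInstance,
    fun x => x.elim, fun i => (β (f i) : V), ⟨?_, fun x => x.elim, fun x => x.elim, ?_, ?_⟩,
    fun i => (β (f i)).2, ?_⟩
  · exact (β.orthonormal.comp_linearIsometry W.subtypeₗᵢ).comp f hf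
  · intro x
    rw [hT']
    congr 1
    exact (hev2 _).resolve_left x.2
  · intro x
    rw [hT']
    have : ev x.1 = 0 := not_not.mp x.2
    simp only [f, Sum.elim_inr, this, zero_smul]
  · simp only [Fintype.card_sum, Fintype.card_prod, Fintype.card_empty, mul_zero, zero_add]
    rw [← Fintype.card_sum, Fintype.card_congr (Equiv.sumCompl _), Fintype.card_fin]

/-- The two-dimensional invariant subspace on which `T` is not symmetric. -/
lemma exists_rotation_pair (hadj : ∀ x y, (inner ℝ (T x) y) = (inner ℝ x (T' y)))
    (h1 : ∀ x, T x + T' x = (2 * r) • T (T' x)) (h2 : ∀ x, T' (T x) = T (T' x))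
    (W : Submodule ℝ V) (hT : ∀ w ∈ W, T w ∈ W) (hT' : ∀ w ∈ W, T' w ∈ W)
    (hns : ∃ w ∈ W, T w ≠ T' w) :
    ∃ v ∈ W, ∃ u ∈ W, ∃ a : ℝ, (inner ℝ v v) = 1 ∧ (inner ℝ u u) = 1 ∧ (inner ℝ v u) = 0 ∧
      T v = (r / (r ^ 2 + a ^ 2)) • v - (a / (r ^ 2 + a ^ 2)) • u ∧
      T u = (a / (r ^ 2 + a ^ 2)) • v + (r / (r ^ 2 + a ^ 2)) • u ∧
      T' v = (r / (r ^ 2 + a ^ 2)) • v + (a / (r ^ 2 + a ^ 2)) • u ∧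
      T' u = (r / (r ^ 2 + a ^ 2)) • u - (a / (r ^ 2 + a ^ 2)) • v := by
  -- `T` need not have a real eigenvector, but T T' is self-adjoint and can be diagonalized.
  set S : W →ₗ[ℝ] W := (T ∘ₗ T').restrict (fun w hw => hT _ (hT' _ hw)) with hS
  have hadj' : ∀ x y, (inner ℝ (T' x) y) = (inner ℝ x (T y)) := fun x y => by
    rw [real_inner_comm, ← hadj, real_inner_comm]
  have hSs : S.IsSymmetric := by
    intro x y
    simp only [Submodule.coe_inner, hS, LinearMap.coe_restrict_apply, LinearMap.comp_apply]
    rw [hadj, hadj']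
  set β := hSs.eigenvectorBasis rfl with hβ
  have hG : ∀ i, T (T' (β i)) = hSs.eigenvalues rfl i • (β i : V) := by
    intro i
    have := congrArg Subtype.val (hSs.apply_eigenvectorBasis rfl i)
    simpa only [hS, LinearMap.coe_restrict_apply, LinearMap.comp_apply, Submodule.coe_smul,
      RCLike.ofReal_real_eq_id, id] using this
  obtain ⟨i, hi⟩ : ∃ i, T (β i) ≠ T' (β i) := by
    by_contra! hcon
    obtain ⟨w, hw, hne⟩ := hns
    apply hne
    have : (T ∘ₗ W.subtype) = (T' ∘ₗ W.subtype) := β.toBasis.ext fun i => by simpa using hcon i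
    exact LinearMap.congr_fun this ⟨w, hw⟩
  set v : V := (β i : W).val with hv
  set g := hSs.eigenvalues rfl i with hg
  have hvv : (inner ℝ v v) = 1 := by
    have hvn : ‖v‖ = 1 := β.orthonormal.1 i
    rw [real_inner_self_eq_norm_sq, hvn]; norm_num
  set x := T v with hx
  -- The relation `h1` expresses T'v, and then Tx, through v and x = Tv; the plane spanned by v and
  -- x is thus invariant under both operators.
  have hT'v : T' v = (2 * r * g) • v - x := by
    have := h1 v
    rw [hG, smul_smul] at this
    rw [← this]; abel
  have hTx : T x = (2 * r * g) • x - g • v := by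
    have := hG i
    rw [← hv, hT'v, map_sub, map_smul] at this
    rw [← this]; abel
  have hT'x : T' x = g • v := by rw [hx, h2, hG]
  have hxx : (inner ℝ x x) = g := by
    rw [hx, hadj, h2, hG, inner_smul_right, hvv, mul_one]
  have hvx : (inner ℝ v x) = r * g := by
    have e : (inner ℝ v x) = (inner ℝ v (T' v)) := by rw [hx, ← hadj, real_inner_comm]
    rw [hT'v, inner_sub_right, inner_smul_right, hvv] at e
    linarith
  set y := x - (r * g) • v with hy
  have hyy : (inner ℝ y y) = g - r ^ 2 * g ^ 2 := by
    simp only [hy, inner_sub_left, inner_sub_right, inner_smul_left, inner_smul_right, hxx, hvv,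
      hvx, real_inner_comm v x, RCLike.conj_to_real]
    ring
  have hy0 : y ≠ 0 := by
    intro h0
    apply hi
    have : x = (r * g) • v := sub_eq_zero.mp h0
    rw [hT'v, this]; module
  have hpos : 0 < g - r ^ 2 * g ^ 2 := hyy ▸ real_inner_self_pos.mpr hy0
  have hg0 : 0 < g := by nlinarith [sq_nonneg (r * g)]
  set β' := Real.sqrt (g - r ^ 2 * g ^ 2) with hβ'
  have hβ0 : 0 < β' := Real.sqrt_pos.mpr hpos
  have hβ2 : β' ^ 2 = g - r ^ 2 * g ^ 2 := Real.sq_sqrt hpos.le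
  -- The block has diagonal entry s = r g and off-diagonal entry A = β', with s² + A² = g. Hence a =
  -- A / g gives r² + a² = 1 / g, the required shape of s and A.
  have hden : r ^ 2 + (β' / g) ^ 2 = 1 / g := by
    rw [div_pow, hβ2]; field_simp; ring
  have hs : r / (r ^ 2 + (β' / g) ^ 2) = r * g := by rw [hden]; field_simp
  have ha : β' / g / (r ^ 2 + (β' / g) ^ 2) = β' := by rw [hden]; field_simp
  set u := (-(1 / β')) • y with hu
  have hyu : y = (-β') • u := by
    rw [hu, smul_smul, neg_mul_neg, mul_one_div_cancel hβ0.ne', one_smul]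
  have hxu : x = (r * g) • v - β' • u := by
    have : x = y + (r * g) • v := by rw [hy]; abel
    rw [this, hyu, neg_smul]; abel
  have hvW : v ∈ W := (β i).2
  have hyW : y ∈ W := W.sub_mem (hT _ hvW) (W.smul_mem _ hvW)
  refine ⟨v, hvW, u, W.smul_mem _ hyW, β' / g, hvv, ?_, ?_, ?_, ?_, ?_, ?_⟩
  · rw [hu, inner_smul_left, inner_smul_right, hyy, ← hβ2]
    simp only [RCLike.conj_to_real]
    field_simp
  · rw [hu, inner_smul_right, hy, inner_sub_right, hvx, inner_smul_right, hvv]; ring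
  · rw [hs, ha]; exact hxu
  · rw [hs, ha, hu, map_smul, hy, map_sub, map_smul, hTx, ← hx, ← hy, ← hu]
    have e : (2 * r * g) • x - g • v - (r * g) • x =
        (-β' ^ 2) • v + (-(β' * (r * g))) • u := by
      rw [hβ2, hxu]; module
    rw [e, smul_add, smul_smul, smul_smul]
    congr 2 <;> field_simp
  · rw [hs, ha, hT'v, hxu]; module
  · rw [hs, ha, hu, map_smul, hy, map_sub, map_smul, hT'x, hT'v, ← hy, ← hu]
    have e : g • v - (r * g) • ((2 * r * g) • v - x) =
        (β' ^ 2) • v + (-(β' * (r * g))) • u := by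
      rw [hβ2, hxu]; module
    rw [e, smul_add, smul_smul, smul_smul, sub_eq_neg_add, ← neg_smul]
    congr 2 <;> field_simp

/-- Add a rotation pair to a canonical family. -/
def consPair {P Q Z : Type} (v u : V) (b : BlockIndex P Q Z → V) :
    BlockIndex (Option P) Q Z → V
  | .inl (i, none) => if i = 0 then v else u
  | .inl (i, some μ) => b (.inl (i, μ))
  | .inr x => b (.inr x)

/-- Induction on the dimension: as long as T and T' differ on `W`, a rotation plane is split off.
Its orthogonal complement in `W` is again invariant because T and T' are adjoint to each other. -/
lemma exists_canonicalFamily_aux (hr : r ≠ 0) (hadj : ∀ x y, (inner ℝ (T x) y) = (inner ℝ x (T' y)))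
    (h1 : ∀ x, T x + T' x = (2 * r) • T (T' x)) (h2 : ∀ x, T' (T x) = T (T' x)) (d : ℕ) :
    ∀ W : Submodule ℝ V, finrank ℝ W = d → (∀ w ∈ W, T w ∈ W) → (∀ w ∈ W, T' w ∈ W) →
    ∃ (P Q Z : Type) (_ : Fintype P) (_ : Fintype Q) (_ : Fintype Z) (a : P → ℝ)
      (b : BlockIndex P Q Z → V), IsCanonicalFamily T r a b ∧ (∀ i, b i ∈ W) ∧
      Fintype.card (BlockIndex P Q Z) = d := by
  induction d using Nat.strong_induction_on with
  | _ d ih =>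
  intro W hW hT hT'
  classical
  by_cases hns : ∃ w ∈ W, T w ≠ T' w
  swap
  · push Not at hns
    have := exists_canonicalFamily_of_symm hr hadj h1 W hT hns
    rwa [hW] at this
  obtain ⟨v, hvW, u, huW, a₀, hvv, huu, hvu, hTv, hTu, hT'v, hT'u⟩ :=
    exists_rotation_pair hadj h1 h2 W hT hT' hns
  have hadj' : ∀ x y, (inner ℝ (T' x) y) = (inner ℝ x (T y)) := fun x y => by
    rw [real_inner_comm, ← hadj, real_inner_comm]
  have hvn : ‖v‖ = 1 := by rw [norm_eq_sqrt_real_inner, hvv, Real.sqrt_one]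
  have hun : ‖u‖ = 1 := by rw [norm_eq_sqrt_real_inner, huu, Real.sqrt_one]
  set K : Submodule ℝ V := Submodule.span ℝ (Set.range ![v, u]) with hK
  have hon : Orthonormal ℝ ![v, u] := by
    rw [orthonormal_iff_ite]
    intro i j
    fin_cases i <;> fin_cases j <;> simp [hvn, hun, hvu, real_inner_comm v u]
  have hKd : finrank ℝ K = 2 := by
    simpa using finrank_span_eq_card hon.linearIndependent
  have hKW : K ≤ W := by
    rw [hK, Submodule.span_le]
    rintro _ ⟨i, rfl⟩
    fin_cases i
    exacts [hvW, huW]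
  have mem : ∀ y, y ∈ Kᗮ ↔ (inner ℝ v y) = 0 ∧ (inner ℝ u y) = 0 := by
    intro y
    rw [Submodule.mem_orthogonal, hK]
    constructor
    · intro h
      exact ⟨h v (Submodule.subset_span ⟨0, rfl⟩), h u (Submodule.subset_span ⟨1, rfl⟩)⟩
    · rintro ⟨hv, hu⟩ w hw
      induction hw using Submodule.span_induction with
      | mem x hx =>
        obtain ⟨i, rfl⟩ := hx
        fin_cases i
        exacts [hv, hu]
      | zero => simp
      | add x y _ _ hx hy => rw [inner_add_left, hx, hy, add_zero]
      | smul c x _ hx => rw [inner_smul_left, hx, mul_zero]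
  have hdim : finrank ℝ (Kᗮ ⊓ W : Submodule ℝ V) + 2 = d := by
    rw [← hW, ← Submodule.finrank_add_inf_finrank_orthogonal hKW, hKd]; ring
  obtain ⟨P, Q, Z, iP, iQ, iZ, a, b, hb, hbW, hcard⟩ := ih _ (by omega) (Kᗮ ⊓ W) rfl
    (fun w ⟨hw1, hw2⟩ => by
      have := (mem w).mp hw1
      refine ⟨(mem _).mpr ⟨?_, ?_⟩, hT w hw2⟩
      · rw [← hadj', hT'v, inner_add_left, inner_smul_left, inner_smul_left, this.1, this.2]; simp
      · rw [← hadj', hT'u, inner_sub_left, inner_smul_left, inner_smul_left, this.1, this.2]; simp)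
    (fun w ⟨hw1, hw2⟩ => by
      have := (mem w).mp hw1
      refine ⟨(mem _).mpr ⟨?_, ?_⟩, hT' w hw2⟩
      · rw [← hadj, hTv, inner_sub_left, inner_smul_left, inner_smul_left, this.1, this.2]; simp
      · rw [← hadj, hTu, inner_add_left, inner_smul_left, inner_smul_left, this.1, this.2]; simp)
  have hbv : ∀ i, (inner ℝ v (b i)) = 0 ∧ (inner ℝ u (b i)) = 0 := fun i => (mem _).mp (hbW i).1
  have hbo := orthonormal_iff_ite.mp hb.orthonormal
  refine ⟨Option P, Q, Z, inferInstance, iQ, iZ, fun x => x.elim a₀ a, consPair v u b,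
    ⟨?_, ?_, ?_, ?_, ?_⟩, ?_, ?_⟩
  · rw [orthonormal_iff_ite]
    rintro (⟨i, _ | μ⟩ | x) (⟨j, _ | ν⟩ | y)
    · fin_cases i <;> fin_cases j <;> simp [consPair, hvn, hun, hvu, real_inner_comm v u]
    · fin_cases i <;> simp [consPair, hbv]
    · fin_cases i <;> simp [consPair, hbv]
    · fin_cases j <;> simp [consPair, hbv, real_inner_comm v, real_inner_comm u]
    · simp [consPair, hbo]
    · simp [consPair, hbo]
    · fin_cases j <;> simp [consPair, hbv, real_inner_comm v, real_inner_comm u]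
    · simp [consPair, hbo]
    · simp [consPair, hbo]
  · rintro (_ | μ)
    · simpa [consPair] using hTv
    · simpa [consPair] using hb.fst μ
  · rintro (_ | μ)
    · simpa [consPair] using hTu
    · simpa [consPair] using hb.snd μ
  · exact hb.diag
  · exact hb.zero
  · rintro (⟨i, _ | μ⟩ | x)
    · fin_cases i
      exacts [hvW, huW]
    · exact (hbW _).2
    · exact (hbW _).2
  · simp only [BlockIndex, Fintype.card_sum, Fintype.card_prod, Fintype.card_fin,
      Fintype.card_option] at hcard ⊢
    omega

end CanonicalForm

/-! ### The canonical matrix: block structure, trace, rank and derivative. -/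

section CanonicalMatrix

/-- The position of the block indices in the canonical form. -/
def blockEquiv (p q z : ℕ) : BlockIndex (Fin p) (Fin q) (Fin z) ≃ Fin (p * 2 + (q + z)) :=
  (Equiv.sumCongr ((Equiv.prodComm _ _).trans finProdFinEquiv) finSumFinEquiv).trans finSumFinEquiv

@[simp] lemma blockEquiv_inl {p q z : ℕ} (i : Fin 2) (μ : Fin p) :
    (blockEquiv p q z (.inl (i, μ))).val = i.val + 2 * μ.val := rfl

@[simp] lemma blockEquiv_inr_inl {p q z : ℕ} (x : Fin q) :
    (blockEquiv p q z (.inr (.inl x))).val = p * 2 + x.val := rfl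

@[simp] lemma blockEquiv_inr_inr {p q z : ℕ} (x : Fin z) :
    (blockEquiv p q z (.inr (.inr x))).val = p * 2 + (q + x.val) := rfl

/-- The canonical form as a block matrix. -/
def canonicalBlock {p q z : ℕ} (a : Fin p → ℝ) (r : ℝ) :
    Matrix (BlockIndex (Fin p) (Fin q) (Fin z)) (BlockIndex (Fin p) (Fin q) (Fin z)) ℝ :=
  Matrix.fromBlocks
    (Matrix.blockDiagonal fun μ => !![r / (r ^ 2 + a μ ^ 2), a μ / (r ^ 2 + a μ ^ 2);
      -(a μ / (r ^ 2 + a μ ^ 2)), r / (r ^ 2 + a μ ^ 2)]) 0 0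
    (Matrix.fromBlocks ((1 / r) • 1) 0 0 0)

lemma canonicalMatrix_apply {p q z : ℕ} (a : Fin p → ℝ) (r : ℝ)
    (x y : BlockIndex (Fin p) (Fin q) (Fin z)) :
    canonicalMatrix (p * 2 + (q + z)) p (2 * p + q) a r (blockEquiv p q z x) (blockEquiv p q z y) =
      canonicalBlock a r x y := by
  have hd : ∀ (i : Fin 2) (μ : Fin p), (i.val + 2 * μ.val) / 2 = μ.val := fun i μ => by omega
  have hm : ∀ (i : Fin 2) (μ : Fin p), (i.val + 2 * μ.val) % 2 = i.val := fun i μ => by omega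
  unfold canonicalMatrix
  simp only [EmbeddingLike.apply_eq_iff_eq]
  rcases x with ⟨i, μ⟩ | x | x
  · have hlt : (blockEquiv p q z (.inl (i, μ))).val / 2 < p := by
      rw [blockEquiv_inl, hd]; exact μ.2
    rw [dif_pos hlt]
    simp only [blockEquiv_inl, hd, hm, Fin.eta]
    rcases y with ⟨j, ν⟩ | y | y
    · simp only [blockEquiv_inl, hd, canonicalBlock, Matrix.fromBlocks_apply₁₁,
        Matrix.blockDiagonal_apply, Sum.inl.injEq, Prod.mk.injEq, Fin.val_inj]
      by_cases hμ : ν = μ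
      · subst hμ
        fin_cases i <;> fin_cases j <;> simp
      · simp [hμ, Ne.symm hμ]
    · have : ¬ (p * 2 + y.val) / 2 = μ.val := by omega
      simp [canonicalBlock, this]
    · have : ¬ (p * 2 + (q + y.val)) / 2 = μ.val := by omega
      simp [canonicalBlock, this]
  · have hlt : ¬ (blockEquiv p q z (.inr (.inl x))).val / 2 < p := by
      rw [blockEquiv_inr_inl]; omega
    rw [dif_neg hlt]
    have hm : p * 2 + x.val < 2 * p + q := by omega
    rcases y with ⟨j, ν⟩ | y | y <;>
      simp [canonicalBlock, hm, Matrix.one_apply, eq_comm]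
  · have hlt : ¬ (blockEquiv p q z (.inr (.inr x))).val / 2 < p := by
      rw [blockEquiv_inr_inr]; omega
    rw [dif_neg hlt]
    have hm : ¬ p * 2 + (q + x.val) < 2 * p + q := by omega
    rcases y with ⟨j, ν⟩ | y | y <;>
      simp [canonicalBlock, hm]

lemma canonicalMatrix_submatrix {p q z : ℕ} (a : Fin p → ℝ) (r : ℝ) :
    (canonicalMatrix (p * 2 + (q + z)) p (2 * p + q) a r).submatrix
      (blockEquiv p q z) (blockEquiv p q z) = canonicalBlock a r :=
  Matrix.ext fun x y => canonicalMatrix_apply a r x y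

variable {p q z : ℕ} (a : Fin p → ℝ) {r : ℝ}

lemma trace_canonicalMatrix (r : ℝ) :
    (canonicalMatrix (p * 2 + (q + z)) p (2 * p + q) a r).trace =
      ∑ μ, 2 * (r / (r ^ 2 + a μ ^ 2)) + q * (1 / r) := by
  rw [Matrix.trace, ← (blockEquiv p q z).sum_comp]
  simp only [Matrix.diag_apply, canonicalMatrix_apply, canonicalBlock]
  rw [Fintype.sum_sum_type, Fintype.sum_sum_type, Fintype.sum_prod_type]
  simp [Matrix.blockDiagonal_apply, two_mul, Finset.sum_add_distrib]

/-- The product with the transpose is diagonal, with entries 1/(r² + a²) on the blocks, then 1/r²,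
then 0, and it has the same rank. -/
lemma rank_canonicalMatrix (hr : r ≠ 0) :
    (canonicalMatrix (p * 2 + (q + z)) p (2 * p + q) a r).rank = 2 * p + q := by
  rw [← Matrix.rank_submatrix _ (blockEquiv p q z) (blockEquiv p q z), canonicalMatrix_submatrix,
    ← Matrix.rank_self_mul_transpose]
  have hpos : ∀ μ, 0 < r ^ 2 + a μ ^ 2 := fun μ => by positivity
  have : (canonicalBlock a r : Matrix (BlockIndex (Fin p) (Fin q) (Fin z)) _ ℝ) *
      (canonicalBlock a r)ᵀ = Matrix.diagonal
        (Sum.elim (fun x => 1 / (r ^ 2 + a x.2 ^ 2)) (Sum.elim (fun _ => 1 / r ^ 2) 0)) := by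
    rw [canonicalBlock, Matrix.fromBlocks_transpose, Matrix.fromBlocks_transpose,
      Matrix.fromBlocks_multiply, Matrix.fromBlocks_multiply, Matrix.blockDiagonal_transpose,
      ← Matrix.blockDiagonal_mul]
    ext x y
    rcases x with ⟨i, μ⟩ | x | x <;> rcases y with ⟨j, ν⟩ | y | y
    · by_cases hμ : μ = ν
      · subst hμ
        have := (hpos μ).ne'
        simp only [Matrix.fromBlocks_apply₁₁, Matrix.blockDiagonal_apply, if_true,
          Matrix.zero_mul, add_zero, Matrix.diagonal_apply, Sum.inl.injEq,
          Prod.mk.injEq, and_true, Sum.elim_inl]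
        fin_cases i <;> fin_cases j <;>
          simp only [Fin.zero_eta, Fin.mk_one, Matrix.mul_apply, Fin.sum_univ_two,
            Matrix.of_apply, Matrix.cons_val', Matrix.cons_val_zero, Matrix.cons_val_one,
            Matrix.cons_val_fin_one, Matrix.transpose_apply, if_true, zero_ne_one, one_ne_zero,
            if_false] <;>
          field_simp <;> ring
      · simp [Matrix.blockDiagonal_apply, hμ]
    all_goals simp [Matrix.diagonal_apply, Matrix.one_apply, sq]
  rw [this, Matrix.rank_diagonal]
  have e : ∀ x : BlockIndex (Fin p) (Fin q) (Fin z),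
      (Sum.elim (fun x => 1 / (r ^ 2 + a x.2 ^ 2)) (Sum.elim (fun _ => 1 / r ^ 2) 0) x : ℝ) ≠ 0 ↔
        ∃ y : (Fin 2 × Fin p) ⊕ Fin q, Sum.elim Sum.inl (Sum.inr ∘ Sum.inl) y = x := by
    rintro (⟨i, μ⟩ | x | x)
    · simp [(hpos μ).ne']
    · simp [hr]
    · simp
  have hinj : Function.Injective (Sum.elim Sum.inl (Sum.inr ∘ Sum.inl) :
      (Fin 2 × Fin p) ⊕ Fin q → BlockIndex (Fin p) (Fin q) (Fin z)) := by
    rintro (x | x) (y | y) hxy <;> simp_all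
  rw [Fintype.card_congr (Equiv.subtypeEquivRight e)]
  refine Eq.trans (b := Fintype.card ((Fin 2 × Fin p) ⊕ Fin q))
    (@Fintype.card_congr _ _ _ _ (Equiv.ofInjective _ hinj).symm) ?_
  simp

/-- A block represents the complex number s + iA = 1/(r - ia), whose derivative in r is minus its
square; the same holds for 1/r and for 0. The canonical matrix therefore solves the Riccati equation
F' = -F². -/
lemma hasDerivAt_canonicalMatrix (hr : r ≠ 0) (i j) :
    HasDerivAt (fun r => canonicalMatrix (p * 2 + (q + z)) p (2 * p + q) a r i j)
      (-((canonicalMatrix (p * 2 + (q + z)) p (2 * p + q) a r *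
        canonicalMatrix (p * 2 + (q + z)) p (2 * p + q) a r) i j)) r := by
  obtain ⟨x, rfl⟩ := (blockEquiv p q z).surjective i
  obtain ⟨y, rfl⟩ := (blockEquiv p q z).surjective j
  have e : (canonicalMatrix (p * 2 + (q + z)) p (2 * p + q) a r *
        canonicalMatrix (p * 2 + (q + z)) p (2 * p + q) a r)
          (blockEquiv p q z x) (blockEquiv p q z y) =
      (canonicalBlock a r * canonicalBlock a r :
        Matrix (BlockIndex (Fin p) (Fin q) (Fin z)) (BlockIndex (Fin p) (Fin q) (Fin z)) ℝ) x y := by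
    rw [Matrix.mul_apply, ← (blockEquiv p q z).sum_comp]
    simp only [canonicalMatrix_apply, Matrix.mul_apply]
  rw [e]
  simp only [canonicalMatrix_apply]
  have hpos : ∀ μ, 0 < r ^ 2 + a μ ^ 2 := fun μ => by positivity
  have hs : ∀ μ, HasDerivAt (fun r => r / (r ^ 2 + a μ ^ 2))
      (-((r / (r ^ 2 + a μ ^ 2)) ^ 2 - (a μ / (r ^ 2 + a μ ^ 2)) ^ 2)) r := by
    intro μ
    have h1 : HasDerivAt (fun r => r ^ 2 + a μ ^ 2) (2 * r) r := by
      simpa using (hasDerivAt_pow 2 r).add_const (a μ ^ 2)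
    convert! (hasDerivAt_id r).div h1 (hpos μ).ne' using 1
    have := (hpos μ).ne'
    simp only [id]
    field_simp; ring
  have ha : ∀ μ, HasDerivAt (fun r => a μ / (r ^ 2 + a μ ^ 2))
      (-(2 * (r / (r ^ 2 + a μ ^ 2)) * (a μ / (r ^ 2 + a μ ^ 2)))) r := by
    intro μ
    have h1 : HasDerivAt (fun r => r ^ 2 + a μ ^ 2) (2 * r) r := by
      simpa using (hasDerivAt_pow 2 r).add_const (a μ ^ 2)
    convert! (hasDerivAt_const r (a μ)).div h1 (hpos μ).ne' using 1
    have := (hpos μ).ne'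
    field_simp; ring
  have hi : HasDerivAt (fun r : ℝ => 1 / r) (-((1 / r) * (1 / r))) r := by
    convert! hasDerivAt_inv hr using 1
    · ext; simp
    · field_simp
  rw [canonicalBlock, Matrix.fromBlocks_multiply, Matrix.fromBlocks_multiply,
    ← Matrix.blockDiagonal_mul]
  simp only [canonicalBlock]
  rcases x with ⟨i, μ⟩ | x | x <;> rcases y with ⟨j, ν⟩ | y | y
  · by_cases hμ : μ = ν
    · subst hμ
      simp only [Matrix.fromBlocks_apply₁₁, Matrix.blockDiagonal_apply, if_true,
        Matrix.zero_mul, add_zero]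
      fin_cases i <;> fin_cases j <;>
          simp only [Fin.zero_eta, Fin.mk_one, Matrix.mul_apply, Fin.sum_univ_two,
            Matrix.of_apply, Matrix.cons_val', Matrix.cons_val_zero, Matrix.cons_val_one,
            Matrix.cons_val_fin_one]
      · convert! hs μ using 1; ring
      · convert! ha μ using 1; ring
      · convert! (ha μ).neg using 1; ring
      · convert! hs μ using 1; ring
    · simpa [Matrix.blockDiagonal_apply, hμ] using hasDerivAt_const r (0 : ℝ)
  all_goals try simpa using hasDerivAt_const r (0 : ℝ)
  by_cases hxy : x = y
  · subst hxy
    simpa using hi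
  · simpa [hxy] using hasDerivAt_const r (0 : ℝ)

end CanonicalMatrix

/-! ### Normality and orthogonal reduction of matrices satisfying the optical constraint. -/

section MatrixForm

variable {m : Type*} [Fintype m] [DecidableEq m]

/-- The optical constraint implies normality. -/
lemma transpose_mul_of_constraint {L : Matrix m m ℝ} {r : ℝ} (hr : r ≠ 0)
    (h : L + Lᵀ = (2 * r) • (L * Lᵀ)) : Lᵀ * L = L * Lᵀ := by
  have e : ∀ A B : Matrix m m ℝ, (1 - (2 * r) • A) * (1 - (2 * r) • B) =
      1 - (2 * r) • (A + B) + (2 * r) • (2 * r) • (A * B) := by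
    intro A B
    simp only [sub_mul, mul_sub, one_mul, mul_one, Matrix.smul_mul, Matrix.mul_smul, smul_add]
    abel
  -- The constraint says that 1 - 2rL is orthogonal. A one-sided inverse of a square matrix is
  -- two-sided, so the constraint also holds with LᵀL.
  have h1 : (1 - (2 * r) • L) * (1 - (2 * r) • Lᵀ) = 1 := by
    rw [e, h]; abel
  have h2 := mul_eq_one_comm.mp h1
  rw [e, add_comm Lᵀ L, h] at h2
  have h3 : (2 * r) • (2 * r) • (Lᵀ * L) = (2 * r) • (2 * r) • (L * Lᵀ) := by
    calc _ = (1 - (2 * r) • (2 * r) • (L * Lᵀ) + (2 * r) • (2 * r) • (Lᵀ * L)) - 1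
          + (2 * r) • (2 * r) • (L * Lᵀ) := by abel
      _ = _ := by rw [h2]; abel
  have h0 : 2 * r ≠ 0 := by simpa using hr
  exact smul_right_injective _ h0 (smul_right_injective _ h0 h3)

lemma exists_canonicalMatrix {d : ℕ} {L : Matrix (Fin d) (Fin d) ℝ} {r : ℝ} (hr : r ≠ 0)
    (h : L + Lᵀ = (2 * r) • (L * Lᵀ)) :
    ∃ (p q z : ℕ) (a : Fin p → ℝ) (Q : Matrix (Fin d) (Fin d) ℝ), d = p * 2 + (q + z) ∧
      Q * Qᵀ = 1 ∧ Q * L * Qᵀ = canonicalMatrix d p (2 * p + q) a r := by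
  have hn := transpose_mul_of_constraint hr h
  set T := Matrix.toEuclideanLin L with hT
  set T' := Matrix.toEuclideanLin Lᵀ with hT'
  have ip : ∀ x y : EuclideanSpace ℝ (Fin d), inner ℝ x y = x.ofLp ⬝ᵥ y.ofLp := by
    intro x y
    simp [PiLp.inner_apply, dotProduct, mul_comm]
  have hTa : ∀ x, (T x).ofLp = L *ᵥ x.ofLp := fun x => by simp [hT]
  have hT'a : ∀ x, (T' x).ofLp = Lᵀ *ᵥ x.ofLp := fun x => by simp [hT']
  have hadj : ∀ x y, inner ℝ (T x) y = inner ℝ x (T' y) := by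
    intro x y
    rw [ip, ip, hTa, hT'a, Matrix.mulVec_transpose, dotProduct_comm, Matrix.dotProduct_mulVec,
      dotProduct_comm]
  have h1 : ∀ x, T x + T' x = (2 * r) • T (T' x) := by
    intro x
    apply WithLp.ofLp_injective
    simp only [WithLp.ofLp_add, WithLp.ofLp_smul, hTa, hT'a, Matrix.mulVec_mulVec]
    rw [← Matrix.add_mulVec, h, Matrix.smul_mulVec]
  have h2 : ∀ x, T' (T x) = T (T' x) := by
    intro x
    apply WithLp.ofLp_injective
    simp only [hTa, hT'a, Matrix.mulVec_mulVec, hn]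
  obtain ⟨P, Q, Z, iP, iQ, iZ, a, b, hb, -, hcard⟩ :=
    exists_canonicalFamily_aux hr hadj h1 h2 d ⊤ (by simp) (fun _ _ => trivial) (fun _ _ => trivial)
  set eP := Fintype.equivFin P
  set eQ := Fintype.equivFin Q
  set eZ := Fintype.equivFin Z
  set p := Fintype.card P
  set q := Fintype.card Q
  set z := Fintype.card Z
  have hd : d = p * 2 + (q + z) := by
    rw [← hcard]; simp [BlockIndex, p, q, z, mul_comm]
  clear hcard
  subst hd
  let e : BlockIndex (Fin p) (Fin q) (Fin z) → BlockIndex P Q Z :=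
    Sum.map (Prod.map id eP.symm) (Sum.map eQ.symm eZ.symm)
  have he : Function.Injective e :=
    Function.Injective.sumMap (Function.Injective.prodMap (fun _ _ h => h) eP.symm.injective)
      (Function.Injective.sumMap eQ.symm.injective eZ.symm.injective)
  set c : BlockIndex (Fin p) (Fin q) (Fin z) → EuclideanSpace ℝ (Fin (p * 2 + (q + z))) := b ∘ e
  set a' : Fin p → ℝ := a ∘ eP.symm
  have hc : IsCanonicalFamily T r a' c :=
    ⟨hb.orthonormal.comp e he, fun μ => hb.fst (eP.symm μ), fun μ => hb.snd (eP.symm μ),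
      fun x => hb.diag (eQ.symm x), fun x => hb.zero (eZ.symm x)⟩
  have hco := orthonormal_iff_ite.mp hc.orthonormal
  set ψ := blockEquiv p q z
  set M : Matrix (Fin (p * 2 + (q + z))) (Fin (p * 2 + (q + z))) ℝ :=
    Matrix.of fun i => (c (ψ.symm i)).ofLp with hM
  refine ⟨p, q, z, a', M, rfl, ?_, ?_⟩
  · ext i j
    have := hco (ψ.symm i) (ψ.symm j)
    rw [ip] at this
    simpa [Matrix.mul_apply, hM, dotProduct, Matrix.one_apply] using this
  · ext i j
    obtain ⟨x, rfl⟩ := ψ.surjective i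
    obtain ⟨y, rfl⟩ := ψ.surjective j
    rw [canonicalMatrix_apply]
    have : (M * L * Mᵀ) (ψ x) (ψ y) = inner ℝ (c x) (T (c y)) := by
      rw [ip, hTa, Matrix.mul_assoc, Matrix.mul_apply]
      simp [dotProduct, hM, Matrix.mul_apply, Matrix.mulVec]
    rw [this]
    rcases y with ⟨j, ν⟩ | y | y
    · fin_cases j
      · simp only [Fin.zero_eta, hc.fst, inner_sub_right, inner_smul_right, hco]
        rcases x with ⟨i, μ⟩ | x | x
        · by_cases hμ : μ = ν
          · subst hμ
            fin_cases i <;> simp [canonicalBlock, Matrix.blockDiagonal_apply]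
          · simp [canonicalBlock, Matrix.blockDiagonal_apply, hμ]
        all_goals simp [canonicalBlock]
      · simp only [Fin.mk_one, hc.snd, inner_add_right, inner_smul_right, hco]
        rcases x with ⟨i, μ⟩ | x | x
        · by_cases hμ : μ = ν
          · subst hμ
            fin_cases i <;> simp [canonicalBlock, Matrix.blockDiagonal_apply]
          · simp [canonicalBlock, Matrix.blockDiagonal_apply, hμ]
        all_goals simp [canonicalBlock]
    · rw [hc.diag, inner_smul_right, hco]
      rcases x with ⟨i, μ⟩ | x | x <;> simp [canonicalBlock, Matrix.one_apply]
    · rw [hc.zero, inner_zero_right]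
      rcases x with ⟨i, μ⟩ | x | x <;> simp [canonicalBlock]

end MatrixForm

/-- For K = fκ and δ the derivative of `H` along κ the sum is K^b K_{a;b}. Affine parametrization
thus amounts to f being constant along κ. -/
lemma IsGeodesicNull.contract_multiple {n : ℕ} {A : Type*} [CommRing A] [Algebra ℝ A]
    {D : Fin n → Derivation ℝ A A} {o : Fin n} {κ : Fin n → A} (hg : IsGeodesicNull D o κ)
    (f δ : A) (a : Fin n) :
    ∑ b, f * (sgn o b * κ b) * (f * D b (κ a) + D b f * κ a - f * (δ * (κ a * κ b))) =
      f * (dirD D o κ f * κ a) := by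
  have : ∑ b, f * (sgn o b * κ b) * (f * D b (κ a) + D b f * κ a - f * (δ * (κ a * κ b))) =
      f * f * ∑ b, sgn o b * κ b * D b (κ a) + f * κ a * ∑ b, sgn o b * κ b * D b f
      - f * f * δ * κ a * ∑ b, sgn o b * κ b * κ b := by
    simp only [Finset.mul_sum, ← Finset.sum_add_distrib, ← Finset.sum_sub_distrib]
    exact Finset.sum_congr rfl fun b _ => by ring
  rw [this, hg.contract_right, hg.null, dirD]; ring

/-! ### Translation of the pointwise definitions into the algebra of smooth functions. -/

section Bridge

variable {n : ℕ} {U : Set (Vec n)} {H : Vec n → ℝ} {k : Vec n → Vec n}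

lemma sum_ksG_mul_ksGi {A : Type*} [CommRing A] [Algebra ℝ A] {o : Fin n} {κ : Fin n → A}
    (hn : ∑ a, sgn o a * κ a * κ a = 0) (H : A) (a b : Fin n) :
    ∑ c, ksG o H κ a c * ksGi o H κ c b = if a = b then 1 else 0 := by
  have : ∑ c, ksG o H κ a c * ksGi o H κ c b =
      (∑ c, if a = c then sgn o a * (if c = b then sgn o c else 0) else 0)
      + (∑ c, if a = c then sgn o a * (2 * (H * ((sgn o c * κ c) * (sgn o b * κ b)))) else 0)
      - (∑ c, if c = b then 2 * (H * (κ a * κ c)) * sgn o c else 0)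
      - 2 * (H * κ a) * (2 * (H * (sgn o b * κ b))) * ∑ c, sgn o c * κ c * κ c := by
    simp only [Finset.mul_sum, ← Finset.sum_add_distrib, ← Finset.sum_sub_distrib]
    refine Finset.sum_congr rfl fun c _ => ?_
    simp only [ksG, ksGi]
    split_ifs <;> ring
  rw [this, hn]
  simp only [Finset.sum_ite_eq, Finset.sum_ite_eq', Finset.mem_univ, if_true]
  by_cases hab : a = b
  · subst hab
    simp only [if_true]
    linear_combination (1 + 2 * H * κ a * sgn o a * κ a) * sgn_mul_self (A := A) o a
  · simp only [hab, if_false]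
    linear_combination (2 * H * κ a * sgn o b * κ b) * sgn_mul_self (A := A) o a

lemma sum_ksGi_mul {A : Type*} [CommRing A] [Algebra ℝ A] {o : Fin n} {κ : Fin n → A}
    (hn : ∑ a, sgn o a * κ a * κ a = 0) (H : A) (a : Fin n) :
    ∑ b, ksGi o H κ a b * κ b = sgn o a * κ a := by
  have : ∑ b, ksGi o H κ a b * κ b = (∑ b, if a = b then sgn o a * κ b else 0)
      + 2 * H * (sgn o a * κ a) * ∑ b, sgn o b * κ b * κ b := by
    simp only [Finset.mul_sum, ← Finset.sum_add_distrib]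
    refine Finset.sum_congr rfl fun b _ => ?_
    simp only [ksGi]
    split_ifs <;> ring
  rw [this, hn]; simp

@[simp] lemma evalAt_sgn (x : U) (o a : Fin n) : evalAt x (sgn o a) = sgn o a := by
  unfold sgn; split_ifs <;> simp

/-- Bridge between the pointwise definitions and the algebra of smooth functions. -/
lemma christoffel_eq (hU : IsOpen U) {g : MetricField n} {G Gi : Fin n → Fin n → smoothAlgebra U}
    (hG : ∀ (x : U) a b, g x a b = evalAt x (G a b))
    (hGi : ∀ (x : U) a b, (g x)⁻¹ a b = evalAt x (Gi a b)) (a b c : Fin n) (x : U) :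
    christoffel g a b c x = evalAt x (gamma (pd hU) G Gi a b c) := by
  have hd : ∀ a b c, partialDeriv a (fun y => g y b c) x = evalAt x (pd hU a (G b c)) := by
    intro a b c
    exact (pd_eq_partialDeriv hU a (G b c) (F := fun y => g y b c) (fun y => (hG y b c).symm) x).symm
  simp only [christoffel, gamma, map_smul, map_sum, map_mul, map_add, map_sub, hd, hGi, smul_eq_mul]

lemma riemann_eq (hU : IsOpen U) {g : MetricField n} {G Gi : Fin n → Fin n → smoothAlgebra U}
    (hG : ∀ (x : U) a b, g x a b = evalAt x (G a b))
    (hGi : ∀ (x : U) a b, (g x)⁻¹ a b = evalAt x (Gi a b)) (a b c d : Fin n) (x : U) :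
    riemann g a b c d x = evalAt x (riem (pd hU) (gamma (pd hU) G Gi) a b c d) := by
  have hd : ∀ a b c d, partialDeriv a (christoffel g b c d) x =
      evalAt x (pd hU a (gamma (pd hU) G Gi b c d)) := by
    intro a b c d
    exact (pd_eq_partialDeriv hU a _ (fun y => (christoffel_eq hU hG hGi b c d y).symm) x).symm
  simp only [riemann, riem, map_sum, map_mul, map_add, map_sub, hd, christoffel_eq hU hG hGi]

lemma ricci_eq (hU : IsOpen U) {g : MetricField n} {G Gi : Fin n → Fin n → smoothAlgebra U}
    (hG : ∀ (x : U) a b, g x a b = evalAt x (G a b))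
    (hGi : ∀ (x : U) a b, (g x)⁻¹ a b = evalAt x (Gi a b)) (b d : Fin n) (x : U) :
    ricci g b d x = evalAt x (ric (pd hU) (gamma (pd hU) G Gi) b d) := by
  simp only [ricci, ric, map_sum, riemann_eq hU hG hGi]

namespace IsKerrSchild

variable (h : IsKerrSchild U H k)
include h

lemma mono {V : Set (Vec n)} (hV : IsOpen V) (hVU : V ⊆ U) : IsKerrSchild V H k where
  four_le := h.four_le
  isOpen := hV
  smooth_H := h.smooth_H.mono hVU
  smooth_k := h.smooth_k.mono hVU
  null := fun x hx => h.null x (hVU hx)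
  ne_zero := fun x hx => h.ne_zero x (hVU hx)
  dense := by
    intro x hx
    rw [mem_closure_iff]
    intro W hW hxW
    obtain ⟨y, ⟨hy1, hy2⟩, hy3, hy4⟩ :=
      mem_closure_iff.mp (h.dense (hVU hx)) (W ∩ V) (hW.inter hV) ⟨hxW, hx⟩
    exact ⟨y, hy1, hy2, hy4⟩

/-- The index of the time direction. -/
def time : Fin n := ⟨0, by have := h.four_le; omega⟩

lemma minkowski_apply (a b : Fin n) :
    minkowski n a b = if a = b then sgn h.time a else 0 := by
  have : a.val = 0 ↔ a = h.time := by simp [Fin.ext_iff, time]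
  simp [minkowski, Matrix.diagonal_apply, sgn, this]

lemma minkowski_inv : (minkowski n)⁻¹ = minkowski n := by
  apply Matrix.inv_eq_right_inv
  ext a b
  rw [Matrix.mul_apply]
  simp only [h.minkowski_apply, Matrix.one_apply]
  by_cases hab : a = b
  · subst hab
    simp [sgn_mul_self]
  · simp [hab]

lemma null_sum (x : U) : ∑ a, sgn h.time a * k x a * k x a = 0 := by
  have := h.null x x.2
  rw [h.minkowski_inv] at this
  rw [← this, dotProduct]
  refine Finset.sum_congr rfl fun a _ => ?_
  simp [Matrix.mulVec, dotProduct, h.minkowski_apply]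
  ring

/-- Without time component the null condition would be a vanishing Euclidean sum of squares. -/
lemma time_ne_zero (x : U) : k x h.time ≠ 0 := by
  intro h0
  apply h.ne_zero x x.2
  have e := h.null_sum x
  have e2 : ∀ a, sgn h.time a * k x a * k x a = k x a * k x a := fun a => by
    rw [sgn_mul_of_zero (X := k x) h0 a]
  simp only [e2] at e
  ext a
  have := (Finset.sum_eq_zero_iff_of_nonneg (fun a _ => mul_self_nonneg (k x a))).mp e a
    (Finset.mem_univ a)
  simpa using this

/-- The components of `k` as smooth functions on `U`. -/
def comp (a : Fin n) : smoothAlgebra U :=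
  restrictSmooth (fun x => k x a) (contDiffOn_pi.mp h.smooth_k a)

/-- The time component of `k`. -/
def lapse : smoothAlgebra U := h.comp h.time

lemma lapse_apply (x : U) : evalAt x h.lapse = k x h.time := rfl

lemma lapse_ne_zero (x : U) : h.lapse x ≠ 0 := h.time_ne_zero x

/-- The covector field `κ = k / k_o`. -/
def kap (a : Fin n) : smoothAlgebra U := h.comp a * invSmooth h.lapse h.lapse_ne_zero

/-- The function `H k_o ^ 2` belonging to `κ`. -/
def prof : smoothAlgebra U := restrictSmooth H h.smooth_H * (h.lapse * h.lapse)

lemma kap_apply (a : Fin n) (x : U) : evalAt x (h.kap a) = k x a / k x h.time := rfl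

lemma prof_apply (x : U) : evalAt x h.prof = H x * (k x h.time * k x h.time) := rfl

lemma lapse_mul_kap (a : Fin n) (x : U) : evalAt x (h.lapse * h.kap a) = k x a := by
  rw [map_mul, kap_apply, lapse_apply, mul_div_cancel₀ _ (h.time_ne_zero x)]

lemma isNormalizedNull : IsNormalizedNull (pd h.isOpen) h.time h.kap where
  comm := pd_comm h.isOpen
  time := smoothAlgebra_ext fun x => by
    have := h.kap_apply h.time x
    rw [div_self (h.time_ne_zero x)] at this
    exact this
  null := smoothAlgebra_ext fun x => by
    change evalAt x (∑ a, sgn h.time a * h.kap a * h.kap a) = 0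
    have e := h.null_sum x
    simp only [map_sum, map_mul, kap_apply, evalAt_sgn]
    calc _ = (∑ a, sgn h.time a * k x a * k x a) * (1 / (k x h.time * k x h.time)) := by
          rw [Finset.sum_mul]
          refine Finset.sum_congr rfl fun a _ => ?_
          have := h.time_ne_zero x
          field_simp
      _ = 0 := by rw [e, zero_mul]

lemma metric_eq (x : U) (a b : Fin n) :
    ksMetric H k x a b = evalAt x (ksG h.time h.prof h.kap a b) := by
  have h0 := h.time_ne_zero x
  have e : evalAt x (if a = b then sgn h.time a else 0) =
      if a = b then sgn h.time a else 0 := by split_ifs <;> simp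
  have e2 : evalAt x (2 : smoothAlgebra U) = 2 := map_ofNat _ 2
  rw [ksG, map_sub, e, map_mul, map_mul, map_mul, e2, prof_apply, kap_apply, kap_apply]
  simp only [ksMetric, Matrix.sub_apply, Matrix.smul_apply, Matrix.vecMulVec_apply, smul_eq_mul,
    h.minkowski_apply]
  field_simp

lemma metric_inv_eq (x : U) (a b : Fin n) :
    (ksMetric H k x)⁻¹ a b = evalAt x (ksGi h.time h.prof h.kap a b) := by
  have : (ksMetric H k x)⁻¹ = Matrix.of fun a b => evalAt x (ksGi h.time h.prof h.kap a b) := by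
    apply Matrix.inv_eq_right_inv
    ext a b
    rw [Matrix.mul_apply]
    simp only [h.metric_eq, Matrix.of_apply, ← map_mul, ← map_sum]
    rw [sum_ksG_mul_ksGi h.isNormalizedNull.null, Matrix.one_apply]
    split_ifs <;> simp
  rw [this, Matrix.of_apply]

/-- The Christoffel symbols as smooth functions. -/
abbrev Gam : Fin n → Fin n → Fin n → smoothAlgebra U :=
  ksGamma (pd h.isOpen) h.time h.prof h.kap

lemma ric_eq_zero (hv : IsVacuum U (ksMetric H k)) (b d : Fin n) :
    ric (pd h.isOpen) h.Gam b d = 0 :=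
  smoothAlgebra_ext fun x =>
    (ricci_eq h.isOpen h.metric_eq h.metric_inv_eq b d x).symm.trans (hv x x.2 b d)

/-- `ric_contract` shows that H times the norm of the acceleration vanishes. `H` is cancelled by
density, and the norm is a sum of squares since the acceleration has no time component. -/
lemma isGeodesicNull (hv : IsVacuum U (ksMetric H k)) :
    IsGeodesicNull (pd h.isOpen) h.time h.kap where
  toIsNormalizedNull := h.isNormalizedNull
  geodesic := by
    have e := h.isNormalizedNull.ric_contract h.prof
    have e0 : ∀ b d, ric (pd h.isOpen) (ksGamma (pd h.isOpen) h.time h.prof h.kap) b d = 0 :=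
      h.ric_eq_zero hv
    simp only [e0, mul_zero, Finset.sum_const_zero] at e
    set α := fun a => dirD (pd h.isOpen) h.time h.kap (h.kap a) with hα
    have hα0 : α h.time = 0 := h.isNormalizedNull.accel_time
    have e1 : restrictSmooth H h.smooth_H *
        (2 * (h.lapse * h.lapse) * ∑ a, sgn h.time a * (α a * α a)) = 0 := by
      rw [e, prof]; ring
    have e2 := eq_zero_of_mul_eq_zero_of_dense h.smooth_H h.dense e1
    have e3 : ∀ a, sgn h.time a * (α a * α a) = α a * α a := fun a => by
      rw [← mul_assoc, sgn_mul_of_zero hα0]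
    simp only [e3] at e2
    intro a
    refine smoothAlgebra_ext fun x => ?_
    have e4 := congrArg (evalAt x) e2
    have e2 : evalAt x (2 : smoothAlgebra U) = 2 := map_ofNat _ 2
    simp only [map_mul, map_sum, map_zero, lapse_apply, e2] at e4
    have e5 := (mul_eq_zero.mp e4).resolve_left
      (by have := h.time_ne_zero x; positivity)
    have := (Finset.sum_eq_zero_iff_of_nonneg
      (fun a _ => mul_self_nonneg (evalAt x (α a)))).mp e5 a (Finset.mem_univ a)
    exact mul_self_eq_zero.mp this

variable {K : Vec n → Vec n} {f : smoothAlgebra U}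

lemma raise_eq (hK : ∀ (x : U) a, K x a = evalAt x (f * h.kap a)) (x : U) (a : Fin n) :
    raise (ksMetric H k) K x a = evalAt x (f * (sgn h.time a * h.kap a)) := by
  rw [← sum_ksGi_mul h.isNormalizedNull.null h.prof, Finset.mul_sum, map_sum, raise,
    Matrix.mulVec, dotProduct]
  refine Finset.sum_congr rfl fun b _ => ?_
  rw [h.metric_inv_eq, hK, ← map_mul]
  congr 1; ring

lemma covDeriv_eq (hv : IsVacuum U (ksMetric H k)) (hK : ∀ (x : U) a, K x a = evalAt x (f * h.kap a))
    (x : U) (a b : Fin n) : covDeriv (ksMetric H k) K a b x =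
      evalAt x (f * pd h.isOpen b (h.kap a) + pd h.isOpen b f * h.kap a
        - f * (dirD (pd h.isOpen) h.time h.kap h.prof * (h.kap a * h.kap b))) := by
  have e1 : partialDeriv b (fun y => K y a) x = evalAt x (pd h.isOpen b (f * h.kap a)) :=
    (pd_eq_partialDeriv h.isOpen b _ (fun y => (hK y a).symm) x).symm
  rw [covDeriv, e1, ← (h.isGeodesicNull hv).contract_gamma_null, Finset.mul_sum,
    Derivation.leibniz, map_sub, map_sum]
  congr 1
  · congr 1
    simp only [smul_eq_mul]; ring
  · refine Finset.sum_congr rfl fun c _ => ?_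
    rw [christoffel_eq h.isOpen h.metric_eq h.metric_inv_eq, hK, ← map_mul]
    congr 1
    simp only [ksGamma]; ring

/-- Multiples of `κ` are affinely parametrized if and only if the factor is constant along `κ`. -/
lemma isAffineGeodetic_iff (hv : IsVacuum U (ksMetric H k))
    (hK : ∀ (x : U) a, K x a = evalAt x (f * h.kap a)) (hf : ∀ x : U, f x ≠ 0) :
    IsAffineGeodetic U (ksMetric H k) K ↔ dirD (pd h.isOpen) h.time h.kap f = 0 := by
  have hg := h.isGeodesicNull hv
  have e : ∀ (x : U) a, ∑ b, raise (ksMetric H k) K x b * covDeriv (ksMetric H k) K a b x =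
      evalAt x (f * (dirD (pd h.isOpen) h.time h.kap f * h.kap a)) := by
    intro x a
    simp only [h.raise_eq hK, h.covDeriv_eq hv hK, ← map_mul, ← map_sum]
    congr 1
    exact hg.contract_multiple f _ a
  constructor
  · intro hA
    refine smoothAlgebra_ext fun x => ?_
    have := hA x x.2 h.time
    rw [e, map_mul, map_mul, h.isNormalizedNull.time, map_one, mul_one] at this
    exact (mul_eq_zero.mp this).resolve_left (hf x)
  · intro h0 x hx a
    have := e ⟨x, hx⟩ a
    rw [h0] at this
    simpa using this

/-- The shape tensor of `κ` at a point. -/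
def shapeAt (x : U) : Matrix (Fin n) (Fin n) ℝ :=
  Matrix.of fun a b => evalAt x (shape (pd h.isOpen) h.time h.kap a b)

omit h in
lemma sum_contract {m : ℕ} {C N : Fin m → Fin m → ℝ} {φ : ℝ} {X Y κ u v : Fin m → ℝ}
    (hC : ∀ a b, C a b = φ * N a b + X a * κ b + κ a * Y b)
    (hu : ∑ a, κ a * u a = 0) (hv : ∑ a, κ a * v a = 0) :
    ∑ a, ∑ b, C a b * u a * v b = φ * ∑ a, ∑ b, u a * N a b * v b := by
  calc _ = ∑ a, (φ * ∑ b, u a * N a b * v b + X a * u a * ∑ b, κ b * v b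
        + κ a * u a * ∑ b, Y b * v b) := by
        refine Finset.sum_congr rfl fun a _ => ?_
        simp only [Finset.mul_sum, ← Finset.sum_add_distrib]
        refine Finset.sum_congr rfl fun b _ => ?_
        rw [hC]; ring
    _ = _ := by
        simp only [hv, mul_zero, add_zero, Finset.sum_add_distrib, ← Finset.sum_mul, hu, zero_mul,
          ← Finset.mul_sum]

/-- The covariant derivative is f times the shape tensor plus terms with a factor κ_a or κ_b, and
these vanish on vectors orthogonal to κ. Derivatives of f and of `H` drop out. -/
lemma opticalMatrix_eq (hv : IsVacuum U (ksMetric H k))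
    (hK : ∀ (x : U) a, K x a = evalAt x (f * h.kap a)) (x : U) (e : Fin (n - 2) → Vec n)
    (he : ∀ i, ∑ a, evalAt x (h.kap a) * e i a = 0) :
    opticalMatrix (ksMetric H k) K x e =
      (evalAt x f) • (Matrix.of e * h.shapeAt x * (Matrix.of e)ᵀ) := by
  ext i j
  have e1 : ∀ a b, covDeriv (ksMetric H k) K a b x = evalAt x f * h.shapeAt x a b
      + (evalAt x f * evalAt x (pd h.isOpen h.time (h.kap a))
        - evalAt x f * evalAt x (dirD (pd h.isOpen) h.time h.kap h.prof) * evalAt x (h.kap a))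
        * evalAt x (h.kap b) + evalAt x (h.kap a) * evalAt x (pd h.isOpen b f) := by
    intro a b
    rw [h.covDeriv_eq hv hK, shapeAt, Matrix.of_apply, shape]
    simp only [map_sub, map_add, map_mul]
    ring
  have e2 := sum_contract e1 (he i) (he j)
  rw [opticalMatrix, e2]
  generalize h.shapeAt x = N
  rw [Matrix.smul_apply, Matrix.mul_apply, smul_eq_mul, Finset.sum_comm]
  congr 1
  refine Finset.sum_congr rfl fun b _ => ?_
  rw [Matrix.mul_apply, Finset.sum_mul]
  rfl

end IsKerrSchild

end Bridge

/-! ### Null frames and transverse bilinear forms. -/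

section Frame

variable {n : ℕ}

/-- A bilinear form that annihilates the time direction and the null covector `κ` on both sides. -/
structure IsTransverse (o : Fin n) (κ : Fin n → ℝ) (N : Matrix (Fin n) (Fin n) ℝ) : Prop where
  time_left : ∀ b, N o b = 0
  time_right : ∀ a, N a o = 0
  null_left : ∀ b, ∑ a, κ a * N a b = 0
  null_right : ∀ a, ∑ b, N a b * κ b = 0

namespace IsTransverse

variable {o : Fin n} {κ : Fin n → ℝ} {N N' : Matrix (Fin n) (Fin n) ℝ}

lemma transpose (hN : IsTransverse o κ N) : IsTransverse o κ Nᵀ where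
  time_left := hN.time_right
  time_right := hN.time_left
  null_left a := by simpa [mul_comm] using hN.null_right a
  null_right a := by simpa [mul_comm] using hN.null_left a

lemma sgn_left (hN : IsTransverse o κ N) (a b : Fin n) : sgn o a * N a b = N a b :=
  sgn_mul_of_zero (X := fun a => N a b) (hN.time_left b) a

lemma sgn_right (hN : IsTransverse o κ N) (a b : Fin n) : sgn o b * N a b = N a b :=
  sgn_mul_of_zero (X := fun b => N a b) (hN.time_right a) b

end IsTransverse

lemma mulVec_of_metric {o : Fin n} {κ : Fin n → ℝ} {h : ℝ} {g : Matrix (Fin n) (Fin n) ℝ}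
    (hg : ∀ a b, g a b = ksG o h κ a b) (v : Vec n) (a : Fin n) :
    (g *ᵥ v) a = sgn o a * v a - 2 * h * κ a * ∑ b, κ b * v b := by
  rw [Matrix.mulVec, dotProduct, Finset.mul_sum]
  have : ∀ b, g a b * v b = (if a = b then sgn o a * v b else 0) - 2 * h * κ a * (κ b * v b) := by
    intro b; rw [hg, ksG]; split_ifs <;> ring
  simp only [this, Finset.sum_sub_distrib, Finset.sum_ite_eq, Finset.mem_univ, if_true]

/-- A null frame of the metric `η - 2 h κ κ` for the multiple `φ κ` of the null covector `κ`. -/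
structure IsKerrSchildFrame (o : Fin n) (κ : Fin n → ℝ) (h φ : ℝ)
    (g : Matrix (Fin n) (Fin n) ℝ) (l : Vec n) (e : Fin (n - 2) → Vec n) : Prop where
  two_le : 2 ≤ n
  time : κ o = 1
  null : ∑ a, sgn o a * κ a * κ a = 0
  metric : ∀ a b, g a b = ksG o h κ a b
  factor : φ ≠ 0
  frame : IsNullFrame g (φ • κ) l e

namespace IsKerrSchildFrame

variable {o : Fin n} {κ : Fin n → ℝ} {h φ : ℝ} {g : Matrix (Fin n) (Fin n) ℝ} {l : Vec n}
  {e : Fin (n - 2) → Vec n} (hf : IsKerrSchildFrame o κ h φ g l e)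
include hf

lemma null_frame (i : Fin (n - 2)) : ∑ a, κ a * e i a = 0 := by
  have := hf.frame.k_e i
  rw [smul_dotProduct, smul_eq_mul] at this
  exact (mul_eq_zero.mp this).resolve_left hf.factor

lemma metric_mulVec (v : Vec n) (a : Fin n) :
    (g *ᵥ v) a = sgn o a * v a - 2 * h * κ a * ∑ b, κ b * v b :=
  mulVec_of_metric hf.metric v a

/-- The vectors φκ (index raised), l, e_i and the covectors g l, φκ, g e_i are dual families of n
elements each, so the matrix identity B C = 1 implies C B = 1. -/
lemma completeness (a b : Fin n) :
    φ * (sgn o a * κ a) * (g *ᵥ l) b + l a * (φ * κ b) + ∑ i, e i a * (sgn o b * e i b) =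
      if a = b then 1 else 0 := by
  let kv : Vec n := fun a => φ * (sgn o a * κ a)
  have kk : ∑ a, κ a * kv a = 0 := by
    have : ∑ a, κ a * kv a = φ * ∑ a, sgn o a * κ a * κ a := by
      rw [Finset.mul_sum]; exact Finset.sum_congr rfl fun a _ => by simp only [kv]; ring
    rw [this, hf.null, mul_zero]
  have gk : ∀ v, (g *ᵥ v) ⬝ᵥ kv = (φ • κ) ⬝ᵥ v := by
    intro v
    have : (g *ᵥ v) ⬝ᵥ kv = ∑ a, φ * κ a * v a * (sgn o a * sgn o a)
        - 2 * h * (∑ b, κ b * v b) * ∑ a, κ a * kv a := by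
      rw [dotProduct, Finset.mul_sum, ← Finset.sum_sub_distrib]
      refine Finset.sum_congr rfl fun a _ => ?_
      rw [hf.metric_mulVec]; simp only [kv]; ring
    rw [this, kk, dotProduct]
    simp [sgn_mul_self]
  have hsymm : ∀ v w, (g *ᵥ v) ⬝ᵥ w = v ⬝ᵥ (g *ᵥ w) := by
    intro v w
    rw [Matrix.dotProduct_mulVec, ← Matrix.mulVec_transpose]
    congr 2
    ext a b
    rw [Matrix.transpose_apply, hf.metric, hf.metric, ksG, ksG]
    by_cases hab : a = b
    · subst hab; rfl
    · simp [hab, Ne.symm hab, mul_comm (κ a)]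
  let B : Matrix (Fin 2 ⊕ Fin (n - 2)) (Fin n) ℝ :=
    Matrix.of (Sum.elim ![g *ᵥ l, φ • κ] fun i => g *ᵥ e i)
  let C : Matrix (Fin n) (Fin 2 ⊕ Fin (n - 2)) ℝ :=
    (Matrix.of (Sum.elim ![kv, l] e))ᵀ
  have hBC : B * C = 1 := by
    ext i j
    change (Sum.elim ![g *ᵥ l, φ • κ] (fun i => g *ᵥ e i) i) ⬝ᵥ (Sum.elim ![kv, l] e j) = _
    rcases i with i | i <;> rcases j with j | j
    · fin_cases i <;> fin_cases j
      · simpa [gk] using hf.frame.k_l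
      · simpa [hsymm] using hf.frame.l_l
      · have : (φ • κ) ⬝ᵥ kv = φ * ∑ a, κ a * kv a := by
          rw [smul_dotProduct, smul_eq_mul, dotProduct]
        simpa [kk] using this
      · simpa using hf.frame.k_l
    · fin_cases i
      · simpa [hsymm] using hf.frame.l_e j
      · simpa using hf.frame.k_e j
    · fin_cases j
      · simpa [gk] using hf.frame.k_e i
      · have := hf.frame.l_e i
        rw [← hsymm, dotProduct_comm] at this
        simpa [hsymm, dotProduct_comm] using this
    · simpa [hsymm, Matrix.one_apply] using hf.frame.e_e i j
  have hCB : C * B = 1 := (Matrix.mul_eq_one_comm_of_card_eq _ _ _ (by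
    simp only [Fintype.card_sum, Fintype.card_fin]; have := hf.two_le; omega)).mp hBC
  have := congrFun (congrFun hCB a) b
  rw [Matrix.one_apply, Matrix.mul_apply, Fintype.sum_sum_type, Fin.sum_univ_two] at this
  rw [← this]
  congr 1
  refine Finset.sum_congr rfl fun i _ => ?_
  change _ = e i a * (g *ᵥ e i) b
  rw [hf.metric_mulVec, hf.null_frame]; ring

lemma mul_frame {N : Matrix (Fin n) (Fin n) ℝ} (hN : IsTransverse o κ N) (c b : Fin n) :
    N c b = φ * κ b * ∑ a, N c a * l a + ∑ i, (∑ a, N c a * e i a) * (sgn o b * e i b) := by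
  have e1 : N c b = ∑ a, N c a * (if a = b then 1 else 0) := by simp
  rw [e1]
  simp only [← hf.completeness, mul_add, Finset.sum_add_distrib]
  have e2 : ∑ a, N c a * (φ * (sgn o a * κ a) * (g *ᵥ l) b) = 0 := by
    have : ∀ a, N c a * (φ * (sgn o a * κ a) * (g *ᵥ l) b) = φ * (g *ᵥ l) b * (N c a * κ a) := by
      intro a
      linear_combination φ * κ a * (g *ᵥ l) b * hN.sgn_right c a
    simp only [this, ← Finset.mul_sum, hN.null_right, mul_zero]
  rw [e2, zero_add, Finset.mul_sum]
  congr 1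
  · exact Finset.sum_congr rfl fun a _ => by ring
  · simp only [Finset.mul_sum, Finset.sum_mul]
    rw [Finset.sum_comm]
    exact Finset.sum_congr rfl fun a _ => Finset.sum_congr rfl fun i _ => by ring

lemma mul_projection {N : Matrix (Fin n) (Fin n) ℝ} (hN : IsTransverse o κ N) (c b : Fin n) :
    (N * (Matrix.of e)ᵀ * Matrix.of e) c b = sgn o b * N c b
      - φ * (sgn o b * κ b) * ∑ a, N c a * l a := by
  rw [hf.mul_frame hN c b, Matrix.mul_apply, mul_add]
  have : ∀ i, (N * (Matrix.of e)ᵀ) c i * Matrix.of e i b =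
      sgn o b * ((∑ a, N c a * e i a) * (sgn o b * e i b)) := by
    intro i
    rw [Matrix.mul_apply]
    simp only [Matrix.transpose_apply, Matrix.of_apply]
    linear_combination (-(∑ a, N c a * e i a) * e i b) * sgn_mul_self (A := ℝ) o b
  simp only [this, ← Finset.mul_sum]
  ring

/-- The sum of the e_i ⊗ e_i is the inverse Minkowski metric up to terms containing κ. Transverse
forms annihilate κ and do not see the time direction, so the projection is invisible between them
and matrix products may be computed in the frame. -/
lemma mul_projection_mul {N N' : Matrix (Fin n) (Fin n) ℝ} (hN : IsTransverse o κ N)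
    (hN' : IsTransverse o κ N') : N * (Matrix.of e)ᵀ * Matrix.of e * N' = N * N' := by
  ext c d
  rw [Matrix.mul_apply, Matrix.mul_apply]
  have : ∀ b, (N * (Matrix.of e)ᵀ * Matrix.of e) c b * N' b d = N c b * N' b d
      - φ * (∑ a, N c a * l a) * (κ b * N' b d) := by
    intro b
    rw [hf.mul_projection hN]
    linear_combination (N c b - φ * κ b * ∑ a, N c a * l a) * hN'.sgn_left b d
  simp only [this, Finset.sum_sub_distrib, ← Finset.mul_sum, hN'.null_left, mul_zero, sub_zero]

lemma trace_projection {N : Matrix (Fin n) (Fin n) ℝ} (hN : IsTransverse o κ N) :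
    (Matrix.of e * N * (Matrix.of e)ᵀ).trace = N.trace := by
  rw [Matrix.mul_assoc, Matrix.trace_mul_comm, Matrix.trace, Matrix.trace]
  have : ∀ c, (N * (Matrix.of e)ᵀ * Matrix.of e) c c = N c c
      - φ * ∑ a, κ c * N c a * l a := by
    intro c
    have e1 : κ c * ∑ a, N c a * l a = ∑ a, κ c * N c a * l a := by
      rw [Finset.mul_sum]; exact Finset.sum_congr rfl fun a _ => by ring
    have e2 : sgn o c * ∑ a, N c a * l a = ∑ a, N c a * l a := by
      rw [Finset.mul_sum]
      exact Finset.sum_congr rfl fun a _ => by rw [← mul_assoc, hN.sgn_left]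
    rw [hf.mul_projection hN, hN.sgn_left, ← e1]
    linear_combination (-φ * κ c) * e2
  simp only [Matrix.diag_apply, this, Finset.sum_sub_distrib, ← Finset.mul_sum]
  rw [Finset.sum_comm]
  simp only [← Finset.sum_mul, hN.null_left]
  simp

/-- The frame components determine a transverse form. -/
lemma eq_mul_dual {N : Matrix (Fin n) (Fin n) ℝ} (hN : IsTransverse o κ N) :
    N = N * (Matrix.of e)ᵀ * Matrix.of fun i b => sgn o b * e i b + e i o * κ b := by
  ext c b
  -- The time component of this expansion is zero and expresses the contraction with l through the
  -- frame components, so l can be eliminated.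
  have e0 := hf.mul_frame hN c o
  rw [hN.time_right, hf.time, sgn_self] at e0
  rw [hf.mul_frame hN c b, Matrix.mul_apply]
  simp only [Matrix.mul_apply, Matrix.transpose_apply, Matrix.of_apply, mul_add,
    Finset.sum_add_distrib]
  have e1 : ∑ i, (∑ a, N c a * e i a) * (e i o * κ b) =
      - κ b * ∑ i, (∑ a, N c a * e i a) * (-1 * e i o) := by
    rw [Finset.mul_sum]; exact Finset.sum_congr rfl fun i _ => by ring
  rw [e1]
  linear_combination (-κ b) * e0

/-- By `eq_mul_dual`, applied to N and to its transpose, N factors through its frame components. -/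
lemma rank_le {N : Matrix (Fin n) (Fin n) ℝ} (hN : IsTransverse o κ N) :
    N.rank ≤ (Matrix.of e * N * (Matrix.of e)ᵀ).rank := by
  have e1 := hf.eq_mul_dual hN
  have e2 := congrArg Matrix.transpose (hf.eq_mul_dual hN.transpose)
  set W : Matrix (Fin (n - 2)) (Fin n) ℝ := Matrix.of fun i b => sgn o b * e i b + e i o * κ b
  rw [Matrix.transpose_mul, Matrix.transpose_mul, Matrix.transpose_transpose,
    Matrix.transpose_transpose] at e2
  have : N = Wᵀ * (Matrix.of e * N * (Matrix.of e)ᵀ * W) := by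
    calc N = Wᵀ * (Matrix.of e * N) := e2
      _ = Wᵀ * (Matrix.of e * (N * (Matrix.of e)ᵀ * W)) := by rw [← e1]
      _ = _ := by simp only [Matrix.mul_assoc]
  calc N.rank = (Wᵀ * (Matrix.of e * N * (Matrix.of e)ᵀ * W)).rank := congrArg _ this
    _ ≤ (Matrix.of e * N * (Matrix.of e)ᵀ * W).rank := Matrix.rank_mul_le_right _ _
    _ ≤ _ := Matrix.rank_mul_le_left _ _

end IsKerrSchildFrame

end Frame

/-- A nonvanishing minor would give an invertible 2×2 submatrix. -/
lemma mul_eq_mul_of_rank_lt_two {m : Type*} [Fintype m] {N : Matrix m m ℝ} (hN : N.rank < 2)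
    (a b c d : m) : N a b * N c d = N a d * N c b := by
  by_contra hne
  have hu : IsUnit (N.submatrix ![a, c] ![b, d]) := by
    rw [Matrix.isUnit_iff_isUnit_det, Matrix.det_fin_two]
    simpa [isUnit_iff_ne_zero, sub_eq_zero] using hne
  have := Matrix.rank_of_isUnit _ hu
  have h2 := N.rank_submatrix_le ![a, c] ![b, d]
  rw [this, Fintype.card_fin] at h2
  omega

/-! ### Traces of the shape tensor and their derivatives along κ. -/

section ShapeTraces

variable {n : ℕ} {A : Type*} [CommRing A] [Algebra ℝ A] {D : Fin n → Derivation ℝ A A}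
  {o : Fin n} {κ : Fin n → A} (H : A)

/-- The sum of the squares of the components of the shape tensor. -/
def shapeSq (D : Fin n → Derivation ℝ A A) (o : Fin n) (κ : Fin n → A) : A :=
  ∑ a, ∑ b, shape D o κ a b * shape D o κ a b

lemma dirD_sum {ι : Type*} (s : Finset ι) (F : ι → A) :
    dirD D o κ (∑ i ∈ s, F i) = ∑ i ∈ s, dirD D o κ (F i) := by
  simp only [dirD, map_sum, Finset.mul_sum]
  exact Finset.sum_comm

lemma IsGeodesicNull.dirD_divergence (h : IsGeodesicNull D o κ) :
    dirD D o κ (divergence D o κ) = -∑ a, ∑ c, shape D o κ a c * shape D o κ c a := by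
  rw [← h.trace_shape, dirD_sum, ← Finset.sum_neg_distrib]
  exact Finset.sum_congr rfl fun a _ => h.dirD_shape a a

lemma IsGeodesicNull.dirD_shapeSq (h : IsGeodesicNull D o κ) :
    dirD D o κ (shapeSq D o κ) =
      -(2 * ∑ a, ∑ b, (∑ c, shape D o κ a c * shape D o κ c b) * shape D o κ a b) := by
  simp only [shapeSq, dirD_sum, dirD_mul, h.dirD_shape]
  rw [Finset.mul_sum, ← Finset.sum_neg_distrib]
  refine Finset.sum_congr rfl fun a _ => ?_
  rw [Finset.mul_sum, ← Finset.sum_neg_distrib]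
  refine Finset.sum_congr rfl fun b _ => ?_
  ring

lemma IsGeodesicNull.fluxCoeff_mul_divergence (h : IsGeodesicNull D o κ)
    (hv : ∀ b d, ric D (ksGamma D o H κ) b d = 0) :
    fluxCoeff D o H κ * divergence D o κ = H * shapeSq D o κ := by
  have e : ∑ b, fluxCoeff D o H κ * (shape D o κ b b + shape D o κ b b) =
      ∑ b, 2 * H * ∑ c, shape D o κ b c * shape D o κ b c :=
    Finset.sum_congr rfl fun b _ => h.optical_constraint H hv b b
  rw [← Finset.mul_sum, ← Finset.mul_sum, Finset.sum_add_distrib, h.trace_shape] at e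
  refine sub_eq_zero.mp (two_mul_cancel ?_)
  rw [shapeSq]
  linear_combination e

/-- The coefficient φ = `fluxCoeff` is eliminated by multiplying the optical constraint by tr N and
inserting its own trace, φ tr N = H tr(N Nᵀ). -/
lemma IsGeodesicNull.mul_shapeSq (h : IsGeodesicNull D o κ)
    (hv : ∀ b d, ric D (ksGamma D o H κ) b d = 0) (b d : Fin n) :
    H * (shapeSq D o κ * (shape D o κ b d + shape D o κ d b)
      - 2 * divergence D o κ * ∑ c, shape D o κ b c * shape D o κ d c) = 0 := by
  linear_combination divergence D o κ * h.optical_constraint H hv b d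
    - (shape D o κ b d + shape D o κ d b) * h.fluxCoeff_mul_divergence H hv

end ShapeTraces

/-! ### Trace identities following from N + Nᵀ = 2r N Nᵀ. -/

section MatrixConstraint

variable {m : Type*} [Fintype m] [DecidableEq m] {N : Matrix m m ℝ} {r : ℝ}

lemma trace_of_constraint (h : N + Nᵀ = (2 * r) • (N * Nᵀ)) :
    N.trace = r * (N * Nᵀ).trace := by
  have := congrArg Matrix.trace h
  rw [Matrix.trace_add, Matrix.trace_transpose, Matrix.trace_smul, smul_eq_mul] at this
  linarith

lemma trace_sq_of_constraint (h : N + Nᵀ = (2 * r) • (N * Nᵀ)) :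
    (N * N).trace = 2 * r * (N * N * Nᵀ).trace - (N * Nᵀ).trace := by
  have := congrArg (fun M => (N * M).trace) h
  simp only [Matrix.mul_add, Matrix.trace_add, Matrix.mul_smul, Matrix.trace_smul, smul_eq_mul,
    ← Matrix.mul_assoc] at this
  linarith

lemma trace_cube_of_constraint (hr : r ≠ 0) (h : N + Nᵀ = (2 * r) • (N * Nᵀ)) :
    (N * N * Nᵀ).trace = r * (N * Nᵀ * (N * Nᵀ)).trace := by
  have hn := transpose_mul_of_constraint hr h
  have e := congrArg (fun M => (M * (N * Nᵀ)).trace) h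
  have e1 : (Nᵀ * (N * Nᵀ)).trace = (N * N * Nᵀ).trace := by
    rw [← Matrix.trace_transpose, Matrix.transpose_mul, Matrix.transpose_mul,
      Matrix.transpose_transpose, Matrix.trace_mul_cycle]
  simp only [Matrix.add_mul, Matrix.trace_add, Matrix.smul_mul, Matrix.trace_smul, smul_eq_mul,
    e1, ← Matrix.mul_assoc N N] at e
  linarith

/-- The left side is the numerator in the derivative of tr N / tr(N Nᵀ) when N' = -N²; the identity
makes this derivative equal to 1. -/
lemma trace_identity_of_constraint (h : N + Nᵀ = (2 * r) • (N * Nᵀ)) :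
    2 * N.trace * (N * N * Nᵀ).trace - (N * N).trace * (N * Nᵀ).trace = (N * Nᵀ).trace ^ 2 := by
  rw [trace_of_constraint h, trace_sq_of_constraint h]
  ring

lemma trace_mul_transpose_eq (N : Matrix m m ℝ) : (N * Nᵀ).trace = ∑ a, ∑ b, N a b * N a b := rfl

lemma eq_zero_of_trace_mul_transpose (h : (N * Nᵀ).trace = 0) : N = 0 := by
  rw [trace_mul_transpose_eq] at h
  ext a b
  have h1 := (Finset.sum_eq_zero_iff_of_nonneg fun a _ =>
    Finset.sum_nonneg fun b _ => mul_self_nonneg (N a b)).mp h a (Finset.mem_univ a)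
  have h2 := (Finset.sum_eq_zero_iff_of_nonneg fun b _ => mul_self_nonneg (N a b)).mp h1 b
    (Finset.mem_univ b)
  simpa using h2

/-- Vanishing minors give tr N² = (tr N)² and tr((N Nᵀ)²) = (tr N Nᵀ)². Inserted into the trace
consequences of the constraint, these leave a linear equation for tr(N Nᵀ). -/
lemma trace_of_minors (h : N + Nᵀ = (2 * r) • (N * Nᵀ)) (hr : r ≠ 0)
    (hm : ∀ a b c d, N a b * N c d = N a d * N c b) :
    (N * N).trace = N.trace ^ 2 ∧ (N * Nᵀ).trace = N.trace ^ 2 := by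
  have e1 : (N * N).trace = N.trace ^ 2 := by
    simp only [Matrix.trace, Matrix.diag_apply, Matrix.mul_apply, sq, Finset.sum_mul_sum]
    exact Finset.sum_congr rfl fun a _ => Finset.sum_congr rfl fun b _ => hm a b b a
  have e2 : (N * Nᵀ * (N * Nᵀ)).trace = (N * Nᵀ).trace ^ 2 := by
    have hs : ∀ a b, (N * Nᵀ) a b * (N * Nᵀ) b a = (N * Nᵀ) a a * (N * Nᵀ) b b := by
      intro a b
      simp only [Matrix.mul_apply, Matrix.transpose_apply, Finset.sum_mul_sum]
      refine Finset.sum_congr rfl fun c _ => Finset.sum_congr rfl fun d _ => ?_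
      linear_combination (-(N a c * N b d)) * hm a c b d
    simp only [Matrix.trace, Matrix.diag_apply, sq, Finset.sum_mul_sum]
    refine Finset.sum_congr rfl fun a _ => ?_
    rw [Matrix.mul_apply]
    exact Finset.sum_congr rfl fun b _ => hs a b
  have h1 := trace_of_constraint h
  have h2 := trace_sq_of_constraint h
  have h3 := trace_cube_of_constraint hr h
  refine ⟨e1, ?_⟩
  rw [e2] at h3
  rw [h3, e1] at h2
  rw [h1] at h2 ⊢
  linarith

/-- The squared norm of N - Nᵀ is 2 tr(N Nᵀ) - 2 tr N², which vanishes by `trace_of_minors`. -/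
lemma symm_of_minors (h : N + Nᵀ = (2 * r) • (N * Nᵀ)) (hr : r ≠ 0)
    (hm : ∀ a b c d, N a b * N c d = N a d * N c b) (a b : m) : N a b = N b a := by
  obtain ⟨h1, h2⟩ := trace_of_minors h hr hm
  have h3 : ((N - Nᵀ) * (N - Nᵀ)ᵀ).trace = 0 := by
    have e1 : (Nᵀ * N).trace = (N * Nᵀ).trace := Matrix.trace_mul_comm _ _
    have e2 : (Nᵀ * Nᵀ).trace = (N * N).trace := by
      rw [← Matrix.transpose_mul, Matrix.trace_transpose]
    rw [Matrix.transpose_sub, Matrix.transpose_transpose, Matrix.sub_mul, Matrix.mul_sub,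
      Matrix.mul_sub, Matrix.trace_sub, Matrix.trace_sub, Matrix.trace_sub, e1, e2, h1, h2]
    ring
  have := congrFun (congrFun (eq_zero_of_trace_mul_transpose h3) a) b
  simpa [sub_eq_zero] using this

end MatrixConstraint

/-! ### The optical constraint and the affine parameter on `U`. -/

section Bridge

variable {n : ℕ} {U : Set (Vec n)} {H : Vec n → ℝ} {k : Vec n → Vec n}

namespace IsKerrSchild

variable (h : IsKerrSchild U H k)
include h

lemma isTransverse (hv : IsVacuum U (ksMetric H k)) (x : U) :
    IsTransverse h.time (fun a => evalAt x (h.kap a)) (h.shapeAt x) := by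
  have hg := h.isGeodesicNull hv
  refine ⟨fun b => ?_, fun a => ?_, fun b => ?_, fun a => ?_⟩
  · exact (congrArg (evalAt x) (hg.shape_time_left b)).trans (map_zero _)
  · exact (congrArg (evalAt x) (hg.shape_time_right a)).trans (map_zero _)
  · have := congrArg (evalAt x) (hg.null_mul_shape b)
    rw [map_sum, map_zero] at this
    simp only [map_mul] at this
    exact this
  · have := congrArg (evalAt x) (hg.shape_mul_null a)
    rw [map_sum, map_zero] at this
    simp only [map_mul] at this
    exact this

lemma isKerrSchildFrame {K : Vec n} {x : U} {φ : ℝ} {l : Vec n} {e : Fin (n - 2) → Vec n}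
    (hK : ∀ a, K a = φ * evalAt x (h.kap a)) (hφ : φ ≠ 0)
    (hf : IsNullFrame (ksMetric H k x) K l e) :
    IsKerrSchildFrame h.time (fun a => evalAt x (h.kap a)) (evalAt x h.prof) φ
      (ksMetric H k x) l e where
  two_le := by have := h.four_le; omega
  time := by rw [h.isNormalizedNull.time, map_one]
  null := by
    have := congrArg (evalAt x) h.isNormalizedNull.null
    rw [map_sum, map_zero] at this
    simp only [map_mul, evalAt_sgn] at this
    exact this
  metric a b := by
    rw [h.metric_eq, ksG, ksG, map_sub, map_mul, map_mul, map_mul, map_ofNat]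
    congr 1
    split_ifs <;> simp
  factor := hφ
  frame := by
    have : K = φ • fun a => evalAt x (h.kap a) := funext hK
    rwa [this] at hf

lemma shapeAt_trace (hv : IsVacuum U (ksMetric H k)) (x : U) :
    (h.shapeAt x).trace = evalAt x (divergence (pd h.isOpen) h.time h.kap) := by
  rw [← (h.isGeodesicNull hv).trace_shape, map_sum]
  rfl

lemma shapeAt_sq (x : U) : (h.shapeAt x * (h.shapeAt x)ᵀ).trace =
    evalAt x (shapeSq (pd h.isOpen) h.time h.kap) := by
  rw [shapeSq, map_sum, trace_mul_transpose_eq]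
  refine Finset.sum_congr rfl fun a _ => ?_
  rw [map_sum]
  refine Finset.sum_congr rfl fun b _ => ?_
  rw [map_mul]; rfl

lemma comp_eq (x : U) (a : Fin n) : k x a = evalAt x h.lapse * evalAt x (h.kap a) := by
  rw [← map_mul, h.lapse_mul_kap]

lemma opticalMatrix_self (hv : IsVacuum U (ksMetric H k)) {x : U} {l : Vec n}
    {e : Fin (n - 2) → Vec n} (hf : IsNullFrame (ksMetric H k x) (k x) l e) :
    opticalMatrix (ksMetric H k) k x e =
      evalAt x h.lapse • (Matrix.of e * h.shapeAt x * (Matrix.of e)ᵀ) :=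
  h.opticalMatrix_eq hv (fun x a => (h.lapse_mul_kap a x).symm) x e
    (h.isKerrSchildFrame (h.comp_eq x) (h.lapse_ne_zero x) hf).null_frame

lemma trace_ne_zero (hv : IsVacuum U (ksMetric H k)) (hexp : IsExpanding U (ksMetric H k) k)
    (x : U) : (h.shapeAt x).trace ≠ 0 := by
  intro h0
  obtain ⟨l, e, hf, hθ⟩ := hexp x x.2
  apply hθ
  rw [expansion, h.opticalMatrix_self hv hf, Matrix.trace_smul,
    (h.isKerrSchildFrame (h.comp_eq x) (h.lapse_ne_zero x) hf).trace_projection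
      (h.isTransverse hv x), h0]
  simp

lemma shapeSq_ne_zero (hv : IsVacuum U (ksMetric H k)) (hexp : IsExpanding U (ksMetric H k) k)
    (x : U) : evalAt x (shapeSq (pd h.isOpen) h.time h.kap) ≠ 0 := by
  rw [← h.shapeAt_sq]
  intro h0
  apply h.trace_ne_zero hv hexp x
  rw [eq_zero_of_trace_mul_transpose h0, Matrix.trace_zero]

lemma shapeSq_apply_ne_zero (hv : IsVacuum U (ksMetric H k))
    (hexp : IsExpanding U (ksMetric H k) k) (x : U) :
    shapeSq (pd h.isOpen) h.time h.kap x ≠ 0 := h.shapeSq_ne_zero hv hexp x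

/-- The affine parameter along `κ`. -/
def radius (hv : IsVacuum U (ksMetric H k)) (hexp : IsExpanding U (ksMetric H k) k) :
    smoothAlgebra U :=
  -- Taking the trace of N + Nᵀ = 2r N Nᵀ forces this value of r.
  divergence (pd h.isOpen) h.time h.kap *
    invSmooth (shapeSq (pd h.isOpen) h.time h.kap) (h.shapeSq_apply_ne_zero hv hexp)

variable (hv : IsVacuum U (ksMetric H k)) (hexp : IsExpanding U (ksMetric H k) k)

lemma radius_mul : h.radius hv hexp * shapeSq (pd h.isOpen) h.time h.kap =
    divergence (pd h.isOpen) h.time h.kap := by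
  rw [radius, mul_assoc, mul_comm (invSmooth _ _), mul_invSmooth, mul_one]

lemma radius_ne_zero (x : U) : evalAt x (h.radius hv hexp) ≠ 0 := by
  have := congrArg (evalAt x) (h.radius_mul hv hexp)
  rw [map_mul, ← h.shapeAt_trace hv] at this
  exact left_ne_zero_of_mul (this ▸ h.trace_ne_zero hv hexp x)

lemma shapeAt_constraint (x : U) : h.shapeAt x + (h.shapeAt x)ᵀ =
    (2 * evalAt x (h.radius hv hexp)) • (h.shapeAt x * (h.shapeAt x)ᵀ) := by
  have hg := h.isGeodesicNull hv
  ext b d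
  have e := hg.mul_shapeSq h.prof (h.ric_eq_zero hv) b d
  rw [prof, mul_assoc] at e
  have e1 := congrArg (evalAt x) (eq_zero_of_mul_eq_zero_of_dense h.smooth_H h.dense e)
  have hl : evalAt x h.lapse ≠ 0 := h.lapse_ne_zero x
  have e2 : evalAt x (2 : smoothAlgebra U) = 2 := map_ofNat _ 2
  rw [← h.radius_mul hv hexp, map_zero, map_mul, map_mul] at e1
  have e3 := (mul_eq_zero.mp e1).resolve_left (mul_ne_zero hl hl)
  rw [map_sub, map_mul, map_mul, map_mul, map_mul, e2, map_add, map_sum] at e3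
  have hT := h.shapeSq_ne_zero hv hexp x
  have e4 : ∑ c, evalAt x (shape (pd h.isOpen) h.time h.kap b c *
      shape (pd h.isOpen) h.time h.kap d c) = (h.shapeAt x * (h.shapeAt x)ᵀ) b d := by
    rw [Matrix.mul_apply]
    exact Finset.sum_congr rfl fun c _ => map_mul _ _ _
  rw [e4] at e3
  change h.shapeAt x b d + h.shapeAt x d b = 2 * _ * _
  change _ * (h.shapeAt x b d + h.shapeAt x d b) - _ = 0 at e3
  refine mul_left_cancel₀ hT ?_
  linear_combination e3

lemma dirD_divergence_at (hv : IsVacuum U (ksMetric H k)) (x : U) :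
    evalAt x (dirD (pd h.isOpen) h.time h.kap (divergence (pd h.isOpen) h.time h.kap)) =
      -(h.shapeAt x * h.shapeAt x).trace := by
  rw [(h.isGeodesicNull hv).dirD_divergence, map_neg, map_sum]
  congr 1
  refine Finset.sum_congr rfl fun a _ => ?_
  rw [map_sum]
  exact Finset.sum_congr rfl fun c _ => map_mul _ _ _

lemma dirD_shapeSq_at (hv : IsVacuum U (ksMetric H k)) (x : U) :
    evalAt x (dirD (pd h.isOpen) h.time h.kap (shapeSq (pd h.isOpen) h.time h.kap)) =
      -(2 * (h.shapeAt x * h.shapeAt x * (h.shapeAt x)ᵀ).trace) := by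
  rw [(h.isGeodesicNull hv).dirD_shapeSq, map_neg, map_mul, map_ofNat, map_sum]
  congr 2
  refine Finset.sum_congr rfl fun a _ => ?_
  rw [map_sum]
  refine Finset.sum_congr rfl fun b _ => ?_
  rw [map_mul, map_sum]
  congr 1

/-- Differentiating r tr(N Nᵀ) = tr N along κ by means of the Sachs equation leaves exactly the
quotient evaluated in `trace_identity_of_constraint`. -/
lemma dirD_radius : dirD (pd h.isOpen) h.time h.kap (h.radius hv hexp) = 1 := by
  refine smoothAlgebra_ext fun x => ?_
  have e := congrArg (fun f => evalAt x (dirD (pd h.isOpen) h.time h.kap f)) (h.radius_mul hv hexp)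
  rw [h.dirD_divergence_at hv, dirD_mul, map_add, map_mul, map_mul, h.dirD_shapeSq_at hv] at e
  have hc := h.shapeAt_constraint hv hexp x
  have hT := h.shapeSq_ne_zero hv hexp x
  have i1 := trace_identity_of_constraint hc
  have i2 := trace_of_constraint hc
  rw [h.shapeAt_sq] at i1 i2
  rw [i2] at i1
  change evalAt x (dirD (pd h.isOpen) h.time h.kap (h.radius hv hexp)) = 1
  generalize evalAt x (dirD (pd h.isOpen) h.time h.kap (h.radius hv hexp)) = ρ at *
  generalize evalAt x (shapeSq (pd h.isOpen) h.time h.kap) = T at *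
  refine mul_right_cancel₀ (mul_ne_zero hT hT) ?_
  linear_combination T * e + i1

/-- The transport equation of the profile. It follows from φ tr N = H tr(N Nᵀ) with φ = κ(H) + H tr
N and tr N = r tr(N Nᵀ). -/
lemma radius_mul_dirD_prof (x : U) :
    evalAt x (h.radius hv hexp) * evalAt x (dirD (pd h.isOpen) h.time h.kap h.prof) =
      evalAt x h.prof * (1 - evalAt x (h.radius hv hexp) * (h.shapeAt x).trace) := by
  have e := congrArg (evalAt x)
    ((h.isGeodesicNull hv).fluxCoeff_mul_divergence h.prof (h.ric_eq_zero hv))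
  rw [fluxCoeff, map_mul, map_add, map_mul, map_mul, ← h.shapeAt_trace hv] at e
  have i := congrArg (evalAt x) (h.radius_mul hv hexp)
  rw [map_mul, ← h.shapeAt_trace hv] at i
  have hT := h.shapeSq_ne_zero hv hexp x
  refine mul_right_cancel₀ hT ?_
  linear_combination e + (evalAt x (dirD (pd h.isOpen) h.time h.kap h.prof)
    + evalAt x h.prof * (h.shapeAt x).trace) * i

end IsKerrSchild

end Bridge

/-- Passing to frame components preserves the constraint since `hE` removes the projection between
the factors; scaling N by f replaces r by r / f. -/
lemma smul_constraint {m d : Type*} [Fintype m] [Fintype d] {N : Matrix m m ℝ}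
    {E : Matrix d m ℝ} {f r : ℝ} (hf : f ≠ 0) (h : N + Nᵀ = (2 * r) • (N * Nᵀ))
    (hE : N * Eᵀ * E * Nᵀ = N * Nᵀ) :
    f • (E * N * Eᵀ) + (f • (E * N * Eᵀ))ᵀ =
      (2 * (r / f)) • (f • (E * N * Eᵀ) * (f • (E * N * Eᵀ))ᵀ) := by
  have e1 : (E * N * Eᵀ) * (E * N * Eᵀ)ᵀ = E * (N * Nᵀ) * Eᵀ := by
    rw [Matrix.transpose_mul, Matrix.transpose_mul, Matrix.transpose_transpose, ← hE]
    simp only [Matrix.mul_assoc]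
  have e2 : (E * N * Eᵀ)ᵀ = E * Nᵀ * Eᵀ := by
    rw [Matrix.transpose_mul, Matrix.transpose_mul, Matrix.transpose_transpose, Matrix.mul_assoc]
  rw [Matrix.transpose_smul, Matrix.smul_mul, Matrix.mul_smul, e1, e2, ← smul_add, ← Matrix.add_mul,
    ← Matrix.mul_add, h, Matrix.mul_smul, Matrix.smul_mul, smul_smul, smul_smul, smul_smul]
  congr 1
  field_simp

/-! ### Normality, flatness at rank one, and the affine parametrization. -/

section Bridge

variable {n : ℕ} {U : Set (Vec n)} {H : Vec n → ℝ} {k : Vec n → Vec n}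

namespace IsKerrSchild

variable (h : IsKerrSchild U H k) (hv : IsVacuum U (ksMetric H k))
  (hexp : IsExpanding U (ksMetric H k) k)
include h hv

include hexp in
lemma frame_constraint {K : Vec n} {x : U} {φ : ℝ} {l : Vec n} {e : Fin (n - 2) → Vec n}
    (hK : ∀ a, K a = φ * evalAt x (h.kap a)) (hφ : φ ≠ 0)
    (hf : IsNullFrame (ksMetric H k x) K l e) :
    φ • (Matrix.of e * h.shapeAt x * (Matrix.of e)ᵀ)
        + (φ • (Matrix.of e * h.shapeAt x * (Matrix.of e)ᵀ))ᵀ =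
      (2 * (evalAt x (h.radius hv hexp) / φ)) •
        (φ • (Matrix.of e * h.shapeAt x * (Matrix.of e)ᵀ) *
          (φ • (Matrix.of e * h.shapeAt x * (Matrix.of e)ᵀ))ᵀ) :=
  smul_constraint hφ (h.shapeAt_constraint hv hexp x)
    ((h.isKerrSchildFrame hK hφ hf).mul_projection_mul (h.isTransverse hv x)
      (h.isTransverse hv x).transpose)

include hexp in
/-- The optical matrix is normal. -/
lemma optical_normal {x : U} {l : Vec n} {e : Fin (n - 2) → Vec n}
    (hf : IsNullFrame (ksMetric H k x) (k x) l e) :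
    opticalMatrix (ksMetric H k) k x e * (opticalMatrix (ksMetric H k) k x e)ᵀ =
      (opticalMatrix (ksMetric H k) k x e)ᵀ * opticalMatrix (ksMetric H k) k x e := by
  rw [h.opticalMatrix_self hv hf]
  exact (transpose_mul_of_constraint
    (div_ne_zero (h.radius_ne_zero hv hexp x) (h.lapse_ne_zero x))
    (h.frame_constraint hv hexp (h.comp_eq x) (h.lapse_ne_zero x) hf)).symm

lemma rank_shapeAt_le {x : U} {l : Vec n} {e : Fin (n - 2) → Vec n}
    (hf : IsNullFrame (ksMetric H k x) (k x) l e) :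
    (h.shapeAt x).rank ≤ (opticalMatrix (ksMetric H k) k x e).rank := by
  have hl : evalAt x h.lapse ≠ 0 := h.lapse_ne_zero x
  rw [h.opticalMatrix_self hv hf, Matrix.rank_smul_of_mem_nonZeroDivisors _ (mem_nonZeroDivisors_of_ne_zero hl)]
  exact (h.isKerrSchildFrame (h.comp_eq x) hl hf).rank_le (h.isTransverse hv x)

include hexp in
lemma isRankOne (hr : ∀ x ∈ U, ∃ l e, IsNullFrame (ksMetric H k x) (k x) l e ∧
      (opticalMatrix (ksMetric H k) k x e).rank < 2) :
    IsRankOne (pd h.isOpen) h.time h.prof h.kap := by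
  have hm : ∀ (x : U) a b c d, h.shapeAt x a b * h.shapeAt x c d =
      h.shapeAt x a d * h.shapeAt x c b := by
    intro x
    obtain ⟨l, e, hf, hlt⟩ := hr x x.2
    exact mul_eq_mul_of_rank_lt_two ((h.rank_shapeAt_le hv hf).trans_lt hlt)
  refine { h.isGeodesicNull hv with symm := ?_, minors := ?_, isUnit := ?_, dirD_zero := ?_ }
  · exact fun a b => smoothAlgebra_ext fun x =>
      symm_of_minors (h.shapeAt_constraint hv hexp x) (h.radius_ne_zero hv hexp x) (hm x) a b
  · intro a b c d
    refine smoothAlgebra_ext fun x => ?_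
    exact hm x a b c d
  · have hd : ∀ x : U, divergence (pd h.isOpen) h.time h.kap x ≠ 0 := by
      intro x
      have := h.trace_ne_zero hv hexp x
      rwa [h.shapeAt_trace hv] at this
    exact IsUnit.of_mul_eq_one _ (mul_invSmooth _ hd)
  · refine smoothAlgebra_ext fun x => ?_
    have hρ := h.radius_ne_zero hv hexp x
    have hc := h.shapeAt_constraint hv hexp x
    have e1 := trace_of_constraint hc
    rw [(trace_of_minors hc hρ (hm x)).2] at e1
    have e2 := h.radius_mul_dirD_prof hv hexp x
    -- At rank one tr(N Nᵀ) = (tr N)², so r tr N = 1, and the transport equation says that the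
    -- profile is constant along κ.
    have e3 : evalAt x (h.radius hv hexp) * (h.shapeAt x).trace = 1 :=
      mul_left_cancel₀ (h.trace_ne_zero hv hexp x) (by linear_combination -e1)
    rw [e3, sub_self, mul_zero] at e2
    exact (mul_eq_zero.mp e2).resolve_left hρ

include hexp in
/-- A vacuum Kerr-Schild metric with an expanding optical matrix of rank one is flat. -/
lemma riemann_eq_zero (hr : ∀ x ∈ U, ∃ l e, IsNullFrame (ksMetric H k x) (k x) l e ∧
      (opticalMatrix (ksMetric H k) k x e).rank < 2) (a b c d : Fin n) (x : U) :
    riemann (ksMetric H k) a b c d x = 0 := by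
  have hR := h.isRankOne hv hexp hr
  obtain ⟨u, z, hs⟩ := hR.exists_splitting (h.ric_eq_zero hv)
  have e : riem (pd h.isOpen) h.Gam a b c d = 0 := by
    rw [hs.riem_eq hR, hs.linRiem_eq_zero hR (h.ric_eq_zero hv), mul_zero]
  exact (riemann_eq h.isOpen h.metric_eq h.metric_inv_eq a b c d x).trans
    ((congrArg (evalAt x) e).trans (map_zero _))

/-- The choice c = 1 / k_0 gives c k = κ, which is already affinely parametrized. -/
lemma isAffineRescaling : ∃ c : Vec n → ℝ, IsAffineRescaling U (ksMetric H k) k c := by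
  refine ⟨fun x => (k x h.time)⁻¹, ?_, fun x hx => inv_ne_zero (h.time_ne_zero ⟨x, hx⟩), ?_⟩
  · exact (contDiffOn_pi.mp h.smooth_k h.time).inv fun x hx => h.time_ne_zero ⟨x, hx⟩
  · refine (h.isAffineGeodetic_iff hv (f := 1) (fun x a => ?_) fun x => one_ne_zero).mpr ?_
    · rw [one_mul, h.kap_apply, Pi.smul_apply, smul_eq_mul, div_eq_inv_mul]
    · simp [dirD]

end IsKerrSchild

end Bridge

/-! ### Uniqueness for the matrix Riccati equation. -/

section Ode

lemma eq_of_hasDerivAt_zero {E : Type*} [NormedAddCommGroup E] [NormedSpace ℝ E] {I : Set ℝ}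
    (hI : IsOpen I) (hI' : I.OrdConnected) {F : ℝ → E} (hF : ∀ s ∈ I, HasDerivAt F 0 s)
    {s t : ℝ} (hs : s ∈ I) (ht : t ∈ I) : F s = F t :=
  hI.is_const_of_deriv_eq_zero hI'.isPreconnected
    (fun s hs => (hF s hs).differentiableAt.differentiableWithinAt)
    (fun s hs => (hF s hs).deriv) hs ht

variable {d : Type*} [Fintype d]

/-- Grönwall: F² - G² = F(F - G) + (F - G)G, and F and G are bounded by A and B on the compact
interval. Each entry is a sum over `d` of terms at most (A + B)‖F - G‖ in the sup norm of the
entries. -/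
lemma eq_of_riccati_of_le {I : Set ℝ} (hI : I.OrdConnected) {F G : ℝ → Matrix d d ℝ}
    (hF : ∀ s ∈ I, ∀ i j, HasDerivAt (fun t => F t i j) (-((F s * F s) i j)) s)
    (hG : ∀ s ∈ I, ∀ i j, HasDerivAt (fun t => G t i j) (-((G s * G s) i j)) s)
    {s t : ℝ} (hs : s ∈ I) (ht : t ∈ I) (hst : s ≤ t) (h0 : F s = G s) : F t = G t := by
  have hsub : Set.Icc s t ⊆ I := hI.out hs ht
  let F' : ℝ → d → d → ℝ := F
  let G' : ℝ → d → d → ℝ := G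
  have dF : ∀ u ∈ I, HasDerivAt F' (fun i j => -((F u * F u) i j)) u := fun u hu =>
    hasDerivAt_pi.mpr fun i => hasDerivAt_pi.mpr fun j => hF u hu i j
  have dG : ∀ u ∈ I, HasDerivAt G' (fun i j => -((G u * G u) i j)) u := fun u hu =>
    hasDerivAt_pi.mpr fun i => hasDerivAt_pi.mpr fun j => hG u hu i j
  have cF : ContinuousOn F' (Set.Icc s t) := fun u hu =>
    (dF u (hsub hu)).continuousAt.continuousWithinAt
  have cG : ContinuousOn G' (Set.Icc s t) := fun u hu =>
    (dG u (hsub hu)).continuousAt.continuousWithinAt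
  obtain ⟨A, hA⟩ := isCompact_Icc.exists_bound_of_continuousOn cF
  obtain ⟨B, hB⟩ := isCompact_Icc.exists_bound_of_continuousOn cG
  have hent : ∀ (X : d → d → ℝ) i j, |X i j| ≤ ‖X‖ := fun X i j =>
    (norm_le_pi_norm (X i) j).trans (norm_le_pi_norm X i)
  have key := eq_zero_of_abs_deriv_le_mul_abs_self_of_eq_zero_right
    (f := fun u => F' u - G' u) (f' := fun u => fun i j => -((F u * F u) i j) - -((G u * G u) i j))
    (K := Fintype.card d * (A + B)) (cF.sub cG)
    (fun u hu => ((dF u (hsub (Set.Ico_subset_Icc_self hu))).sub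
      (dG u (hsub (Set.Ico_subset_Icc_self hu)))).hasDerivWithinAt)
    (sub_eq_zero.mpr h0) (fun u hu => ?_) t ⟨hst, le_rfl⟩
  · exact sub_eq_zero.mp key
  have hA' := hA u (Set.Ico_subset_Icc_self hu)
  have hB' := hB u (Set.Ico_subset_Icc_self hu)
  have hA0 : 0 ≤ A := (norm_nonneg _).trans hA'
  have hB0 : 0 ≤ B := (norm_nonneg _).trans hB'
  have h1 : 0 ≤ Fintype.card d * (A + B) * ‖F' u - G' u‖ := by positivity
  refine (pi_norm_le_iff_of_nonneg h1).mpr fun i => (pi_norm_le_iff_of_nonneg h1).mpr fun j => ?_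
  have e : -((F u * F u) i j) - -((G u * G u) i j) =
      -∑ l, (F' u i l * (F' u - G' u) l j + (F' u - G' u) i l * G' u l j) := by
    rw [Matrix.mul_apply, Matrix.mul_apply, ← Finset.sum_neg_distrib, ← Finset.sum_neg_distrib,
      ← Finset.sum_sub_distrib, ← Finset.sum_neg_distrib]
    refine Finset.sum_congr rfl fun l _ => ?_
    change -(F u i l * F u l j) - -(G u i l * G u l j) =
      -(F u i l * (F u l j - G u l j) + (F u i l - G u i l) * G u l j)
    ring
  rw [e, norm_neg]
  calc _ ≤ ∑ _l : d, (A + B) * ‖F' u - G' u‖ := by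
        refine norm_sum_le_of_le _ fun l _ => ?_
        rw [add_mul]
        refine (norm_add_le _ _).trans (add_le_add ?_ ?_)
        · rw [norm_mul]
          exact mul_le_mul ((hent _ _ _).trans hA') (hent _ _ _) (norm_nonneg _) hA0
        · rw [norm_mul, mul_comm]
          exact mul_le_mul ((hent _ _ _).trans hB') (hent _ _ _) (norm_nonneg _) hB0
    _ = _ := by rw [Finset.sum_const, Finset.card_univ, nsmul_eq_mul, mul_assoc]

/-- Uniqueness of the solutions of the matrix Riccati equation `F' = - F ^ 2`. -/
lemma eq_of_riccati {I : Set ℝ} (hI : I.OrdConnected) {F G : ℝ → Matrix d d ℝ}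
    (hF : ∀ s ∈ I, ∀ i j, HasDerivAt (fun t => F t i j) (-((F s * F s) i j)) s)
    (hG : ∀ s ∈ I, ∀ i j, HasDerivAt (fun t => G t i j) (-((G s * G s) i j)) s)
    {s t : ℝ} (hs : s ∈ I) (ht : t ∈ I) (h0 : F s = G s) : F t = G t := by
  rcases le_total s t with hst | hst
  · exact eq_of_riccati_of_le hI hF hG hs ht hst h0
  -- If F solves F' = -F², so does t ↦ -F(-t); this reverses the direction of time.
  have hrefl : ∀ {F : ℝ → Matrix d d ℝ},
      (∀ s ∈ I, ∀ i j, HasDerivAt (fun t => F t i j) (-((F s * F s) i j)) s) →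
      ∀ s ∈ Neg.neg ⁻¹' I, ∀ i j, HasDerivAt (fun t => (fun t => -F (-t)) t i j)
        (-(((fun t => -F (-t)) s * (fun t => -F (-t)) s) i j)) s := by
    intro F hF s hs i j
    refine ((hF (-s) hs i j).comp s (hasDerivAt_neg s)).neg.congr_deriv ?_
    simp
  have := eq_of_riccati_of_le (I := Neg.neg ⁻¹' I) (s := -s) (t := -t)
    (Set.OrdConnected.preimage_anti hI fun a b hab => neg_le_neg hab)
    (hrefl hF) (hrefl hG) (by simpa using hs) (by simpa using ht) (neg_le_neg hst) (by simp [h0])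
  simpa using this

lemma hasDerivAt_prod_of_ne_zero {ι : Type*} (S : Finset ι) {u : ι → ℝ → ℝ} {u' : ι → ℝ} {s : ℝ}
    (hu : ∀ i ∈ S, HasDerivAt (u i) (u' i) s) (h0 : ∀ i ∈ S, u i s ≠ 0) :
    HasDerivAt (fun t => ∏ i ∈ S, u i t) ((∏ i ∈ S, u i s) * ∑ i ∈ S, u' i / u i s) s := by
  classical
  induction S using Finset.induction_on with
  | empty => simpa using hasDerivAt_const s (1 : ℝ)
  | insert i S hi ih =>
    have h1 := hu i (Finset.mem_insert_self i S)
    have h2 := ih (fun j hj => hu j (Finset.mem_insert_of_mem hj))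
      (fun j hj => h0 j (Finset.mem_insert_of_mem hj))
    have h3 := h0 i (Finset.mem_insert_self i S)
    simp only [Finset.prod_insert hi, Finset.sum_insert hi]
    refine (h1.mul h2).congr_deriv ?_
    field_simp

end Ode

/-- Integration of the transport equation of the profile function. -/
lemma profile_const {I : Set ℝ} (hI : IsOpen I) (hI' : I.OrdConnected) {p q : ℕ} (a : Fin p → ℝ)
    {P r : ℝ → ℝ} {P' : ℝ → ℝ} (hr : ∀ s ∈ I, HasDerivAt r 1 s) (hr0 : ∀ s ∈ I, r s ≠ 0)
    (hP : ∀ s ∈ I, HasDerivAt P (P' s) s)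
    (hP' : ∀ s ∈ I, r s * P' s =
      P s * (1 - r s * (∑ μ, 2 * (r s / (r s ^ 2 + a μ ^ 2)) + q * (1 / r s)))) {s₀ s : ℝ}
    (hs₀ : s₀ ∈ I) (hs : s ∈ I) :
    P s = (P s₀ * (r s₀ ^ ((q : ℤ) - 1) * ∏ μ, (r s₀ ^ 2 + a μ ^ 2))) *
      r s ^ (-((q : ℤ) - 1)) * ∏ μ, 1 / (r s ^ 2 + a μ ^ 2) := by
  have hpos : ∀ s ∈ I, ∀ μ, r s ^ 2 + a μ ^ 2 ≠ 0 := fun s hs μ => by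
    have := hr0 s hs; positivity
  -- First integral: the logarithmic derivative of P is (1 - q)/r - ∑ 2r/(r² + a²). The exponent q -
  -- 1 is an integer, since it is -1 when q = 0.
  have hc : ∀ t ∈ I, HasDerivAt
      (fun t => P t * (r t ^ ((q : ℤ) - 1) * ∏ μ, (r t ^ 2 + a μ ^ 2))) 0 t := by
    intro t ht
    have h1 := hasDerivAt_prod_of_ne_zero Finset.univ
      (u := fun μ t => r t ^ 2 + a μ ^ 2) (u' := fun _ => 2 * r t) (s := t)
      (fun μ _ => by
        have := ((hr t ht).pow 2).add_const (a μ ^ 2)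
        simpa using this) fun μ _ => hpos t ht μ
    have h2 := (hasDerivAt_zpow ((q : ℤ) - 1) (r t) (Or.inl (hr0 t ht))).comp t (hr t ht)
    have h3 := (hP t ht).mul (h2.mul h1)
    refine h3.congr_deriv ?_
    have e := hP' t ht
    have hrt := hr0 t ht
    have hz : r t ^ ((q : ℤ) - 1 - 1) * r t = r t ^ ((q : ℤ) - 1) := by
      rw [← zpow_add_one₀ hrt, sub_add_cancel]
    have hsum : ∑ μ, 2 * (r t / (r t ^ 2 + a μ ^ 2)) = ∑ μ, 2 * r t / (r t ^ 2 + a μ ^ 2) :=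
      Finset.sum_congr rfl fun μ _ => by ring
    rw [hsum] at e
    have e' : r t * P' t = P t * (1 - r t * ∑ μ, 2 * r t / (r t ^ 2 + a μ ^ 2) - q) := by
      rw [e]; field_simp; ring
    simp only [Function.comp_apply, Pi.mul_apply]
    push_cast
    generalize (∏ μ, (r t ^ 2 + a μ ^ 2)) = B at *
    generalize (∑ μ, 2 * r t / (r t ^ 2 + a μ ^ 2)) = Λ at *
    generalize r t ^ ((q : ℤ) - 1) = Z at *
    refine mul_left_cancel₀ hrt ?_
    rw [mul_zero]
    linear_combination Z * B * e' + P t * ((q : ℝ) - 1) * B * hz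
  have e := eq_of_hasDerivAt_zero hI hI' hc hs₀ hs
  rw [e]
  have h1 := hr0 s hs
  have h2 : (∏ μ, (r s ^ 2 + a μ ^ 2)) * ∏ μ, 1 / (r s ^ 2 + a μ ^ 2) = 1 := by
    rw [← Finset.prod_mul_distrib]
    exact Finset.prod_eq_one fun μ _ => mul_one_div_cancel (hpos s hs μ)
  have h3 : r s ^ ((q : ℤ) - 1) * r s ^ (-((q : ℤ) - 1)) = 1 := by
    rw [← zpow_add₀ h1, add_neg_cancel, zpow_zero]
  linear_combination (-P s) * (r s ^ ((q : ℤ) - 1) * r s ^ (-((q : ℤ) - 1))) * h2 - P s * h3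

/-! ### Changes of null frames. -/

section FrameChange

variable {n : ℕ} {g : Matrix (Fin n) (Fin n) ℝ} {K l : Vec n} {e : Fin (n - 2) → Vec n}

lemma IsNullFrame.rescale (hf : IsNullFrame g K l e) {c : ℝ} (hc : c ≠ 0) :
    IsNullFrame g (c • K) (c⁻¹ • l) e where
  k_k := by simp [Matrix.mulVec_smul, hf.k_k]
  k_l := by simp [hf.k_l, hc]
  l_l := by simp [Matrix.mulVec_smul, hf.l_l]
  k_e i := by simp [hf.k_e]
  l_e i := by simp [hf.l_e]
  e_e := hf.e_e

lemma IsNullFrame.rotate (hf : IsNullFrame g K l e)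
    {Q : Matrix (Fin (n - 2)) (Fin (n - 2)) ℝ} (hQ : Q * Qᵀ = 1) :
    IsNullFrame g K l (Q * Matrix.of e) := by
  have hrow : ∀ i, (Q * Matrix.of e) i = ∑ j, Q i j • e j := by
    intro i; ext a
    simp [Matrix.mul_apply]
  refine ⟨hf.k_k, hf.k_l, hf.l_l, fun i => ?_, fun i => ?_, fun i j => ?_⟩
  · simp only [hrow, dotProduct_sum, dotProduct_smul, hf.k_e, smul_zero, Finset.sum_const_zero]
  · simp only [hrow, Matrix.mulVec_sum, Matrix.mulVec_smul, dotProduct_sum, dotProduct_smul,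
      hf.l_e, smul_zero, Finset.sum_const_zero]
  · have := congrFun (congrFun hQ i) j
    rw [Matrix.mul_apply, Matrix.one_apply] at this
    simp only [hrow, Matrix.mulVec_sum, Matrix.mulVec_smul, dotProduct_sum, dotProduct_smul,
      sum_dotProduct, smul_dotProduct, hf.e_e, smul_eq_mul, mul_ite, mul_one, mul_zero,
      Finset.sum_ite_eq', Finset.mem_univ, if_true]
    rw [← this]
    exact Finset.sum_congr rfl fun b _ => mul_comm _ _

/-- Transport of a null frame to another value of the profile function. -/
lemma IsKerrSchildFrame.transport {o : Fin n} {κ : Fin n → ℝ} {h h' φ : ℝ}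
    {g' : Matrix (Fin n) (Fin n) ℝ} (hf : IsKerrSchildFrame o κ h φ g l e)
    (hg' : ∀ a b, g' a b = ksG o h' κ a b) (hk : (φ • κ) ⬝ᵥ (g'⁻¹ *ᵥ (φ • κ)) = 0) :
    IsNullFrame g' (φ • κ) (l + ((h' - h) / φ) • fun a => sgn o a * κ a) e := by
  set v : Vec n := fun a => sgn o a * κ a with hvdef
  -- Replacing h by h' changes g(l, l) by -2(h' - h)/φ², and adding t times κ with raised index
  -- changes it by 2t/φ; this t balances the two.
  set t := (h' - h) / φ with ht
  have hφ := hf.factor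
  have hkl : ∑ a, κ a * l a = 1 / φ := by
    have := hf.frame.k_l
    rw [smul_dotProduct, smul_eq_mul, dotProduct] at this
    exact eq_one_div_of_mul_eq_one_right this
  have hkv : ∑ a, κ a * v a = 0 := by
    rw [← hf.null]
    exact Finset.sum_congr rfl fun a _ => by simp only [hvdef]; ring
  have hkl' : ∑ a, κ a * (l + t • v) a = 1 / φ := by
    rw [← hkl, ← add_zero (∑ a, κ a * l a), ← mul_zero t, ← hkv, Finset.mul_sum,
      ← Finset.sum_add_distrib]
    exact Finset.sum_congr rfl fun a _ => by simp only [Pi.add_apply, Pi.smul_apply, smul_eq_mul]; ring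
  have hge : ∀ i a, (g' *ᵥ e i) a = (g *ᵥ e i) a := by
    intro i a
    rw [mulVec_of_metric hg', mulVec_of_metric hf.metric, hf.null_frame, mul_zero, mul_zero]
  have hge' : ∀ i, g' *ᵥ e i = g *ᵥ e i := fun i => funext (hge i)
  refine ⟨hk, ?_, ?_, hf.frame.k_e, fun i => ?_, fun i j => ?_⟩
  · rw [smul_dotProduct, smul_eq_mul, dotProduct, hkl', mul_one_div_cancel hφ]
  · have h1 := hf.frame.l_l
    have h2 : ∀ (H : ℝ) (w : Vec n), ∑ a, w a * (sgn o a * w a - 2 * H * κ a * ∑ b, κ b * w b) =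
        ∑ a, sgn o a * (w a * w a) - 2 * H * (∑ b, κ b * w b) * ∑ b, κ b * w b := by
      intro H w
      rw [Finset.mul_sum _ _ (2 * H * (∑ b, κ b * w b)), ← Finset.sum_sub_distrib]
      exact Finset.sum_congr rfl fun a _ => by ring
    have h3 : ∑ a, sgn o a * ((l + t • v) a * (l + t • v) a) = ∑ a, sgn o a * (l a * l a)
        + 2 * t * ∑ a, κ a * l a + t * t * ∑ a, κ a * v a := by
      simp only [Finset.mul_sum, ← Finset.sum_add_distrib]
      refine Finset.sum_congr rfl fun a _ => ?_
      simp only [Pi.add_apply, Pi.smul_apply, smul_eq_mul, hvdef]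
      linear_combination (2 * t * κ a * l a + t * t * κ a * κ a * sgn o a) *
        sgn_mul_self (A := ℝ) o a
    rw [dotProduct] at h1 ⊢
    simp only [mulVec_of_metric hg', mulVec_of_metric hf.metric] at h1 ⊢
    rw [h2, hkl] at h1
    rw [h2, hkl', h3, hkl, hkv, ht]
    linear_combination h1
  · rw [hge', add_dotProduct, hf.frame.l_e, smul_dotProduct, zero_add]
    have : v ⬝ᵥ (g *ᵥ e i) = ∑ a, κ a * e i a := by
      refine Finset.sum_congr rfl fun a _ => ?_
      rw [mulVec_of_metric hf.metric, hf.null_frame]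
      simp only [hvdef]
      linear_combination κ a * e i a * sgn_mul_self (A := ℝ) o a
    rw [this, hf.null_frame, smul_zero]
  · rw [hge', hf.frame.e_e]

end FrameChange

lemma hasDerivAt_mul_mul {ι m : Type*} [Fintype m] {X : ℝ → Matrix m m ℝ} {X' : Matrix m m ℝ}
    {s : ℝ} (hX : ∀ a b, HasDerivAt (fun t => X t a b) (X' a b) s) (A : Matrix ι m ℝ)
    (B : Matrix m ι ℝ) (i j : ι) :
    HasDerivAt (fun t => (A * X t * B) i j) ((A * X' * B) i j) s := by
  simp only [Matrix.mul_apply]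
  exact HasDerivAt.fun_sum fun b _ =>
    (HasDerivAt.fun_sum fun a _ => (hX a b).const_mul (A i a)).mul_const (B b j)

/-! ### Differentiation along integral curves. -/

section Curve

variable {n : ℕ} {U : Set (Vec n)} {H : Vec n → ℝ} {k : Vec n → Vec n}

namespace IsKerrSchild

variable (h : IsKerrSchild U H k)
include h

section Curve

variable {K : Vec n → Vec n} {f : smoothAlgebra U}
  (hK : ∀ (x : U) a, K x a = evalAt x (f * h.kap a))
include hK

lemma sum_raise_mul (g : smoothAlgebra U) (x : U) :
    ∑ a, raise (ksMetric H k) K x a * pd h.isOpen a g x =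
      evalAt x (f * dirD (pd h.isOpen) h.time h.kap g) := by
  rw [dirD, Finset.mul_sum, map_sum]
  refine Finset.sum_congr rfl fun a _ => ?_
  rw [h.raise_eq hK]
  change _ * evalAt x (pd h.isOpen a g) = _
  rw [← map_mul, mul_assoc]

lemma fderiv_raise (g : smoothAlgebra U) (x : U) :
    fderiv ℝ (extendZero g) x (raise (ksMetric H k) K x) =
      evalAt x (f * dirD (pd h.isOpen) h.time h.kap g) := by
  rw [fderiv_extendZero_apply h.isOpen, h.sum_raise_mul hK]

lemma null_raise (x : U) : K x ⬝ᵥ ((ksMetric H k x)⁻¹ *ᵥ K x) = 0 := by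
  have e : ∀ a, K x a * raise (ksMetric H k) K x a =
      evalAt x (f * f * (sgn h.time a * h.kap a * h.kap a)) := by
    intro a
    rw [h.raise_eq hK, hK, ← map_mul]
    congr 1; ring
  change ∑ a, K x a * raise (ksMetric H k) K x a = 0
  rw [Finset.sum_congr rfl fun a _ => e a, ← map_sum, ← Finset.mul_sum, h.isNormalizedNull.null,
    mul_zero, map_zero]

variable {I : Set ℝ} {γ : ℝ → Vec n} (hγ : IsIntegralCurveIn U (ksMetric H k) K I γ)
include hγ

lemma hasDerivAt_curve (g : smoothAlgebra U) {s : ℝ} (hs : s ∈ I) :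
    HasDerivAt (fun t => extendZero g (γ t))
      (evalAt ⟨γ s, hγ.mem s hs⟩ (f * dirD (pd h.isOpen) h.time h.kap g)) s :=
  (hasDerivAt_comp_curve h.isOpen g (hγ.mem s hs) (hγ.hasDerivAt s hs)).congr_deriv
    (h.sum_raise_mul hK g ⟨γ s, hγ.mem s hs⟩)

lemma curve_const {g : smoothAlgebra U} (hg : dirD (pd h.isOpen) h.time h.kap g = 0) {s t : ℝ}
    (hs : s ∈ I) (ht : t ∈ I) :
    evalAt ⟨γ s, hγ.mem s hs⟩ g = evalAt ⟨γ t, hγ.mem t ht⟩ g := by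
  have := eq_of_hasDerivAt_zero hγ.isOpen hγ.ordConnected (F := fun t => extendZero g (γ t))
    (fun u hu => (h.hasDerivAt_curve hK hγ g hu).congr_deriv (by rw [hg, mul_zero, map_zero])) hs ht
  rwa [extendZero_apply _ (hγ.mem s hs), extendZero_apply _ (hγ.mem t ht)] at this

/-- The integral curves are straight lines. -/
lemma contDiffOn_curve (hv : IsVacuum U (ksMetric H k))
    (hf : dirD (pd h.isOpen) h.time h.kap f = 0) : ContDiffOn ℝ ∞ γ I := by
  rcases I.eq_empty_or_nonempty with rfl | ⟨s₀, hs₀⟩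
  · exact contDiffOn_empty
  -- The tangent is fκ with its index raised by η alone, because κ is null; f and the components of
  -- κ are constant along the curve.
  have hconst : ∀ s (hs : s ∈ I), raise (ksMetric H k) K (γ s) = raise (ksMetric H k) K (γ s₀) := by
    intro s hs
    ext a
    have e1 := h.raise_eq hK ⟨γ s, hγ.mem s hs⟩ a
    have e2 := h.raise_eq hK ⟨γ s₀, hγ.mem s₀ hs₀⟩ a
    refine e1.trans (Eq.trans ?_ e2.symm)
    rw [map_mul, map_mul, map_mul, map_mul, h.curve_const hK hγ hf hs hs₀,
      h.curve_const hK hγ ((h.isGeodesicNull hv).geodesic a) hs hs₀, evalAt_sgn, evalAt_sgn]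
  set w := raise (ksMetric H k) K (γ s₀)
  have hd : ∀ s ∈ I, HasDerivAt (fun t => γ t - t • w) 0 s := by
    intro s hs
    have h1 := hγ.hasDerivAt s hs
    rw [hconst s hs] at h1
    refine (h1.sub ((hasDerivAt_id s).smul_const w)).congr_deriv ?_
    rw [one_smul, sub_self]
  have he : ∀ s ∈ I, γ s = (γ s₀ - s₀ • w) + s • w := by
    intro s hs
    have := eq_of_hasDerivAt_zero hγ.isOpen hγ.ordConnected hd hs hs₀
    rw [← this, sub_add_cancel]
  exact (ContDiff.contDiffOn (by fun_prop)).congr he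

end Curve

end IsKerrSchild

end Curve

/-! ### The canonical form and the profile along an integral curve. -/

section CanonicalForm

variable {n : ℕ} {U : Set (Vec n)} {H : Vec n → ℝ} {k : Vec n → Vec n}

namespace IsKerrSchild

variable (h : IsKerrSchild U H k)
include h

section Rescaling

variable {c : Vec n → ℝ} (hc : IsAffineRescaling U (ksMetric H k) k c)

/-- The factor between the affinely parametrized covector field `c k` and `κ`. -/
def factor : smoothAlgebra U := restrictSmooth c hc.smooth * h.lapse

lemma factor_apply (x : U) : evalAt x (h.factor hc) = c x * k x h.time := rfl

lemma factor_ne_zero (x : U) : h.factor hc x ≠ 0 :=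
  mul_ne_zero (hc.ne_zero x x.2) (h.time_ne_zero x)

lemma rescaled_eq (x : U) (a : Fin n) : (c x • k x) a = evalAt x (h.factor hc * h.kap a) := by
  rw [map_mul, h.factor_apply, Pi.smul_apply, smul_eq_mul, ← h.lapse_mul_kap a x, map_mul,
    h.lapse_apply, mul_assoc]

lemma dirD_factor (hv : IsVacuum U (ksMetric H k)) :
    dirD (pd h.isOpen) h.time h.kap (h.factor hc) = 0 :=
  (h.isAffineGeodetic_iff hv (h.rescaled_eq hc) (h.factor_ne_zero hc)).mp hc.affine

variable (hv : IsVacuum U (ksMetric H k)) (hexp : IsExpanding U (ksMetric H k) k)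

/-- The affine parameter along `c k`. -/
def affineRadius : smoothAlgebra U :=
  -- The radius has derivative 1 along κ and the factor f is constant along κ, so r / f has
  -- derivative 1 along fκ.
  h.radius hv hexp * invSmooth (h.factor hc) (h.factor_ne_zero hc)

lemma factor_mul_affineRadius :
    h.factor hc * h.affineRadius hc hv hexp = h.radius hv hexp := by
  rw [affineRadius, mul_left_comm, mul_invSmooth, mul_one]

lemma factor_mul_affineRadius_at (x : U) :
    evalAt x (h.factor hc) * evalAt x (h.affineRadius hc hv hexp) = evalAt x (h.radius hv hexp) := by
  rw [← map_mul, h.factor_mul_affineRadius]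

lemma affineRadius_ne_zero (x : U) : evalAt x (h.affineRadius hc hv hexp) ≠ 0 := by
  have := h.radius_ne_zero hv hexp x
  rw [← h.factor_mul_affineRadius_at hc] at this
  exact right_ne_zero_of_mul this

lemma dirD_affineRadius :
    h.factor hc * dirD (pd h.isOpen) h.time h.kap (h.affineRadius hc hv hexp) = 1 := by
  have := h.dirD_radius hv hexp
  rwa [← h.factor_mul_affineRadius hc, dirD_mul, h.dirD_factor hc hv, zero_mul, zero_add] at this

variable {I : Set ℝ} {γ : ℝ → Vec n}
  (hγ : IsIntegralCurveIn U (ksMetric H k) (fun y => c y • k y) I γ)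

include hv in
lemma opticalMatrix_rescaled {x : U} {l : Vec n} {e : Fin (n - 2) → Vec n}
    (hf : IsNullFrame (ksMetric H k x) (c x • k x) l e) :
    opticalMatrix (ksMetric H k) (fun y => c y • k y) x e =
      evalAt x (h.factor hc) • (Matrix.of e * h.shapeAt x * (Matrix.of e)ᵀ) :=
  h.opticalMatrix_eq hv (h.rescaled_eq hc) x e
    (h.isKerrSchildFrame (fun a => (h.rescaled_eq hc x a).trans (map_mul _ _ _))
      (h.factor_ne_zero hc x) hf).null_frame

/-- A canonical null frame at a point. -/
lemma exists_canonical_frame (x : U) : ∃ (p q z : ℕ) (a : Fin p → ℝ) (l : Vec n)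
    (e : Fin (n - 2) → Vec n), n - 2 = p * 2 + (q + z) ∧
      IsNullFrame (ksMetric H k x) (c x • k x) l e ∧
      evalAt x (h.factor hc) • (Matrix.of e * h.shapeAt x * (Matrix.of e)ᵀ) =
        canonicalMatrix (n - 2) p (2 * p + q) a (evalAt x (h.affineRadius hc hv hexp)) := by
  obtain ⟨l, e, hf, -⟩ := hexp x x.2
  have hf' := hf.rescale (hc.ne_zero x x.2)
  have hφ : evalAt x (h.factor hc) ≠ 0 := h.factor_ne_zero hc x
  have hcon := h.frame_constraint hv hexp
    (fun a => (h.rescaled_eq hc x a).trans (map_mul _ _ _)) hφ hf'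
  have hr : evalAt x (h.radius hv hexp) / evalAt x (h.factor hc) =
      evalAt x (h.affineRadius hc hv hexp) := by
    rw [← h.factor_mul_affineRadius_at hc, mul_div_cancel_left₀ _ hφ]
  rw [hr] at hcon
  obtain ⟨p, q, z, a, Q, hd, hQ, hcan⟩ :=
    exists_canonicalMatrix (h.affineRadius_ne_zero hc hv hexp x) hcon
  refine ⟨p, q, z, a, _, Q * Matrix.of e, hd, hf'.rotate hQ, ?_⟩
  rw [← hcan]
  generalize h.shapeAt x = N
  change _ • (Q * Matrix.of e * N * (Q * Matrix.of e)ᵀ) = _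
  rw [Matrix.transpose_mul, Matrix.mul_smul, Matrix.smul_mul]
  simp only [Matrix.mul_assoc]

include hc hv hγ

/-- Along an integral curve, a null frame is obtained from one at a single point by a change of
`l` alone. -/
lemma frame_along {s₀ : ℝ} (hs₀ : s₀ ∈ I) {l : Vec n} {e : Fin (n - 2) → Vec n}
    (hf : IsNullFrame (ksMetric H k (γ s₀)) (c (γ s₀) • k (γ s₀)) l e) :
    ∃ l' : ℝ → Vec n, ContDiffOn ℝ ∞ l' I ∧
      ∀ s ∈ I, IsNullFrame (ksMetric H k (γ s)) (c (γ s) • k (γ s)) (l' s) e := by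
  have hD := h.dirD_factor hc hv
  set x₀ : U := ⟨γ s₀, hγ.mem s₀ hs₀⟩ with hx₀
  set φ := evalAt x₀ (h.factor hc) with hφ
  have hk0 : c (γ s₀) • k (γ s₀) = φ • fun a => evalAt x₀ (h.kap a) :=
    funext fun a => (h.rescaled_eq hc x₀ a).trans (map_mul _ _ _)
  have hks : IsKerrSchildFrame h.time (fun a => evalAt x₀ (h.kap a)) (evalAt x₀ h.prof) φ
      (ksMetric H k (γ s₀)) l e :=
    h.isKerrSchildFrame (fun a => congrFun hk0 a) (h.factor_ne_zero hc x₀) hf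
  -- The e_i stay fixed: κ is constant along the curve, and on vectors orthogonal to κ the metric
  -- does not depend on the profile. Only l has to follow the change of the profile.
  refine ⟨fun s => l + ((extendZero h.prof (γ s) - evalAt x₀ h.prof) / φ) •
    fun a => sgn h.time a * evalAt x₀ (h.kap a), ?_, fun s hs => ?_⟩
  · have h1 : ContDiffOn ℝ ∞ (fun s => extendZero h.prof (γ s)) I :=
      ContDiffOn.comp h.prof.2 (h.contDiffOn_curve (h.rescaled_eq hc) hγ hv hD) hγ.mem
    exact contDiffOn_const.add (((h1.sub contDiffOn_const).div_const φ).smul contDiffOn_const)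
  · set x : U := ⟨γ s, hγ.mem s hs⟩
    have hκ : ∀ a, evalAt x (h.kap a) = evalAt x₀ (h.kap a) := fun a =>
      h.curve_const (h.rescaled_eq hc) hγ ((h.isGeodesicNull hv).geodesic a) hs hs₀
    have hφs : evalAt x (h.factor hc) = φ := h.curve_const (h.rescaled_eq hc) hγ hD hs hs₀
    have hk : c (γ s) • k (γ s) = φ • fun a => evalAt x₀ (h.kap a) := funext fun a => by
      refine (h.rescaled_eq hc x a).trans ((map_mul _ _ _).trans ?_)
      rw [hφs, hκ]; rfl
    have hnull := h.null_raise (K := fun y => c y • k y) (h.rescaled_eq hc) x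
    change (c (γ s) • k (γ s)) ⬝ᵥ ((ksMetric H k (γ s))⁻¹ *ᵥ (c (γ s) • k (γ s))) = 0 at hnull
    rw [hk] at hnull ⊢
    have hm : ∀ a b, ksMetric H k (γ s) a b =
        ksG h.time (evalAt x h.prof) (fun a => evalAt x₀ (h.kap a)) a b := by
      intro a b
      rw [← funext hκ]
      refine (h.metric_eq x a b).trans ?_
      rw [ksG, ksG, map_sub, map_mul, map_mul, map_mul, map_ofNat]
      congr 1
      split_ifs <;> simp
    have ht := hks.transport hm hnull
    have hp : evalAt x h.prof = extendZero h.prof (γ s) :=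
      (extendZero_apply (h.prof : U → ℝ) (hγ.mem s hs)).symm
    rwa [hp] at ht

/-- The canonical form persists along the integral curve. -/
lemma canonical_along {s₀ : ℝ} (hs₀ : s₀ ∈ I) {p q z : ℕ} {a : Fin p → ℝ} {l : ℝ → Vec n}
    {e : Fin (n - 2) → Vec n} (hd : n - 2 = p * 2 + (q + z))
    (hf : ∀ s ∈ I, IsNullFrame (ksMetric H k (γ s)) (c (γ s) • k (γ s)) (l s) e)
    (hcan : evalAt ⟨γ s₀, hγ.mem s₀ hs₀⟩ (h.factor hc) •
        (Matrix.of e * h.shapeAt ⟨γ s₀, hγ.mem s₀ hs₀⟩ * (Matrix.of e)ᵀ) =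
      canonicalMatrix (n - 2) p (2 * p + q) a
        (evalAt ⟨γ s₀, hγ.mem s₀ hs₀⟩ (h.affineRadius hc hv hexp))) {s : ℝ} (hs : s ∈ I) :
    evalAt ⟨γ s, hγ.mem s hs⟩ (h.factor hc) •
        (Matrix.of e * h.shapeAt ⟨γ s, hγ.mem s hs⟩ * (Matrix.of e)ᵀ) =
      canonicalMatrix (n - 2) p (2 * p + q) a
        (evalAt ⟨γ s, hγ.mem s hs⟩ (h.affineRadius hc hv hexp)) := by
  have hD := h.dirD_factor hc hv
  set φ := evalAt ⟨γ s₀, hγ.mem s₀ hs₀⟩ (h.factor hc) with hφ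
  have hφs : ∀ s (hs : s ∈ I), evalAt ⟨γ s, hγ.mem s hs⟩ (h.factor hc) = φ := fun s hs =>
    h.curve_const (h.rescaled_eq hc) hγ hD hs hs₀
  let X : ℝ → Matrix (Fin n) (Fin n) ℝ := fun t =>
    Matrix.of fun a b => extendZero (shape (pd h.isOpen) h.time h.kap a b : smoothAlgebra U) (γ t)
  have hX : ∀ s (hs : s ∈ I), X s = h.shapeAt ⟨γ s, hγ.mem s hs⟩ := fun s hs =>
    Matrix.ext fun a b => extendZero_apply _ (hγ.mem s hs)
  -- Since φ and the e_i are constant along the curve, the Sachs equation for the shape tensor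
  -- becomes F' = -F² for the optical matrix in this frame.
  let F : ℝ → Matrix (Fin (n - 2)) (Fin (n - 2)) ℝ := fun t =>
    (φ • Matrix.of e) * X t * (Matrix.of e)ᵀ
  have hF : ∀ s (hs : s ∈ I), F s =
      φ • (Matrix.of e * h.shapeAt ⟨γ s, hγ.mem s hs⟩ * (Matrix.of e)ᵀ) := by
    intro s hs
    simp only [F, hX s hs, Matrix.smul_mul]
  have dX : ∀ s (hs : s ∈ I) a b, HasDerivAt (fun t => X t a b)
      ((-φ • (h.shapeAt ⟨γ s, hγ.mem s hs⟩ * h.shapeAt ⟨γ s, hγ.mem s hs⟩)) a b) s := by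
    intro s hs a b
    refine (h.hasDerivAt_curve (h.rescaled_eq hc) hγ
      (shape (pd h.isOpen) h.time h.kap a b) hs).congr_deriv ?_
    rw [map_mul, hφs s hs, (h.isGeodesicNull hv).dirD_shape, map_neg, map_sum, Matrix.smul_apply,
      Matrix.mul_apply, smul_eq_mul, neg_mul, mul_neg]
    congr 2
  have dF : ∀ s ∈ I, ∀ i j, HasDerivAt (fun t => F t i j) (-((F s * F s) i j)) s := by
    intro s hs i j
    refine (hasDerivAt_mul_mul (dX s hs) (φ • Matrix.of e) (Matrix.of e)ᵀ i j).congr_deriv ?_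
    have hks := h.isKerrSchildFrame (x := ⟨γ s, hγ.mem s hs⟩)
      (fun a => (h.rescaled_eq hc _ a).trans (map_mul _ _ _)) (h.factor_ne_zero hc _) (hf s hs)
    have hp := hks.mul_projection_mul (h.isTransverse hv ⟨γ s, hγ.mem s hs⟩)
      (h.isTransverse hv ⟨γ s, hγ.mem s hs⟩)
    rw [hF s hs]
    generalize h.shapeAt ⟨γ s, hγ.mem s hs⟩ = N at *
    have : φ • (Matrix.of e * N * (Matrix.of e)ᵀ) * φ • (Matrix.of e * N * (Matrix.of e)ᵀ) =
        (φ * φ) • (Matrix.of e * (N * N) * (Matrix.of e)ᵀ) := by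
      rw [Matrix.smul_mul, Matrix.mul_smul, smul_smul, ← hp]
      simp only [Matrix.mul_assoc]
    rw [this, Matrix.mul_smul, Matrix.smul_mul, Matrix.smul_mul, Matrix.smul_mul, smul_smul,
      Matrix.smul_apply, Matrix.smul_apply, smul_eq_mul, smul_eq_mul]
    ring
  have hρ0 : ∀ s (hs : s ∈ I), extendZero (h.affineRadius hc hv hexp) (γ s) ≠ 0 := by
    intro s hs
    rw [extendZero_apply _ (hγ.mem s hs)]
    exact h.affineRadius_ne_zero hc hv hexp _
  have dG : ∀ s ∈ I, ∀ i j, HasDerivAt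
      (fun t => (fun t => canonicalMatrix (n - 2) p (2 * p + q) a
        (extendZero (h.affineRadius hc hv hexp) (γ t))) t i j)
      (-((canonicalMatrix (n - 2) p (2 * p + q) a (extendZero (h.affineRadius hc hv hexp) (γ s)) *
        canonicalMatrix (n - 2) p (2 * p + q) a
          (extendZero (h.affineRadius hc hv hexp) (γ s))) i j)) s := by
    intro s hs i j
    have h1 := h.hasDerivAt_curve (h.rescaled_eq hc) hγ (h.affineRadius hc hv hexp) hs
    rw [h.dirD_affineRadius, map_one] at h1
    have h2 : ∀ {r : ℝ}, r ≠ 0 → HasDerivAt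
        (fun r => canonicalMatrix (n - 2) p (2 * p + q) a r i j)
        (-((canonicalMatrix (n - 2) p (2 * p + q) a r *
          canonicalMatrix (n - 2) p (2 * p + q) a r) i j)) r := by
      intro r hr
      revert i j
      rw [hd]
      exact fun i j => hasDerivAt_canonicalMatrix a hr i j
    exact ((h2 (hρ0 s hs)).comp s h1).congr_deriv (mul_one _)
  have key := eq_of_riccati hγ.ordConnected dF dG hs₀ hs (by
    rw [hF s₀ hs₀, hcan, extendZero_apply _ (hγ.mem s₀ hs₀)]; rfl)
  rw [hF s hs, extendZero_apply _ (hγ.mem s hs)] at key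
  rw [hφs s hs]
  exact key

/-- The profile function along the integral curve. -/
lemma profile_along {s₀ : ℝ} (hs₀ : s₀ ∈ I) {p q z : ℕ} {a : Fin p → ℝ} {l : ℝ → Vec n}
    {e : Fin (n - 2) → Vec n} (hd : n - 2 = p * 2 + (q + z))
    (hf : ∀ s ∈ I, IsNullFrame (ksMetric H k (γ s)) (c (γ s) • k (γ s)) (l s) e)
    (hcan : ∀ s (hs : s ∈ I), evalAt ⟨γ s, hγ.mem s hs⟩ (h.factor hc) •
        (Matrix.of e * h.shapeAt ⟨γ s, hγ.mem s hs⟩ * (Matrix.of e)ᵀ) =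
      canonicalMatrix (n - 2) p (2 * p + q) a
        (evalAt ⟨γ s, hγ.mem s hs⟩ (h.affineRadius hc hv hexp))) :
    ∃ H₀ : ℝ, ∀ s ∈ I, H (γ s) / c (γ s) ^ 2 =
      H₀ * extendZero (h.affineRadius hc hv hexp) (γ s) ^ (-((q : ℤ) - 1)) *
        ∏ μ, 1 / (extendZero (h.affineRadius hc hv hexp) (γ s) ^ 2 + a μ ^ 2) := by
  have hD := h.dirD_factor hc hv
  set φ := evalAt ⟨γ s₀, hγ.mem s₀ hs₀⟩ (h.factor hc) with hφ
  have hφs : ∀ s (hs : s ∈ I), evalAt ⟨γ s, hγ.mem s hs⟩ (h.factor hc) = φ := fun s hs =>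
    h.curve_const (h.rescaled_eq hc) hγ hD hs hs₀
  have hρ : ∀ s (hs : s ∈ I), extendZero (h.affineRadius hc hv hexp) (γ s) =
      evalAt ⟨γ s, hγ.mem s hs⟩ (h.affineRadius hc hv hexp) := fun s hs =>
    extendZero_apply _ (hγ.mem s hs)
  have hP' : ∀ s ∈ I, extendZero (h.affineRadius hc hv hexp) (γ s) *
      (φ * extendZero (dirD (pd h.isOpen) h.time h.kap h.prof : smoothAlgebra U) (γ s)) =
      extendZero h.prof (γ s) * (1 - extendZero (h.affineRadius hc hv hexp) (γ s) *
        (∑ μ, 2 * (extendZero (h.affineRadius hc hv hexp) (γ s) /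
          (extendZero (h.affineRadius hc hv hexp) (γ s) ^ 2 + a μ ^ 2)) +
          q * (1 / extendZero (h.affineRadius hc hv hexp) (γ s)))) := by
    intro s hs
    have h1 := congrArg Matrix.trace (hcan s hs)
    have hks := h.isKerrSchildFrame (x := ⟨γ s, hγ.mem s hs⟩)
      (fun a => (h.rescaled_eq hc _ a).trans (map_mul _ _ _)) (h.factor_ne_zero hc _) (hf s hs)
    have htr : ∀ r, (canonicalMatrix (n - 2) p (2 * p + q) a r).trace =
        ∑ μ, 2 * (r / (r ^ 2 + a μ ^ 2)) + q * (1 / r) := by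
      rw [hd]; exact fun r => trace_canonicalMatrix a r
    rw [Matrix.trace_smul, hks.trace_projection (h.isTransverse hv _), htr, hφs s hs,
      smul_eq_mul] at h1
    have h2 := h.radius_mul_dirD_prof hv hexp ⟨γ s, hγ.mem s hs⟩
    rw [← h.factor_mul_affineRadius_at hc, hφs s hs] at h2
    simp only [hρ s hs]
    rw [← h1, extendZero_apply _ (hγ.mem s hs), extendZero_apply _ (hγ.mem s hs)]
    change _ * (φ * evalAt ⟨γ s, hγ.mem s hs⟩ (dirD (pd h.isOpen) h.time h.kap h.prof)) =
      evalAt ⟨γ s, hγ.mem s hs⟩ h.prof * _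
    linear_combination h2
  have key := fun s (hs : s ∈ I) => profile_const hγ.isOpen hγ.ordConnected (q := q) a
    (P := fun t => extendZero h.prof (γ t))
    (r := fun t => extendZero (h.affineRadius hc hv hexp) (γ t))
    (P' := fun t => φ * extendZero (dirD (pd h.isOpen) h.time h.kap h.prof : smoothAlgebra U) (γ t))
    (fun s hs => (h.hasDerivAt_curve (h.rescaled_eq hc) hγ _ hs).congr_deriv
      (by rw [h.dirD_affineRadius, map_one]))
    (fun s hs => by simp only [hρ s hs]; exact h.affineRadius_ne_zero hc hv hexp _)
    (fun s hs => (h.hasDerivAt_curve (h.rescaled_eq hc) hγ _ hs).congr_deriv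
      (by rw [map_mul, hφs s hs, extendZero_apply _ (hγ.mem s hs)]; rfl))
    hP' hs₀ hs
  refine ⟨(extendZero h.prof (γ s₀) *
    (extendZero (h.affineRadius hc hv hexp) (γ s₀) ^ ((q : ℤ) - 1) *
      ∏ μ, (extendZero (h.affineRadius hc hv hexp) (γ s₀) ^ 2 + a μ ^ 2))) / φ ^ 2,
    fun s hs => ?_⟩
  -- The profile is H k_0² and the factor is c k_0, so their quotient does not depend on k_0.
  have e1 : H (γ s) / c (γ s) ^ 2 = extendZero h.prof (γ s) / φ ^ 2 := by
    rw [extendZero_apply _ (hγ.mem s hs), ← hφs s hs, h.factor_apply]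
    change _ = H (γ s) * (k (γ s) h.time * k (γ s) h.time) / (c (γ s) * k (γ s) h.time) ^ 2
    have h1 := hc.ne_zero _ (hγ.mem s hs)
    have h2 : k (γ s) h.time ≠ 0 := h.time_ne_zero ⟨γ s, hγ.mem s hs⟩
    field_simp
  rw [e1, key s hs]
  ring

end Rescaling

end IsKerrSchild

end CanonicalForm

end KerrSchild

end

open KerrSchild in
theorem mainTheorem5 {n : ℕ} (U : Set (Vec n)) (H : Vec n → ℝ) (k : Vec n → Vec n)
    (hKS : IsKerrSchild U H k) (hvac : IsVacuum U (ksMetric H k))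
    (hexp : IsExpanding U (ksMetric H k) k) :
    -- the optical matrix is normal, in every null frame
    (∀ x ∈ U, ∀ l e, IsNullFrame (ksMetric H k x) (k x) l e →
      opticalMatrix (ksMetric H k) k x e * (opticalMatrix (ksMetric H k) k x e)ᵀ =
        (opticalMatrix (ksMetric H k) k x e)ᵀ * opticalMatrix (ksMetric H k) k x e) ∧
    -- the rank is at least 2, apart from regions where the metric is flat
    (∀ V : Set (Vec n), IsOpen V → V ⊆ U →
      (∃ x ∈ V, ∃ a b c d, riemann (ksMetric H k) a b c d x ≠ 0) →
      ∃ x ∈ V, ∀ l e, IsNullFrame (ksMetric H k x) (k x) l e →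
        2 ≤ (opticalMatrix (ksMetric H k) k x e).rank) ∧
    -- `k` is geodetic, hence can be rescaled to an affine parametrization
    (∃ c : Vec n → ℝ, IsAffineRescaling U (ksMetric H k) k c) ∧
    -- the canonical form, for every affine parametrization `c k` of `k`;
    -- the metric is that of the pair `c k`, `H / c ^ 2`
    (∀ c : Vec n → ℝ, IsAffineRescaling U (ksMetric H k) k c →
      ∃ r : Vec n → ℝ, ContDiffOn ℝ ∞ r U ∧ (∀ x ∈ U, r x ≠ 0) ∧
        (∀ x ∈ U, fderiv ℝ r x (raise (ksMetric H k) (fun y => c y • k y) x) = 1) ∧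
        ∀ (I : Set ℝ) (γ : ℝ → Vec n),
          IsIntegralCurveIn U (ksMetric H k) (fun y => c y • k y) I γ →
          ∃ (m p : ℕ) (a : Fin p → ℝ) (H₀ : ℝ) (l : ℝ → Vec n) (e : ℝ → Fin (n - 2) → Vec n),
            2 * p ≤ m ∧ m ≤ n - 2 ∧ ContDiffOn ℝ ∞ l I ∧ ContDiffOn ℝ ∞ e I ∧
            ∀ s ∈ I,
              IsNullFrame (ksMetric H k (γ s)) (c (γ s) • k (γ s)) (l s) (e s) ∧
              (opticalMatrix (ksMetric H k) (fun y => c y • k y) (γ s) (e s)).rank = m ∧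
              opticalMatrix (ksMetric H k) (fun y => c y • k y) (γ s) (e s) =
                canonicalMatrix (n - 2) p m a (r (γ s)) ∧
              H (γ s) / c (γ s) ^ 2 =
                H₀ * r (γ s) ^ (-((m : ℤ) - 2 * (p : ℤ) - 1)) *
                  ∏ μ, 1 / (r (γ s) ^ 2 + a μ ^ 2)) := by
  refine ⟨fun x hx l e hf => hKS.optical_normal hvac hexp (x := ⟨x, hx⟩) hf, ?_,
    hKS.isAffineRescaling hvac, ?_⟩
  · rintro V hV hVU ⟨x, hx, a, b, c, d, hne⟩
    -- The negation supplies at each point of `V` one frame of rank below 2, which suffices to make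
    -- the metric flat on `V`.
    by_contra! hcon
    exact hne ((hKS.mono hV hVU).riemann_eq_zero (fun y hy => hvac y (hVU hy))
      (fun y hy => hexp y (hVU hy)) hcon a b c d ⟨x, hx⟩)
  · intro c hc
    set ρ := hKS.affineRadius hc hvac hexp with hρ
    refine ⟨extendZero ρ, ρ.2, fun x hx => ?_, fun x hx => ?_, fun I γ hγ => ?_⟩
    · rw [extendZero_apply _ hx]
      exact hKS.affineRadius_ne_zero hc hvac hexp ⟨x, hx⟩
    · rw [hKS.fderiv_raise (hKS.rescaled_eq hc) ρ ⟨x, hx⟩, hKS.dirD_affineRadius hc hvac hexp,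
        map_one]
    · rcases I.eq_empty_or_nonempty with rfl | ⟨s₀, hs₀⟩
      -- On the empty interval there is nothing to check, so any values serve; otherwise a base
      -- point `s₀` fixes the constants.
      · exact ⟨0, 0, Fin.elim0, 0, 0, 0, le_rfl, Nat.zero_le _, contDiffOn_empty, contDiffOn_empty,
          fun s hs => hs.elim⟩
      obtain ⟨p, q, z, a, l₀, e, hd, hf₀, hcan₀⟩ :=
        hKS.exists_canonical_frame hc hvac hexp ⟨γ s₀, hγ.mem s₀ hs₀⟩
      obtain ⟨l, hl, hf⟩ := hKS.frame_along hc hvac hγ hs₀ hf₀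
      have hcan := fun s (hs : s ∈ I) =>
        hKS.canonical_along hc hvac hexp hγ hs₀ hd hf hcan₀ hs
      obtain ⟨H₀, hH⟩ := hKS.profile_along hc hvac hexp hγ hs₀ hd hf hcan
      -- The rank is m = 2p + q, where q counts the diagonal entries 1/r.
      refine ⟨2 * p + q, p, a, H₀, l, fun _ => e, Nat.le_add_right _ _, by omega, hl,
        contDiffOn_const, fun s hs => ?_⟩
      have hL : opticalMatrix (ksMetric H k) (fun y => c y • k y) (γ s) e =
          canonicalMatrix (n - 2) p (2 * p + q) a (extendZero ρ (γ s)) := by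
        rw [extendZero_apply _ (hγ.mem s hs)]
        exact (hKS.opticalMatrix_rescaled hc hvac (x := ⟨γ s, hγ.mem s hs⟩) (hf s hs)).trans
          (hcan s hs)
      have hr : extendZero ρ (γ s) ≠ 0 := by
        rw [extendZero_apply _ (hγ.mem s hs)]
        exact hKS.affineRadius_ne_zero hc hvac hexp ⟨γ s, hγ.mem s hs⟩
      refine ⟨hf s hs, ?_, hL, ?_⟩
      · rw [hL, hd]
        exact rank_canonicalMatrix a hr
      · have hq : -(((2 * p + q : ℕ) : ℤ) - 2 * (p : ℤ) - 1) = -((q : ℤ) - 1) := by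
          push_cast; ring
        rw [hq]
        exact hH s hs
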